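/- Let $n\ge 0$ products $\{1,\dots,n\}$ be given with prices $r_1\ge r_2\ge\dots\ge r_n\ge 0$ and attraction parameters $v_1,\dots,v_n\ge 0$. Under the multinomial logit (MNL) model with outside option of attraction $1$, a customer who is offered $S\subseteq\{1,\dots,n\}$ buys product $i$ with probability $\phi(i,S)=v_i/(1+\sum_{j\in S}v_j)$ if $i\in S$, and $\phi(i,S)=0$ otherwise; let $R(S)=\sum_{i\in S} r_i\,\phi(i,S)$. For a number of customers $T\ge 0$ and an inventory vector $\mathbf{c}\in\mathbb{Z}_{\ge 0}^n$, define $$f_{LP}(\mathbf{c},T)=\max_{y\ge 0}\Big\{T\sum_{S}y(S)R(S)\ :\ T\sum_{S}y(S)\phi(i,S)\le c_i\ \text{ for all } i,\ \ \sum_{S}y(S)=1\Big\},$$ where $S$ ranges over all subsets of $\{1,\dots,n\}$. The feasible region $\mathcal{F}\subseteq\mathbb{Z}_{\ge 0}^n$ is given either by a cardinality constraint $\sum_i c_i\le K$ with $K\in\mathbb{Z}_{\ge 0}$, or by a budget constraint $\sum_i b_ic_i\le B$ with $b_i\ge 0$ and $B\ge 0$. **Theorem.** Let $\epsilon\in(0,1)$.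 For each of the two kinds of feasible region there is an algorithm that, given any instance with rational data $r_i,v_i,T$ and $K$ (respectively $b_i,B$), outputs some $\mathbf{c}\in\mathcal{F}$ with $$f_{LP}(\mathbf{c},T)\ \ge\ \Big(1-\frac1e-\epsilon\Big)\max_{\mathbf{c}'\in\mathcal{F}}f_{LP}(\mathbf{c}',T),$$ in time polynomial in the length of the binary encoding of the instance (for fixed $\epsilon$). Here time is the logarithmic cost of a random access machine: a step is charged the bit lengths of the numbers it handles. -/

import Mathlib

/-! ### A random access machine over the rationals, with logarithmic cost -/

namespace RatRAM

/-- Number of bits of a rational number, written in lowest terms with binary numerator and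
denominator. -/
def bits (q : ℚ) : ℕ := Nat.size q.num.natAbs + Nat.size q.den

/-- Bit length of a list of rationals (one extra symbol per entry, as a separator). -/
def bitLength (l : List ℚ) : ℕ := (l.map fun q => bits q + 1).sum

/-- The memory: countably many arrays of rationals; `σ a i` is the entry `i` of the array `a`.
A program names only finitely many arrays, but addresses their entries by computed indices. -/
abbrev Memory : Type := ℕ → ℕ → ℚ

/-- Expressions. `get a i` reads the array `a` at the index given by the value of `i`. -/
inductive Expr : Type
  | const (q : ℚ) : Expr
  | get (a : ℕ) (i : Expr) : Expr
  | add (x y : Expr) : Expr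
  | sub (x y : Expr) : Expr
  | mul (x y : Expr) : Expr
  | div (x y : Expr) : Expr
  | floor (x : Expr) : Expr

/-- Value of an expression. Division by `0` gives `0`; an index is rounded down to a natural
number, negative ones to `0`. -/
def Expr.eval (σ : Memory) : Expr → ℚ
  | .const q => q
  | .get a i => σ a ⌊i.eval σ⌋₊
  | .add x y => x.eval σ + y.eval σ
  | .sub x y => x.eval σ - y.eval σ
  | .mul x y => x.eval σ * y.eval σ
  | .div x y => x.eval σ / y.eval σ
  | .floor x => (⌊x.eval σ⌋ : ℤ)

/-- Cost of evaluating an expression: every node is charged one unit plus the bit length of its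
value. The operands, and the addresses of memory accesses, are nodes themselves, so they
are charged too. -/
def Expr.cost (σ : Memory) : Expr → ℕ
  | .const q => 1 + bits q
  | .get a i => i.cost σ + (1 + bits ((Expr.get a i).eval σ))
  | .add x y => x.cost σ + y.cost σ + (1 + bits ((Expr.add x y).eval σ))
  | .sub x y => x.cost σ + y.cost σ + (1 + bits ((Expr.sub x y).eval σ))
  | .mul x y => x.cost σ + y.cost σ + (1 + bits ((Expr.mul x y).eval σ))
  | .div x y => x.cost σ + y.cost σ + (1 + bits ((Expr.div x y).eval σ))
  | .floor x => x.cost σ + (1 + bits ((Expr.floor x).eval σ))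

/-- Programs. `set a i e` stores the value of `e` in the array `a` at the index `i`;
`ite x y P Q` runs `P` if `x < y` and `Q` otherwise; `loop x y P` repeats `P` while `x < y`. -/
inductive Program : Type
  | skip : Program
  | set (a : ℕ) (i e : Expr) : Program
  | seq (P Q : Program) : Program
  | ite (x y : Expr) (P Q : Program) : Program
  | loop (x y : Expr) (P : Program) : Program

/-- The memory after storing `q` in the array `a` at the index `k`. -/
def store (σ : Memory) (a k : ℕ) (q : ℚ) : Memory :=
  Function.update σ a (Function.update (σ a) k q)

/-- `Exec P σ τ t`: started in the memory `σ`, the program `P` halts in the memory `τ`, and the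
total cost of the run is `t`. -/
inductive Exec : Program → Memory → Memory → ℕ → Prop
  | skip (σ : Memory) : Exec .skip σ σ 1
  | set (a : ℕ) (i e : Expr) (σ : Memory) :
      Exec (.set a i e) σ (store σ a ⌊i.eval σ⌋₊ (e.eval σ)) (1 + i.cost σ + e.cost σ)
  | seq {P Q : Program} {σ τ υ : Memory} {s t : ℕ} :
      Exec P σ τ s → Exec Q τ υ t → Exec (.seq P Q) σ υ (s + t)
  | ite_true {x y : Expr} {P Q : Program} {σ τ : Memory} {t : ℕ} :
      x.eval σ < y.eval σ → Exec P σ τ t →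
      Exec (.ite x y P Q) σ τ (1 + x.cost σ + y.cost σ + t)
  | ite_false {x y : Expr} {P Q : Program} {σ τ : Memory} {t : ℕ} :
      ¬ x.eval σ < y.eval σ → Exec Q σ τ t →
      Exec (.ite x y P Q) σ τ (1 + x.cost σ + y.cost σ + t)
  | loop_true {x y : Expr} {P : Program} {σ τ υ : Memory} {s t : ℕ} :
      x.eval σ < y.eval σ → Exec P σ τ s → Exec (.loop x y P) τ υ t →
      Exec (.loop x y P) σ υ (1 + x.cost σ + y.cost σ + s + t)
  | loop_false {x y : Expr} {P : Program} {σ : Memory} :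
      ¬ x.eval σ < y.eval σ → Exec (.loop x y P) σ σ (1 + x.cost σ + y.cost σ)

/-- The initial memory: the input is the beginning of the array `0`, everything else is `0`. -/
def initial (input : List ℚ) : Memory := fun a i => if a = 0 then input.getD i 0 else 0

/-- On the given input, `P` halts with total cost at most `t`, and then the array `1` begins with
the given output. -/
def Program.Computes (P : Program) (input output : List ℚ) (t : ℕ) : Prop :=
  ∃ (τ : Memory) (s : ℕ), Exec P (initial input) τ s ∧ s ≤ t ∧
    ∀ (i : ℕ) (hi : i < output.length), τ 1 i = output[i]

end RatRAM

/-! ### Maximization problems and polynomial time approximation -/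

/-- A maximization problem: instances, their encoding as lists of rationals, the candidate
solutions of each instance with their encoding, the feasible ones, and the objective. -/
structure MaxProblem where
  Inst : Type
  encode : Inst → List ℚ
  Sol : Inst → Type
  encodeSol : (I : Inst) → Sol I → List ℚ
  feasible : (I : Inst) → Set (Sol I)
  value : (I : Inst) → Sol I → ℝ

/-- One program, of cost at most a polynomial in the bit length of the instance, outputs for every
instance a feasible solution whose value is at least `ρ` times that of every feasible one. -/
def MaxProblem.PolyTimeApprox (M : MaxProblem) (ρ : ℝ) : Prop :=
  ∃ (P : RatRAM.Program) (p : Polynomial ℕ), ∀ I : M.Inst, ∃ s ∈ M.feasible I,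
    P.Computes (M.encode I) (M.encodeSol I s) (p.eval (RatRAM.bitLength (M.encode I))) ∧
    ∀ s' ∈ M.feasible I, ρ * M.value I s' ≤ M.value I s

/-! ### The choice-based deterministic linear program under the multinomial logit model -/

namespace Assortment

/-- Probability that a customer who is offered `S` buys product `i`, under the multinomial logit
model with attraction parameters `v` and outside option of attraction `1`. -/
noncomputable def choiceProb {n : ℕ} (v : Fin n → ℝ) (i : Fin n) (S : Finset (Fin n)) : ℝ :=
  if i ∈ S then v i / (∑ j ∈ S, v j + 1) else 0

/-- Expected revenue from one customer who is offered `S`. -/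
noncomputable def revenue {n : ℕ} (r v : Fin n → ℝ) (S : Finset (Fin n)) : ℝ :=
  ∑ i, r i * choiceProb v i S

/-- Feasible mixes of assortments for inventory `c` and horizon `T`. -/
def IsMix {n : ℕ} (v c : Fin n → ℝ) (T : ℝ) (y : Finset (Fin n) → ℝ) : Prop :=
  (∀ S, 0 ≤ y S) ∧ (∀ i, T * ∑ S, y S * choiceProb v i S ≤ c i) ∧ ∑ S, y S = 1

/-- Optimal value of the choice-based deterministic linear program. For nonnegative `v`, `c`, `T`
the feasible set is nonempty and compact, so that the supremum is a maximum. -/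
noncomputable def fLP {n : ℕ} (r v c : Fin n → ℝ) (T : ℝ) : ℝ :=
  sSup {x : ℝ | ∃ y, IsMix v c T y ∧ x = T * ∑ S, y S * revenue r v S}

/-- The products, sorted by descending price, with their prices and attraction parameters, and the
number of customers (any nonnegative number, for instance the mean of a random one). -/
structure Market where
  n : ℕ
  r : Fin n → ℚ
  v : Fin n → ℚ
  T : ℚ
  r_nonneg : ∀ i, 0 ≤ r i
  r_antitone : Antitone r
  v_nonneg : ∀ i, 0 ≤ v i
  T_nonneg : 0 ≤ T

/-- Fluid revenue of stocking `c i` units of each product `i`. -/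
noncomputable def Market.fluidRevenue (M : Market) (c : Fin M.n → ℕ) : ℝ :=
  fLP (fun i => (M.r i : ℝ)) (fun i => (M.v i : ℝ)) (fun i => (c i : ℝ)) (M.T : ℝ)

/-- The list `n, T, r₁, …, rₙ, v₁, …, vₙ`. -/
def Market.encode (M : Market) : List ℚ :=
  (M.n : ℚ) :: M.T :: (List.ofFn M.r ++ List.ofFn M.v)

/-- A market with a bound `K` on the total number of units. -/
structure CardInst extends Market where
  K : ℕ

/-- A market with unit costs `b` and a budget `B`. -/
structure BudgetInst extends Market where
  b : Fin n → ℚ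
  B : ℚ
  b_nonneg : ∀ i, 0 ≤ b i
  B_nonneg : 0 ≤ B

/-- Maximize the fluid revenue over integral inventories with at most `K` units in total. -/
noncomputable def cardProblem : MaxProblem where
  Inst := CardInst
  encode I := I.toMarket.encode ++ [(I.K : ℚ)]
  Sol I := Fin I.n → ℕ
  encodeSol _ c := List.ofFn fun i => (c i : ℚ)
  feasible I := {c | ∑ i, c i ≤ I.K}
  value I c := I.toMarket.fluidRevenue c

/-- Maximize the fluid revenue over integral inventories of total cost at most `B`. -/
noncomputable def budgetProblem : MaxProblem where
  Inst := BudgetInst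
  encode I := I.toMarket.encode ++ (List.ofFn I.b ++ [I.B])
  Sol I := Fin I.n → ℕ
  encodeSol _ c := List.ofFn fun i => (c i : ℚ)
  feasible I := {c | ∑ i, I.b i * (c i : ℚ) ≤ I.B}
  value I c := I.toMarket.fluidRevenue c

end Assortment

/-! The choice-based program over mixes of assortments is equivalent to a compact program in the
expected sales x_i of the products and x₀ of the outside option: maximize ∑ r_i x_i subject to 0 ≤
x_i ≤ min(c_i, v_i x₀) and ∑ x_i + x₀ ≤ T (`IsMix.sales`, `exists_isMix_of_sales`). Once x₀ is
fixed, the products interact only through the capacity W = T - x₀ and the budget, as in a knapsack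
problem with two resources. A dynamic program with coarse rounding solves it within the factor
(8/9)^3 > 2/3 > 1 - 1/e, so one program serves all ε. A cardinality constraint is a budget with unit
costs.

Three roundings cost a factor 8/9 each. (1) x₀ is rounded down to some T (8/9)^(k+1) and all sales
are scaled by 8/9; since x₀ ≥ T / (1 + ∑ v_i) may be assumed, polynomially many k suffice. (2) The
revenue of each product is rounded down to a multiple of g, where 8 n g is the largest revenue that
a single product j can earn within the guess. The rounding loses at most n g, and 8 n g is itself
attained by a plan, so the loss is at most 1/8 of the value found. These two factors are lost in
`Data.le_of_dominates`. (3) The sales are rounded down to slots of size W / (8 n); the capacity is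
then exceeded by a factor of at most 9/8, which scaling by 8/9 repairs (`Guess.sells_of_plan`).
Inventories are the amounts rounded up. This costs nothing against an integral competitor: amount ≤
c_i implies ⌈amount⌉ ≤ c_i.

For each pair (j, k), the table holds the least cost of every total of revenue units (at most 8 n²)
and of slots (at most 8 n), together with a plan attaining it, coded as one number.

The running time rests on heights, which are submultiplicative under the four arithmetic operations.
Since table entries are costs and codes of actual plans, their heights are bounded by what they mean
and do not grow along the computation. If all stored numbers have height at most 2^β and every loop
makes at most R iterations, the cost of a fixed program is at most a polynomial in R times β + 1;
the predicate `Halts` carries this bound together with the postcondition. -/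

namespace RatRAM

/-! ### Heights of rational numbers -/

/-- The height of `q`, numerator plus denominator, is at most `2 ^ m`. -/
def HeightLE (m : ℕ) (q : ℚ) : Prop := q.num.natAbs + q.den ≤ 2 ^ m

theorem HeightLE.mono {m m' : ℕ} {q : ℚ} (h : HeightLE m q) (hm : m ≤ m') : HeightLE m' q :=
  le_trans h (Nat.pow_le_pow_right (by norm_num) hm)

/-- Reduction to lowest terms divides numerator and denominator, so any fraction representing `q`
bounds its height and no gcd has to be tracked. -/
theorem natAbs_num_add_den_le {q : ℚ} {a : ℤ} {b : ℕ} (hb : 0 < b) (h : q = a / b) :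
    q.num.natAbs + q.den ≤ a.natAbs + b := by
  have hq : q = Rat.divInt a b := by rw [h, Rat.divInt_eq_div]; simp
  have hb' : (b : ℤ) ≠ 0 := by exact_mod_cast hb.ne'
  have h1 : q.num ∣ a := hq ▸ Rat.num_dvd a hb'
  have h2 : (q.den : ℤ) ∣ b := hq ▸ Rat.den_dvd a b
  have h4 : q.den ≤ b := Nat.le_of_dvd hb (by exact_mod_cast h2)
  have h3 : q.num.natAbs ≤ a.natAbs := by
    rcases eq_or_ne a 0 with rfl | ha
    · have : q = 0 := by rw [h]; simp
      simp [this]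
    · exact Nat.le_of_dvd (Int.natAbs_pos.2 ha) (Int.natAbs_dvd_natAbs.2 h1)
  omega

theorem HeightLE.of_eq_div {m : ℕ} {q : ℚ} {a : ℤ} {b : ℕ} (hb : 0 < b) (h : q = a / b)
    (hm : a.natAbs + b ≤ 2 ^ m) : HeightLE m q :=
  (natAbs_num_add_den_le hb h).trans hm

theorem heightLE_zero {m : ℕ} : HeightLE m 0 := by
  simpa [HeightLE] using Nat.one_le_two_pow

theorem heightLE_natCast {m k : ℕ} (h : k + 1 ≤ 2 ^ m) : HeightLE m (k : ℚ) := by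
  simpa [HeightLE] using h

theorem heightLE_one : HeightLE 1 1 := by
  simp [HeightLE]

theorem heightLE_bits (q : ℚ) : HeightLE (bits q) q := by
  have h1 := Nat.lt_size_self q.num.natAbs
  have h2 := Nat.lt_size_self q.den
  unfold HeightLE bits
  rw [pow_add]
  have := Nat.mul_le_mul (Nat.succ_le_of_lt h1) (Nat.succ_le_of_lt h2)
  simp only [Nat.succ_eq_add_one] at this
  nlinarith [Nat.zero_le (q.num.natAbs * q.den)]

theorem HeightLE.bits_le {m : ℕ} {q : ℚ} (h : HeightLE m q) : bits q ≤ 2 * m + 1 := by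
  unfold HeightLE at h
  have hd := q.den_pos
  have h1 : q.num.natAbs.size ≤ m := Nat.size_le.2 (by omega)
  have h2 : q.den.size ≤ m + 1 := Nat.size_le.2 (by rw [pow_succ]; omega)
  unfold bits
  omega

/-- The product (|a| + b)(|c| + d) contains |a| d, |c| b and b d among its terms, so it bounds the
height of a/b + c/d. Hence exponents add up, just as for products. -/
theorem HeightLE.add {m m' : ℕ} {x y : ℚ} (hx : HeightLE m x) (hy : HeightLE m' y) :
    HeightLE (m + m') (x + y) := by
  have hdx := x.den_pos
  have hdy := y.den_pos
  refine HeightLE.of_eq_div (a := x.num * y.den + y.num * x.den) (b := x.den * y.den)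
    (Nat.mul_pos hdx hdy) ?_ ?_
  · push_cast
    have hx' : (x.den : ℚ) ≠ 0 := by exact_mod_cast hdx.ne'
    have hy' : (y.den : ℚ) ≠ 0 := by exact_mod_cast hdy.ne'
    conv_lhs => rw [← Rat.num_div_den x, ← Rat.num_div_den y]
    field_simp
  · have h1 := Int.natAbs_add_le (x.num * y.den) (y.num * x.den)
    simp only [Int.natAbs_mul, Int.natAbs_natCast] at h1
    unfold HeightLE at hx hy
    rw [pow_add]
    have := Nat.mul_le_mul hx hy
    nlinarith [Nat.zero_le (x.num.natAbs * y.num.natAbs)]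

theorem HeightLE.neg {m : ℕ} {x : ℚ} (hx : HeightLE m x) : HeightLE m (-x) := by
  simpa [HeightLE] using hx

theorem HeightLE.sub {m m' : ℕ} {x y : ℚ} (hx : HeightLE m x) (hy : HeightLE m' y) :
    HeightLE (m + m') (x - y) := by
  rw [sub_eq_add_neg]
  exact hx.add hy.neg

theorem HeightLE.mul {m m' : ℕ} {x y : ℚ} (hx : HeightLE m x) (hy : HeightLE m' y) :
    HeightLE (m + m') (x * y) := by
  have hdx := x.den_pos
  have hdy := y.den_pos
  refine HeightLE.of_eq_div (a := x.num * y.num) (b := x.den * y.den)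
    (Nat.mul_pos hdx hdy) ?_ ?_
  · push_cast
    conv_lhs => rw [← Rat.num_div_den x, ← Rat.num_div_den y]
    rw [div_mul_div_comm]
  · rw [Int.natAbs_mul]
    unfold HeightLE at hx hy
    rw [pow_add]
    have := Nat.mul_le_mul hx hy
    nlinarith [Nat.zero_le (x.num.natAbs * y.den), Nat.zero_le (x.den * y.num.natAbs)]

theorem HeightLE.inv {m : ℕ} {x : ℚ} (hx : HeightLE m x) : HeightLE m x⁻¹ := by
  rcases eq_or_ne x 0 with rfl | h0
  · simpa using hx
  · have hn : 0 < x.num.natAbs := Int.natAbs_pos.2 (Rat.num_ne_zero.2 h0)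
    refine HeightLE.of_eq_div (a := x.num.sign * x.den) (b := x.num.natAbs) hn ?_ ?_
    · have h1 : (x.num.natAbs : ℚ) = x.num.sign * x.num := by
        have := congrArg (fun z : ℤ => (z : ℚ)) (Int.sign_mul_self_eq_natAbs x.num)
        push_cast at this
        rw [this, Nat.cast_natAbs]
        push_cast
        rfl
      have hs : (x.num.sign : ℚ) ≠ 0 := by
        have : x.num.sign ≠ 0 := by simpa [Int.sign_eq_zero_iff_zero] using h0
        exact_mod_cast this
      rw [h1]
      push_cast
      rw [mul_div_mul_left _ _ hs]
      conv_lhs => rw [← Rat.num_div_den x, inv_div]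
    · have : x.num.sign.natAbs = 1 := Int.natAbs_sign_of_ne_zero (Rat.num_ne_zero.2 h0)
      rw [Int.natAbs_mul, this]
      unfold HeightLE at hx
      simp only [one_mul, Int.natAbs_natCast]
      omega

theorem HeightLE.div {m m' : ℕ} {x y : ℚ} (hx : HeightLE m x) (hy : HeightLE m' y) :
    HeightLE (m + m') (x / y) := by
  rw [div_eq_mul_inv]
  exact hx.mul hy.inv

/-- For d ≥ 1 the integer quotient of a by d is at most |a| in absolute value, also for negative a,
and the denominator drops to 1. -/
theorem HeightLE.floor {m : ℕ} {x : ℚ} (hx : HeightLE m x) : HeightLE m ((⌊x⌋ : ℤ) : ℚ) := by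
  unfold HeightLE at *
  have hd := x.den_pos
  have h : (⌊x⌋ : ℤ) = x.num / x.den := Rat.floor_def x
  have h2 : (x.num / (x.den : ℤ)).natAbs ≤ x.num.natAbs := by
    generalize x.num = a at *
    generalize x.den = d at *
    have hd' : (0 : ℤ) < d := by exact_mod_cast hd
    rcases le_or_gt 0 a with ha | ha
    · have h1 := Int.ediv_nonneg ha hd'.le
      have h2 := Int.ediv_le_self (d : ℤ) ha
      omega
    · have h1 := Int.ediv_neg_of_neg_of_pos ha hd'
      have h2 : a ≤ a / (d : ℤ) := by
        rw [Int.le_ediv_iff_mul_le hd']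
        nlinarith
      omega
  simp only [Rat.num_intCast, Rat.den_intCast, h]
  omega

theorem HeightLE.ceil {m : ℕ} {x : ℚ} (hx : HeightLE m x) : HeightLE m ((⌈x⌉ : ℤ) : ℚ) := by
  have h := hx.neg.floor.neg
  simpa [Int.floor_neg] using h

theorem heightLE_sum {m : ℕ} {f : ℕ → ℚ} {k : ℕ} (h : ∀ i < k, HeightLE m (f i)) :
    HeightLE (k * m) (∑ i ∈ Finset.range k, f i) := by
  induction k with
  | zero => simpa using heightLE_zero
  | succ k ih =>
    rw [Finset.sum_range_succ, Nat.succ_mul]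
    exact (ih fun i hi => h i (by omega)).add (h k (by omega))

theorem HeightLE.pow {m : ℕ} {x : ℚ} (hx : HeightLE m x) (k : ℕ) :
    HeightLE (k * m + 1) (x ^ k) := by
  induction k with
  | zero => simp [HeightLE]
  | succ k ih =>
    rw [pow_succ]
    exact (ih.mul hx).mono (by ring_nf; omega)

/-! ### Cost of expressions and programs -/

/-- All entries of the memory have height at most `2 ^ β`. -/
def Small (β : ℕ) (σ : Memory) : Prop := ∀ a i, HeightLE β (σ a i)

/-- Growth rate of the height of the value of an expression. -/
def Expr.weight : Expr → ℕ
  | .const q => bits q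
  | .get _ _ => 1
  | .add x y => x.weight + y.weight
  | .sub x y => x.weight + y.weight
  | .mul x y => x.weight + y.weight
  | .div x y => x.weight + y.weight
  | .floor x => x.weight

/-- A value read from memory has height at most 2^β whatever its address, so addresses carry no
weight. The `+ 1` leaves room for constants when β = 0. -/
theorem Expr.heightLE_eval {β : ℕ} {σ : Memory} (h : Small β σ) :
    ∀ e : Expr, HeightLE (e.weight * (β + 1)) (e.eval σ)
  | .const q => (heightLE_bits q).mono (by simp only [Expr.weight]; nlinarith)
  | .get a i => (h a _).mono (by simp [Expr.weight])
  | .add x y => by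
    simpa only [Expr.weight, Expr.eval, add_mul] using (x.heightLE_eval h).add (y.heightLE_eval h)
  | .sub x y => by
    simpa only [Expr.weight, Expr.eval, add_mul] using (x.heightLE_eval h).sub (y.heightLE_eval h)
  | .mul x y => by
    simpa only [Expr.weight, Expr.eval, add_mul] using (x.heightLE_eval h).mul (y.heightLE_eval h)
  | .div x y => by
    simpa only [Expr.weight, Expr.eval, add_mul] using (x.heightLE_eval h).div (y.heightLE_eval h)
  | .floor x => (x.heightLE_eval h).floor

/-- Growth rate of the cost of an expression. -/
def Expr.costRate : Expr → ℕ
  | .const q => 1 + bits q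
  | .get _ i => i.costRate + 4
  | .add x y => x.costRate + y.costRate + (2 + 2 * (x.weight + y.weight))
  | .sub x y => x.costRate + y.costRate + (2 + 2 * (x.weight + y.weight))
  | .mul x y => x.costRate + y.costRate + (2 + 2 * (x.weight + y.weight))
  | .div x y => x.costRate + y.costRate + (2 + 2 * (x.weight + y.weight))
  | .floor x => x.costRate + (2 + 2 * x.weight)

theorem Expr.cost_le {β : ℕ} {σ : Memory} (h : Small β σ) :
    ∀ e : Expr, e.cost σ ≤ e.costRate * (β + 1)
  | .const q => by simp only [Expr.cost, Expr.costRate]; nlinarith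
  | .get a i => by
    have h1 := i.cost_le h
    have h2 := ((Expr.get a i).heightLE_eval h).bits_le
    simp only [Expr.cost, Expr.costRate, Expr.weight] at *
    nlinarith
  | .add x y => by
    have h1 := x.cost_le h
    have h2 := y.cost_le h
    have h3 := ((Expr.add x y).heightLE_eval h).bits_le
    simp only [Expr.cost, Expr.costRate, Expr.weight] at *
    nlinarith
  | .sub x y => by
    have h1 := x.cost_le h
    have h2 := y.cost_le h
    have h3 := ((Expr.sub x y).heightLE_eval h).bits_le
    simp only [Expr.cost, Expr.costRate, Expr.weight] at *
    nlinarith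
  | .mul x y => by
    have h1 := x.cost_le h
    have h2 := y.cost_le h
    have h3 := ((Expr.mul x y).heightLE_eval h).bits_le
    simp only [Expr.cost, Expr.costRate, Expr.weight] at *
    nlinarith
  | .div x y => by
    have h1 := x.cost_le h
    have h2 := y.cost_le h
    have h3 := ((Expr.div x y).heightLE_eval h).bits_le
    simp only [Expr.cost, Expr.costRate, Expr.weight] at *
    nlinarith
  | .floor x => by
    have h1 := x.cost_le h
    have h3 := ((Expr.floor x).heightLE_eval h).bits_le
    simp only [Expr.cost, Expr.costRate, Expr.weight] at *
    nlinarith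

open Polynomial in
/-- Growth rate of the cost of a program, as a polynomial in a bound on the number of iterations
of each loop. -/
noncomputable def Program.costPoly : Program → Polynomial ℕ
  | .skip => 1
  | .set _ i e => C (1 + i.costRate + e.costRate)
  | .seq P Q => P.costPoly + Q.costPoly
  | .ite x y P Q => C (1 + x.costRate + y.costRate) + P.costPoly + Q.costPoly
  | .loop x y P => (X + 1) * (C (1 + x.costRate + y.costRate) + P.costPoly)

/-- `P` writes to the array `a`. -/
def Program.writes : Program → ℕ → Bool
  | .skip, _ => false
  | .set b _ _, a => a == b
  | .seq P Q, a => P.writes a || Q.writes a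
  | .ite _ _ P Q, a => P.writes a || Q.writes a
  | .loop _ _ P, a => P.writes a

/-- Since `writes` is a syntactic Boolean, the frame condition of a concrete program is decided by
`rfl`. -/
theorem Exec.frame {P : Program} {σ τ : Memory} {t : ℕ} (h : Exec P σ τ t) {a : ℕ}
    (ha : P.writes a = false) : τ a = σ a := by
  induction h with
  | skip => rfl
  | set b i e σ =>
    have : a ≠ b := by simpa [Program.writes] using ha
    simp [store, Function.update_of_ne this]
  | seq _ _ ih1 ih2 =>
    simp only [Program.writes, Bool.or_eq_false_iff] at ha
    rw [ih2 ha.2, ih1 ha.1]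
  | ite_true _ _ ih =>
    simp only [Program.writes, Bool.or_eq_false_iff] at ha
    exact ih ha.1
  | ite_false _ _ ih =>
    simp only [Program.writes, Bool.or_eq_false_iff] at ha
    exact ih ha.2
  | loop_true _ _ _ ih1 ih2 =>
    simp only [Program.writes] at ha
    rw [ih2 ha, ih1 ha]
  | loop_false => rfl

/-- Started in `σ`, the program `P` halts in a memory of small entries that satisfies `Q`, and
with a cost within the bound given by `Program.costPoly` if each loop makes at most `R`
iterations. -/
def Halts (R β : ℕ) (P : Program) (σ : Memory) (Q : Memory → Prop) : Prop :=
  ∃ τ s, Exec P σ τ s ∧ s ≤ P.costPoly.eval R * (β + 1) ∧ Small β τ ∧ Q τ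

/-! ### Proof rules for termination, cost and correctness -/

section Rules

variable {R β : ℕ} {P P' : Program} {σ : Memory} {Q Q' : Memory → Prop}

theorem Halts.mono (h : Halts R β P σ Q) (hQ : ∀ τ, Q τ → Q' τ) : Halts R β P σ Q' :=
  let ⟨τ, s, h1, h2, h3, h4⟩ := h
  ⟨τ, s, h1, h2, h3, hQ τ h4⟩

/-- Arrays to which a program does not write keep their entries. -/
theorem Halts.frame (h : Halts R β P σ Q) :
    Halts R β P σ fun τ => Small β τ ∧ (∀ a, P.writes a = false → τ a = σ a) ∧ Q τ :=
  let ⟨τ, s, h1, h2, h3, h4⟩ := h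
  ⟨τ, s, h1, h2, h3, h3, fun _ ha => h1.frame ha, h4⟩

theorem Halts.skip (hσ : Small β σ) (h : Q σ) : Halts R β .skip σ Q :=
  ⟨σ, 1, .skip σ, by simp [Program.costPoly], hσ, h⟩

theorem Small.store {a k : ℕ} {q : ℚ} (hσ : Small β σ) (hq : HeightLE β q) :
    Small β (store σ a k q) := by
  intro b i
  unfold RatRAM.store
  rcases eq_or_ne b a with rfl | hb
  · rcases eq_or_ne i k with rfl | hi
    · simpa using hq
    · simpa [Function.update_of_ne hi] using hσ b i
  · simpa [Function.update_of_ne hb] using hσ b i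

/-- Only the stored value needs an explicit height bound; intermediate values and the address are
paid for by `costRate`. -/
theorem Halts.set {a : ℕ} {i e : Expr} (hσ : Small β σ) (he : HeightLE β (e.eval σ))
    (h : Q (store σ a ⌊i.eval σ⌋₊ (e.eval σ))) : Halts R β (.set a i e) σ Q := by
  refine ⟨_, _, .set a i e σ, ?_, hσ.store he, h⟩
  have h1 := i.cost_le hσ
  have h2 := e.cost_le hσ
  simp only [Program.costPoly, Polynomial.eval_C]
  nlinarith

theorem Halts.seq (h : Halts R β P σ fun τ => Halts R β P' τ Q) : Halts R β (.seq P P') σ Q := by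
  obtain ⟨τ, s, h1, h2, -, υ, t, h3, h4, h5, h6⟩ := h
  refine ⟨υ, s + t, .seq h1 h3, ?_, h5, h6⟩
  simp only [Program.costPoly, Polynomial.eval_add]
  nlinarith

theorem Halts.ite {x y : Expr} (hσ : Small β σ) (h1 : x.eval σ < y.eval σ → Halts R β P σ Q)
    (h2 : ¬ x.eval σ < y.eval σ → Halts R β P' σ Q) : Halts R β (.ite x y P P') σ Q := by
  have hx := x.cost_le hσ
  have hy := y.cost_le hσ
  by_cases h : x.eval σ < y.eval σ
  · obtain ⟨τ, s, h3, h4, h5, h6⟩ := h1 h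
    refine ⟨τ, _, .ite_true h h3, ?_, h5, h6⟩
    simp only [Program.costPoly, Polynomial.eval_C, Polynomial.eval_add]
    nlinarith [Nat.zero_le (P'.costPoly.eval R * (β + 1))]
  · obtain ⟨τ, s, h3, h4, h5, h6⟩ := h2 h
    refine ⟨τ, _, .ite_false h h3, ?_, h5, h6⟩
    simp only [Program.costPoly, Polynomial.eval_C, Polynomial.eval_add]
    nlinarith [Nat.zero_le (P.costPoly.eval R * (β + 1))]

/-- Induction on the number `d` of iterations that may still occur. The factor `d + 1` accounts for
the final, failing test. -/
theorem Halts.loop_aux {x y : Expr} (I : ℕ → Memory → Prop) (N : ℕ)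
    (hstep : ∀ k σ, Small β σ → I k σ → x.eval σ < y.eval σ → k < N ∧ Halts R β P σ (I (k + 1)))
    (d : ℕ) : ∀ (k : ℕ) (σ : Memory), k + d = N → Small β σ → I k σ →
      ∃ τ s, Exec (.loop x y P) σ τ s ∧
        s ≤ (d + 1) * ((1 + x.costRate + y.costRate + P.costPoly.eval R) * (β + 1)) ∧
        Small β τ ∧ (∃ k ≤ N, I k τ) ∧ ¬ x.eval τ < y.eval τ := by
  induction d with
  | zero =>
    intro k σ hk hσ hI
    have h : ¬ x.eval σ < y.eval σ := fun h => by
      have := (hstep k σ hσ hI h).1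
      omega
    refine ⟨σ, _, .loop_false h, ?_, hσ, ⟨k, by omega, hI⟩, h⟩
    nlinarith [x.cost_le hσ, y.cost_le hσ, Nat.zero_le (P.costPoly.eval R * (β + 1))]
  | succ d ih =>
    intro k σ hk hσ hI
    have hx := x.cost_le hσ
    have hy := y.cost_le hσ
    by_cases h : x.eval σ < y.eval σ
    · obtain ⟨τ, s, h1, h2, h3, h4⟩ := (hstep k σ hσ hI h).2
      obtain ⟨υ, t, h5, h6, h7, h8, h9⟩ := ih (k + 1) τ (by omega) h3 h4
      refine ⟨υ, _, .loop_true h h1 h5, ?_, h7, h8, h9⟩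
      rw [Nat.succ_mul (d + 1)]
      have : 1 + x.cost σ + y.cost σ + s ≤
          (1 + x.costRate + y.costRate + P.costPoly.eval R) * (β + 1) := by nlinarith
      omega
    · refine ⟨σ, _, .loop_false h, ?_, hσ, ⟨k, by omega, hI⟩, h⟩
      nlinarith [Nat.zero_le (P.costPoly.eval R * (β + 1)),
        Nat.zero_le ((d + 1) * ((1 + x.costRate + y.costRate + P.costPoly.eval R) * (β + 1)))]

/-- Loops with an invariant that counts the iterations. -/
theorem Halts.loop {x y : Expr} (I : ℕ → Memory → Prop) (N : ℕ) (hN : N ≤ R)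
    (hσ : Small β σ) (h0 : I 0 σ)
    (hstep : ∀ k σ, Small β σ → I k σ → x.eval σ < y.eval σ → k < N ∧ Halts R β P σ (I (k + 1)))
    (hQ : ∀ k τ, I k τ → ¬ x.eval τ < y.eval τ → Q τ) : Halts R β (.loop x y P) σ Q := by
  obtain ⟨τ, s, h1, h2, h3, ⟨k, -, h4⟩, h5⟩ :=
    Halts.loop_aux (R := R) (P := P) I N hstep N 0 σ (by omega) hσ h0
  refine ⟨τ, s, h1, h2.trans ?_, h3, hQ k τ h4 h5⟩
  simp only [Program.costPoly, Polynomial.eval_C, Polynomial.eval_add, Polynomial.eval_mul,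
    Polynomial.eval_X, Polynomial.eval_one]
  rw [mul_assoc]
  exact Nat.mul_le_mul (by omega) le_rfl

/-- The scalar variable kept in the array `a`. -/
def Expr.var (a : ℕ) : Expr := .get a (.const 0)

/-- Assignment to the scalar variable kept in the array `a`. -/
def Program.assign (a : ℕ) (e : Expr) : Program := .set a (.const 0) e

/-- Run `P` with the scalar variable `a` equal to `0, …, N - 1`, where `N` is the value of `y`. -/
def Program.for (a : ℕ) (y : Expr) (P : Program) : Program :=
  .seq (.assign a (.const 0))
    (.loop (.var a) y (.seq P (.assign a (.add (.var a) (.const 1)))))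

@[simp] theorem store_same (σ : Memory) (a k : ℕ) (q : ℚ) : store σ a k q a k = q := by
  simp [store]

theorem store_apply (σ : Memory) (a k : ℕ) (q : ℚ) (b i : ℕ) :
    store σ a k q b i = if b = a ∧ i = k then q else σ b i := by
  unfold store
  by_cases h : b = a
  · subst h
    by_cases h' : i = k
    · subst h'; simp
    · simp [h']
  · simp [h]

theorem store_of_ne (σ : Memory) {a b : ℕ} (h : b ≠ a) (k : ℕ) (q : ℚ) :
    store σ a k q b = σ b := by
  simp [store, Function.update_of_ne h]

@[simp] theorem Expr.eval_var (σ : Memory) (a : ℕ) : (Expr.var a).eval σ = σ a 0 := by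
  simp [Expr.var, Expr.eval]

theorem Halts.assign {a : ℕ} {e : Expr} (hσ : Small β σ) (he : HeightLE β (e.eval σ))
    (h : Q (store σ a 0 (e.eval σ))) : Halts R β (.assign a e) σ Q :=
  Halts.set hσ he (by simpa [Expr.eval] using h)

/-- Counting loops: `I` does not depend on the counter. -/
theorem Halts.for {a : ℕ} {y : Expr} (I : ℕ → Memory → Prop) (N : ℕ) (hN : N ≤ R)
    (hN' : N + 1 ≤ 2 ^ β) (hσ : Small β σ) (h0 : I 0 σ) (hP : P.writes a = false)
    (hI : ∀ k σ τ, (∀ b, b ≠ a → τ b = σ b) → I k σ → I k τ)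
    (hy : ∀ k τ, I k τ → y.eval τ = N)
    (hstep : ∀ k τ, Small β τ → I k τ → τ a 0 = k → k < N → Halts R β P τ (I (k + 1)))
    (hQ : ∀ τ, I N τ → Q τ) : Halts R β (.for a y P) σ Q := by
  refine Halts.seq (Halts.assign hσ ?_ ?_)
  · simpa [Expr.eval] using heightLE_zero
  refine Halts.loop (fun k τ => k ≤ N ∧ I k τ ∧ τ a 0 = k) N hN
    (hσ.store (by simpa [Expr.eval] using heightLE_zero)) ⟨Nat.zero_le _, ?_, ?_⟩ ?_ ?_
  · exact hI 0 σ _ (fun b hb => store_of_ne _ hb _ _) h0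
  · simp [Expr.eval]
  · rintro k τ hτ ⟨hk, hIk, hak⟩ hlt
    rw [hy k τ hIk, Expr.eval_var, hak] at hlt
    have hkN : k < N := by exact_mod_cast hlt
    refine ⟨hkN, Halts.seq ((hstep k τ hτ hIk hak hkN).frame.mono ?_)⟩
    rintro υ ⟨hυ, hfr, hIυ⟩
    have hval : (Expr.add (Expr.var a) (Expr.const 1)).eval υ = ((k + 1 : ℕ) : ℚ) := by
      simp [Expr.eval, hfr a hP, hak]
    refine Halts.assign hυ ?_ ⟨hkN, ?_, ?_⟩
    · rw [hval]
      exact heightLE_natCast (by omega)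
    · exact hI _ _ _ (fun b hb => store_of_ne _ hb _ _) hIυ
    · rw [store_same, hval]
  · rintro k τ ⟨hk, hIk, hak⟩ hlt
    rw [hy k τ hIk, Expr.eval_var, hak, not_lt] at hlt
    have : k = N := le_antisymm hk (by exact_mod_cast hlt)
    exact hQ τ (this ▸ hIk)

end Rules

end RatRAM

namespace Assortment

/-! ### The sales formulation of the linear program -/

section Sales

variable {n : ℕ} {r v c : Fin n → ℝ} {T : ℝ}

/-- Take for x_i and x₀ the expected numbers of customers who buy product i and who leave without a
purchase. An offered set S loses a customer with probability 1 / (1 + V(S)), where V(S) is the total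
attraction of S; each choice probability is at most v_i times this, and all of them add up to 1. -/
theorem IsMix.sales (hv : ∀ i, 0 ≤ v i) (hT : 0 ≤ T) {y : Finset (Fin n) → ℝ}
    (hy : IsMix v c T y) : ∃ (x : Fin n → ℝ) (x₀ : ℝ),
      (∀ i, 0 ≤ x i ∧ x i ≤ c i ∧ x i ≤ v i * x₀) ∧ 0 ≤ x₀ ∧ ∑ i, x i + x₀ ≤ T ∧
      ∑ i, r i * x i = T * ∑ S, y S * revenue r v S := by
  obtain ⟨h0, h1, h2⟩ := hy
  have hpos : ∀ S : Finset (Fin n), 0 < ∑ j ∈ S, v j + 1 := fun S =>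
    add_pos_of_nonneg_of_pos (Finset.sum_nonneg fun i _ => hv i) one_pos
  have hφ : ∀ i S, 0 ≤ choiceProb v i S := fun i S => by
    unfold choiceProb
    split_ifs
    · exact div_nonneg (hv i) (hpos S).le
    · exact le_rfl
  refine ⟨fun i => T * ∑ S, y S * choiceProb v i S, T * ∑ S, y S * (1 / (∑ j ∈ S, v j + 1)),
    fun i => ⟨?_, h1 i, ?_⟩, ?_, ?_, ?_⟩
  · exact mul_nonneg hT (Finset.sum_nonneg fun S _ => mul_nonneg (h0 S) (hφ i S))
  · rw [mul_left_comm, Finset.mul_sum]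
    refine mul_le_mul_of_nonneg_left (Finset.sum_le_sum fun S _ => ?_) hT
    rw [mul_left_comm]
    refine mul_le_mul_of_nonneg_left ?_ (h0 S)
    unfold choiceProb
    split_ifs
    · rw [mul_one_div]
    · exact mul_nonneg (hv i) (one_div_pos.2 (hpos S)).le
  · exact mul_nonneg hT (Finset.sum_nonneg fun S _ =>
      mul_nonneg (h0 S) (one_div_pos.2 (hpos S)).le)
  · rw [← Finset.mul_sum, ← mul_add, Finset.sum_comm, ← Finset.sum_add_distrib]
    have : ∀ S : Finset (Fin n), ∑ i, y S * choiceProb v i S +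
        y S * (1 / (∑ j ∈ S, v j + 1)) = y S := fun S => by
      rw [← Finset.mul_sum, ← mul_add]
      have : ∑ i, choiceProb v i S + 1 / (∑ j ∈ S, v j + 1) = 1 := by
        unfold choiceProb
        rw [← Finset.sum_filter, Finset.filter_mem_eq_inter, Finset.univ_inter,
          ← Finset.sum_div, ← add_div, div_self (hpos S).ne']
      rw [this, mul_one]
    rw [Finset.sum_congr rfl fun S _ => this S, h2, mul_one]
  · simp only [revenue, Finset.mul_sum]
    rw [Finset.sum_comm]
    exact Finset.sum_congr rfl fun S _ => Finset.sum_congr rfl fun i _ => by ring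

/-- For f + g = 1 the summands are the distribution of a random set that contains each i
independently with probability f i. General f and g also give its marginals. -/
theorem sum_prod_mul_prod_compl {ι : Type*} [Fintype ι] [DecidableEq ι] (f g : ι → ℝ) :
    ∑ S : Finset ι, (∏ i ∈ S, f i) * ∏ i ∈ Sᶜ, g i = ∏ i, (f i + g i) := by
  rw [Finset.prod_add, Finset.powerset_univ]
  exact Finset.sum_congr rfl fun S _ => by rw [Finset.compl_eq_univ_sdiff]

/-- Let w be the law of a random set containing each i independently with probability z_i = x_i /
(v_i x₀), and put y(S) = (x₀ / T) w(S) (1 + V(S)). The last factor cancels the denominator of the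
choice probability, so the sales of i become x₀ v_i P(i ∈ S) = x_i. The total mass is (x₀ / T)(1 + ∑
v_i z_i) = (x₀ + ∑ x_i) / T = 1. -/
theorem exists_isMix_of_sales (hv : ∀ i, 0 ≤ v i) (hT : 0 < T) {x : Fin n → ℝ} {x₀ : ℝ}
    (hx : ∀ i, 0 ≤ x i ∧ x i ≤ c i ∧ x i ≤ v i * x₀) (hx₀ : 0 ≤ x₀) (hsum : ∑ i, x i + x₀ = T) :
    ∃ y, IsMix v c T y ∧ ∑ i, r i * x i = T * ∑ S, y S * revenue r v S := by
  set z : Fin n → ℝ := fun i => x i / (v i * x₀) with hz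
  have hvx : ∀ i, 0 ≤ v i * x₀ := fun i => mul_nonneg (hv i) hx₀
  have hz0 : ∀ i, 0 ≤ z i := fun i => div_nonneg (hx i).1 (hvx i)
  have hz1 : ∀ i, z i ≤ 1 := fun i => div_le_one_of_le₀ (hx i).2.2 (hvx i)
  -- If v_i x₀ = 0, then x_i = 0, and the default value z_i = 0 of the division is the right one.
  have hxz : ∀ i, v i * x₀ * z i = x i := fun i => by
    rcases eq_or_ne (v i * x₀) 0 with h | h
    · have h1 := (hx i).1
      have h2 := (hx i).2.2
      rw [h] at h2 ⊢
      rw [zero_mul]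
      exact le_antisymm h1 h2
    · exact mul_div_cancel₀ _ h
  set w : Finset (Fin n) → ℝ := fun S => (∏ i ∈ S, z i) * ∏ i ∈ Sᶜ, (1 - z i) with hw
  have hw0 : ∀ S, 0 ≤ w S := fun S => mul_nonneg (Finset.prod_nonneg fun i _ => hz0 i)
    (Finset.prod_nonneg fun i _ => sub_nonneg.2 (hz1 i))
  have hw1 : ∑ S, w S = 1 := by
    rw [hw, sum_prod_mul_prod_compl]
    simp
  have hwi : ∀ i, ∑ S, (if i ∈ S then w S else 0) = z i := fun i => by
    -- Replacing the factor 1 - z_i by 0 removes exactly the sets without i; the product formula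
    -- then leaves z_i as the only factor different from 1.
    have h : ∀ S : Finset (Fin n), (if i ∈ S then w S else 0) =
        (∏ l ∈ S, z l) * ∏ l ∈ Sᶜ, Function.update (fun l => 1 - z l) i 0 l := fun S => by
      split_ifs with hi
      · refine congrArg (fun a => (∏ l ∈ S, z l) * a) (Finset.prod_congr rfl fun l hl => ?_)
        have : l ≠ i := fun h => (Finset.mem_compl.1 hl) (h ▸ hi)
        rw [Function.update_of_ne this]
      · rw [Finset.prod_eq_zero (Finset.mem_compl.2 hi) (by simp), mul_zero]
    rw [Finset.sum_congr rfl fun S _ => h S, sum_prod_mul_prod_compl,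
      Finset.prod_eq_single i]
    · simp
    · intro l _ hl
      simp [Function.update_of_ne hl]
    · simp
  have hpos : ∀ S : Finset (Fin n), 0 < ∑ j ∈ S, v j + 1 := fun S =>
    add_pos_of_nonneg_of_pos (Finset.sum_nonneg fun i _ => hv i) one_pos
  have hsale : ∀ i, T * ∑ S, (x₀ / T * w S * (∑ j ∈ S, v j + 1)) * choiceProb v i S = x i :=
    fun i => by
      rw [← hxz i, ← hwi i, Finset.mul_sum, Finset.mul_sum]
      refine Finset.sum_congr rfl fun S _ => ?_
      unfold choiceProb
      have := (hpos S).ne'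
      split_ifs
      · field_simp
      · simp
  refine ⟨fun S => x₀ / T * w S * (∑ j ∈ S, v j + 1), ⟨fun S => ?_, fun i => ?_, ?_⟩, ?_⟩
  · exact mul_nonneg (mul_nonneg (div_nonneg hx₀ hT.le) (hw0 S)) (hpos S).le
  · rw [hsale]
    exact (hx i).2.1
  · have h1 : ∀ S : Finset (Fin n), x₀ / T * w S * (∑ j ∈ S, v j + 1) =
        x₀ / T * ∑ i, v i * (if i ∈ S then w S else 0) + x₀ / T * w S := fun S => by
      simp only [mul_ite, mul_zero]
      rw [← Finset.sum_filter, Finset.filter_mem_eq_inter, Finset.univ_inter,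
        ← Finset.sum_mul]
      ring
    rw [Finset.sum_congr rfl fun S _ => h1 S, Finset.sum_add_distrib, ← Finset.mul_sum,
      ← Finset.mul_sum, hw1, Finset.sum_comm]
    simp only [← Finset.mul_sum, hwi]
    have h2 : x₀ * ∑ i, v i * z i = ∑ i, x i := by
      rw [Finset.mul_sum]
      exact Finset.sum_congr rfl fun i _ => by rw [← hxz i]; ring
    rw [mul_one, div_mul_eq_mul_div, h2, ← add_div, hsum, div_self hT.ne']
  · simp only [revenue, Finset.mul_sum]
    rw [Finset.sum_comm]
    refine Finset.sum_congr rfl fun i _ => ?_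
    rw [← hsale i, Finset.mul_sum, Finset.mul_sum]
    exact Finset.sum_congr rfl fun S _ => by ring

/-- The real supremum of an unbounded set is 0 by convention, so lower bounds on `fLP` depend on
this. -/
theorem bddAbove_fLP (hr : ∀ i, 0 ≤ r i) (hv : ∀ i, 0 ≤ v i) (hT : 0 ≤ T) :
    BddAbove {x : ℝ | ∃ y, IsMix v c T y ∧ x = T * ∑ S, y S * revenue r v S} := by
  refine ⟨∑ i, r i * c i, ?_⟩
  rintro _ ⟨y, hy, rfl⟩
  obtain ⟨x, x₀, hx, -, -, h⟩ := hy.sales (r := r) hv hT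
  rw [← h]
  exact Finset.sum_le_sum fun i _ => mul_le_mul_of_nonneg_left (hx i).2.1 (hr i)

theorem le_fLP (hr : ∀ i, 0 ≤ r i) (hv : ∀ i, 0 ≤ v i) (hT : 0 ≤ T) (hc : ∀ i, 0 ≤ c i)
    {x : Fin n → ℝ} {x₀ : ℝ}
    (hx : ∀ i, 0 ≤ x i ∧ x i ≤ c i ∧ x i ≤ v i * x₀) (hx₀ : 0 ≤ x₀) (hsum : ∑ i, x i + x₀ ≤ T) :
    ∑ i, r i * x i ≤ fLP r v c T := by
  rcases hT.eq_or_lt with rfl | hT'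
  -- For T = 0 nothing is sold and the mix cannot be normalized by T; the mix that always offers the
  -- empty set serves instead.
  · have hx0 : ∀ i, x i = 0 := fun i => by
      have h1 := Finset.single_le_sum (f := x) (fun j _ => (hx j).1) (Finset.mem_univ i)
      linarith [(hx i).1]
    refine le_csSup (bddAbove_fLP hr hv hT) ⟨fun S => if S = ∅ then 1 else 0, ⟨?_, ?_, ?_⟩, ?_⟩
    · intro S
      positivity
    · intro i
      simpa using hc i
    · simp
    · simp [hx0]
  · have hs : 0 ≤ ∑ i, x i := Finset.sum_nonneg fun i _ => (hx i).1
    obtain ⟨y, hy, h⟩ := exists_isMix_of_sales (r := r) (c := c) hv hT' (x := x)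
      -- The outside option takes all customers left over, which only relaxes x_i ≤ v_i x₀.
      (x₀ := T - ∑ i, x i)
      (fun i => ⟨(hx i).1, (hx i).2.1, (hx i).2.2.trans
        (mul_le_mul_of_nonneg_left (by linarith) (hv i))⟩) (by linarith) (by ring)
    exact le_csSup (bddAbove_fLP hr hv hT) ⟨y, hy, h⟩

theorem fLP_le (hv : ∀ i, 0 ≤ v i) (hT : 0 ≤ T) {A : ℝ} (hA : 0 ≤ A)
    (h : ∀ (x : Fin n → ℝ) (x₀ : ℝ), (∀ i, 0 ≤ x i ∧ x i ≤ c i ∧ x i ≤ v i * x₀) → 0 ≤ x₀ →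
      ∑ i, x i + x₀ ≤ T → ∑ i, r i * x i ≤ A) : fLP r v c T ≤ A := by
  refine Real.sSup_le ?_ hA
  rintro _ ⟨y, hy, rfl⟩
  obtain ⟨x, x₀, hx, hx₀, hs, he⟩ := hy.sales (r := r) hv hT
  rw [← he]
  exact h x x₀ hx hx₀ hs

end Sales

end Assortment

namespace Assortment

/-! ### Discretized plans -/

/-- The data of a budget constrained instance, as sequences. -/
structure Data where
  n : ℕ
  r : ℕ → ℚ
  v : ℕ → ℚ
  b : ℕ → ℚ
  T : ℚ
  B : ℚ

structure Data.Nonneg (D : Data) : Prop where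
  r : ∀ i, 0 ≤ D.r i
  v : ∀ i, 0 ≤ D.v i
  b : ∀ i, 0 ≤ D.b i
  T : 0 ≤ D.T
  B : 0 ≤ D.B

/-- With the inventory `c`, sales of total revenue `a` are possible. -/
def Data.Sells (D : Data) (c : ℕ → ℕ) (a : ℝ) : Prop :=
  ∃ (x : ℕ → ℝ) (x₀ : ℝ), (∀ i < D.n, 0 ≤ x i ∧ x i ≤ c i ∧ x i ≤ D.v i * x₀) ∧ 0 ≤ x₀ ∧
    ∑ i ∈ Finset.range D.n, x i + x₀ ≤ D.T ∧ ∑ i ∈ Finset.range D.n, D.r i * x i = a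

/-- Guesses for the sales `x₀` of the outside option and for a unit of revenue `g`, with the
capacity `W` that is left for the products. -/
structure Guess extends Data where
  x₀ : ℚ
  W : ℚ
  g : ℚ

namespace Guess

variable (G : Guess)

/-- The sales of product `i` that yield `p` units of revenue. -/
def amount (i p : ℕ) : ℚ := p * G.g / G.r i

/-- The sales of product `i` that yield `p` units of revenue, in units of `W / (8 n)`. -/
def slots (i p : ℕ) : ℕ := ⌊G.amount i p * (8 * G.n) / G.W⌋₊

/-- Cost of the inventory for `p` units of revenue from product `i`. -/
def price (i p : ℕ) : ℚ := G.b i * (⌈G.amount i p⌉ : ℤ)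

/-- The attraction of product `i` suffices for `p` units of revenue. -/
def Attains (i p : ℕ) : Prop := p * G.g ≤ G.r i * (G.v i * G.x₀)

/-- Cost of the first `k` products. -/
def cost (p : ℕ → ℕ) (k : ℕ) : ℚ := ∑ l ∈ Finset.range k, G.price l (p l)

/-- The first `k` products yield `P` units of revenue and take up `S` slots. -/
def Plan (k : ℕ) (p : ℕ → ℕ) (P S : ℕ) : Prop :=
  (∀ l < k, G.Attains l (p l)) ∧ ∑ l ∈ Finset.range k, p l = P ∧
    ∑ l ∈ Finset.range k, G.slots l (p l) = S

variable {G}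

theorem slots_zero (G : Guess) (i : ℕ) : G.slots i 0 = 0 := by
  simp [slots, amount]

/-- A product of price 0 attains only p g = 0, so the division by 0 in `amount` does no harm. -/
theorem mul_amount (hr : ∀ i, 0 ≤ G.r i) (hg : 0 < G.g) {i p : ℕ} (h : G.Attains i p) :
    G.r i * G.amount i p = p * G.g := by
  unfold Attains at h
  unfold amount
  rcases (hr i).eq_or_lt with h0 | h0
  · rw [← h0] at h ⊢
    have : 0 ≤ p * G.g := by positivity
    linarith
  · field_simp

theorem amount_nonneg (hr : ∀ i, 0 ≤ G.r i) (hg : 0 < G.g) (i p : ℕ) : 0 ≤ G.amount i p :=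
  div_nonneg (by positivity) (hr i)

theorem amount_le (hr : ∀ i, 0 ≤ G.r i) {i p : ℕ} {x : ℝ} (hx : 0 ≤ x)
    (h : p * (G.g : ℝ) ≤ G.r i * x) : (G.amount i p : ℝ) ≤ x := by
  unfold amount
  rcases (hr i).eq_or_lt with h0 | h0
  · rw [← h0]
    simpa using hx
  · have h0' : (0 : ℝ) < G.r i := by exact_mod_cast h0
    push_cast
    rw [div_le_iff₀ h0']
    linarith

/-- Each amount exceeds its slots by less than one slot of size W / (8 n). With at most 8 n slots in
use, the amounts total at most 9/8 of W, so 8/9 of every amount fits into the capacity. Stock and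
attraction bounds hold for the full amounts already. -/
theorem sells_of_plan (hD : G.Nonneg) (hg : 0 < G.g) (hW : 0 < G.W) (hx₀ : 0 ≤ G.x₀)
    (hT : G.W + G.x₀ ≤ G.T) {p : ℕ → ℕ} {P S : ℕ} (h : G.Plan G.n p P S) (hS : S ≤ 8 * G.n) :
    G.Sells (fun i => ⌈G.amount i (p i)⌉₊) ((8 / 9 * (P * G.g) : ℚ) : ℝ) := by
  obtain ⟨h1, h2, h3⟩ := h
  have ha := amount_nonneg hD.r hg
  refine ⟨fun i => ((8 / 9 * G.amount i (p i) : ℚ) : ℝ), (G.x₀ : ℝ), fun i hi => ⟨?_, ?_, ?_⟩,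
    ?_, ?_, ?_⟩
  · have := ha i (p i)
    beta_reduce
    exact_mod_cast (by positivity : (0 : ℚ) ≤ 8 / 9 * G.amount i (p i))
  · have h4 := Nat.le_ceil (G.amount i (p i))
    have h5 : 8 / 9 * G.amount i (p i) ≤ (⌈G.amount i (p i)⌉₊ : ℚ) := by
      linarith [ha i (p i)]
    beta_reduce
    exact_mod_cast h5
  · have h4 : G.amount i (p i) ≤ G.v i * G.x₀ := by
      have := amount_le (G := G) (i := i) (p := p i) (x := ((G.v i * G.x₀ : ℚ) : ℝ)) hD.r
        (by exact_mod_cast mul_nonneg (hD.v i) hx₀) (by exact_mod_cast h1 i hi)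
      exact_mod_cast this
    have h5 : 8 / 9 * G.amount i (p i) ≤ G.v i * G.x₀ := by linarith [ha i (p i)]
    beta_reduce
    exact_mod_cast h5
  · exact_mod_cast hx₀
  · have h4 : ∀ i, G.amount i (p i) * (8 * G.n) ≤ (G.slots i (p i) + 1) * G.W := fun i => by
      rw [← div_le_iff₀ hW]
      exact (Nat.lt_floor_add_one _).le
    have h5 : (∑ i ∈ Finset.range G.n, G.amount i (p i)) * (8 * G.n) ≤ (S + G.n) * G.W := by
      rw [← h3, Finset.sum_mul]
      refine (Finset.sum_le_sum fun i _ => h4 i).trans_eq ?_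
      rw [← Finset.sum_mul, Finset.sum_add_distrib]
      simp
    have h6 : 8 / 9 * ∑ i ∈ Finset.range G.n, G.amount i (p i) ≤ G.W := by
      rcases Nat.eq_zero_or_pos G.n with h0 | h0
      · simp [h0, hW.le]
      · have h0' : (0 : ℚ) < G.n := by exact_mod_cast h0
        have hS' : (S : ℚ) ≤ 8 * G.n := by exact_mod_cast hS
        have h7 : (S + G.n) * G.W ≤ (9 * G.n) * G.W :=
          mul_le_mul_of_nonneg_right (by linarith) hW.le
        have h8 : (∑ i ∈ Finset.range G.n, G.amount i (p i)) * 8 * G.n ≤ 9 * G.W * G.n := by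
          linarith
        have := le_of_mul_le_mul_right h8 h0'
        linarith
    have h7 : ∑ i ∈ Finset.range G.n, 8 / 9 * G.amount i (p i) + G.x₀ ≤ G.T := by
      rw [← Finset.mul_sum]
      linarith
    beta_reduce
    exact_mod_cast h7
  · have h4 : ∑ i ∈ Finset.range G.n, G.r i * (8 / 9 * G.amount i (p i)) = 8 / 9 * (P * G.g) := by
      rw [← h2, Nat.cast_sum, Finset.sum_mul, Finset.mul_sum]
      refine Finset.sum_congr rfl fun i hi => ?_
      rw [← mul_amount hD.r hg (h1 i (Finset.mem_range.1 hi))]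
      ring
    beta_reduce
    exact_mod_cast h4

end Guess

/-! ### Near-optimality of the best discretized plan -/

namespace Data

variable {D : Data}


/-- The most that can be sold of product `j` alone. -/
def peak (D : Data) (j : ℕ) (x₀ W : ℚ) : ℚ :=
  if D.B < D.b j * (⌈min (D.v j * x₀) W⌉ : ℤ) then (⌊D.B / D.b j⌋ : ℤ) else min (D.v j * x₀) W

/-- The guess given by the product `j` and the number `k`. -/
def guess (D : Data) (j k : ℕ) : Guess where
  toData := D
  x₀ := D.T * (8 / 9) ^ (k + 1)
  W := D.T - D.T * (8 / 9) ^ (k + 1)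
  g := D.r j * D.peak j (D.T * (8 / 9) ^ (k + 1)) (D.T - D.T * (8 / 9) ^ (k + 1)) / (8 * D.n)

/-- All plans of the guess yield at most the revenue `a`. -/
def Dominates (G : Guess) (a : ℚ) : Prop :=
  0 < G.g → ∀ p P S, G.Plan G.n p P S → P ≤ 8 * G.n * G.n → S ≤ 8 * G.n → G.cost p G.n ≤ G.B →
    P * G.g ≤ a

/-- If the budget binds, the integer ⌊B / b_j⌋ is less than the ceiling of the minimum, hence less
than the minimum itself. -/
theorem peak_le_left (hD : D.Nonneg) {j : ℕ} {x₀ W : ℚ} (hx : 0 ≤ x₀) (hW : 0 ≤ W) :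
    D.peak j x₀ W ≤ min (D.v j * x₀) W := by
  unfold peak
  split_ifs with h
  · have hm : 0 ≤ min (D.v j * x₀) W := le_min (mul_nonneg (hD.v j) hx) hW
    have hb : 0 < D.b j := (hD.b j).lt_of_ne fun h0 => by
      rw [← h0, zero_mul] at h
      exact absurd hD.B (not_le.2 h)
    have h1 : ⌊D.B / D.b j⌋ < ⌈min (D.v j * x₀) W⌉ := by
      rw [Int.floor_lt, div_lt_iff₀ hb]
      linarith
    exact (Int.lt_ceil.1 h1).le
  · exact le_rfl

theorem peak_nonneg (hD : D.Nonneg) {j : ℕ} {x₀ W : ℚ} (hx : 0 ≤ x₀) (hW : 0 ≤ W) :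
    0 ≤ D.peak j x₀ W := by
  unfold peak
  split_ifs with h
  · exact_mod_cast Int.floor_nonneg.2 (div_nonneg hD.B (hD.b j))
  · exact le_min (mul_nonneg (hD.v j) hx) hW

theorem mul_ceil_peak_le (hD : D.Nonneg) (j : ℕ) (x₀ W : ℚ) :
    D.b j * (⌈D.peak j x₀ W⌉ : ℤ) ≤ D.B := by
  unfold peak
  split_ifs with h
  · rw [Int.ceil_intCast]
    rcases (hD.b j).eq_or_lt with h0 | h0
    · rw [← h0, zero_mul]
      exact hD.B
    · have := (le_div_iff₀ h0).1 (Int.floor_le (D.B / D.b j))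
      linarith
  · exact not_lt.1 h

/-- Here the integrality of the stock enters: an affordable `c` is at most ⌊B / b_j⌋, so the peak
bounds the sales also when the budget binds. -/
theorem le_peak (hD : D.Nonneg) {j c : ℕ} {x₀ W : ℚ} {x : ℝ} (h1 : x ≤ D.v j * x₀) (h2 : x ≤ W)
    (hc : x ≤ c) (hB : D.b j * c ≤ D.B) : x ≤ D.peak j x₀ W := by
  unfold peak
  split_ifs with h
  · have hb : 0 < D.b j := (hD.b j).lt_of_ne fun h0 => by
      rw [← h0, zero_mul] at h
      exact absurd hD.B (not_le.2 h)
    refine hc.trans ?_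
    have h3 : (c : ℤ) ≤ ⌊D.B / D.b j⌋ := by
      rw [Int.le_floor, le_div_iff₀ hb]
      push_cast
      linarith
    exact_mod_cast h3
  · push_cast
    exact le_min h1 h2

theorem sum_single_range {n j : ℕ} (hj : j < n) (f : ℕ → ℕ → ℚ) (hf : ∀ i, f i 0 = 0) (q : ℕ) :
    ∑ i ∈ Finset.range n, f i (if i = j then q else 0) = f j q := by
  rw [Finset.sum_eq_single j]
  · simp
  · intro i _ hi
    simp [hi, hf]
  · intro h
    exact absurd (Finset.mem_range.2 hj) h

/-- The plan that sells as much as possible of one product. -/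
theorem le_of_dominates_peak (hD : D.Nonneg) {j k : ℕ} (hj : j < D.n) (hT : 0 < D.T) {a : ℚ}
    (hg : 0 < (D.guess j k).g) (h : Dominates (D.guess j k) a) :
    8 * D.n * (D.guess j k).g ≤ a := by
  set G := D.guess j k with hG
  have hn : 0 < D.n := by omega
  have hn' : (0 : ℚ) < D.n := by exact_mod_cast hn
  have hx₀ : 0 ≤ G.x₀ := mul_nonneg hT.le (by positivity)
  have hW : 0 < G.W := by
    have : ((8 : ℚ) / 9) ^ (k + 1) < 1 := pow_lt_one₀ (by norm_num) (by norm_num) (by omega)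
    exact sub_pos.2 (mul_lt_of_lt_one_right hT this)
  have hgp : 8 * D.n * G.g = D.r j * D.peak j G.x₀ G.W := by
    have : G.g = D.r j * D.peak j G.x₀ G.W / (8 * D.n) := rfl
    rw [this]
    field_simp
  have hp0 := D.peak_nonneg hD (j := j) hx₀ hW.le
  have hpm := D.peak_le_left hD (j := j) hx₀ hW.le
  have hr0 : 0 < D.r j := (hD.r j).lt_of_ne fun h0 => by
    rw [← h0, zero_mul] at hgp
    exact absurd hgp (by positivity)
  have ham : G.amount j (8 * D.n) = D.peak j G.x₀ G.W := by
    have : G.r j = D.r j := rfl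
    unfold Guess.amount
    rw [this]
    push_cast
    rw [hgp, mul_div_cancel_left₀ _ hr0.ne']
  have hs : ∀ {f : ℕ → ℕ → ℕ}, (∀ i, f i 0 = 0) →
      ∑ i ∈ Finset.range D.n, f i (if i = j then 8 * D.n else 0) = f j (8 * D.n) := by
    intro f hf
    have := sum_single_range hj (fun i p => (f i p : ℚ)) (by simp [hf]) (8 * D.n)
    exact_mod_cast this
  -- By the choice of g, the peak of product j is worth exactly 8 n units of revenue, so this is a
  -- plan within the dimensions of the table.
  have := h hg (fun i => if i = j then 8 * D.n else 0) (8 * D.n) (G.slots j (8 * D.n))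
    ⟨fun l hl => ?_, hs (f := fun _ p => p) (by simp), hs (fun i => G.slots_zero i)⟩ ?_ ?_ ?_
  · push_cast at this
    exact this
  · dsimp only
    split_ifs with hlj
    · subst hlj
      unfold Guess.Attains
      push_cast
      rw [hgp]
      exact mul_le_mul_of_nonneg_left (hpm.trans (min_le_left _ _)) (hD.r l)
    · unfold Guess.Attains
      rw [Nat.cast_zero, zero_mul]
      exact mul_nonneg (hD.r l) (mul_nonneg (hD.v l) hx₀)
  · change 8 * D.n ≤ 8 * D.n * D.n
    nlinarith
  · unfold Guess.slots
    rw [ham]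
    refine Nat.floor_le_of_le ?_
    rw [div_le_iff₀ hW, mul_comm]
    change _ ≤ ((8 * D.n : ℕ) : ℚ) * _
    push_cast
    exact mul_le_mul_of_nonneg_left (hpm.trans (min_le_right _ _)) (by positivity)
  · have h3 : G.cost (fun i => if i = j then 8 * D.n else 0) G.n = G.price j (8 * D.n) :=
      sum_single_range hj (fun i p => G.price i p)
        (by simp [Guess.price, Guess.amount]) (8 * D.n)
    rw [h3]
    unfold Guess.price
    rw [ham]
    exact D.mul_ceil_peak_le hD j _ _

/-- A value that dominates all guesses is nearly optimal. -/
theorem le_of_dominates (hD : D.Nonneg) {V a : ℚ} (hV : ∑ i ∈ Finset.range D.n, D.v i < V - 1)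
    (ha : 0 ≤ a)
    (h : ∀ j < D.n, ∀ k, D.T < D.T * (8 / 9) ^ k * V → Dominates (D.guess j k) a)
    {c : ℕ → ℕ} (hc : ∑ i ∈ Finset.range D.n, D.b i * c i ≤ D.B) {A : ℝ} (hA : D.Sells c A) :
    (8 / 9) ^ 2 * A ≤ a := by
  have ha' : (0 : ℝ) ≤ a := by exact_mod_cast ha
  obtain ⟨x, y₀, hx, hy₀, hsum, rfl⟩ := hA
  have hr : ∀ i, (0 : ℝ) ≤ D.r i := fun i => by exact_mod_cast hD.r i
  have hv : ∀ i, (0 : ℝ) ≤ D.v i := fun i => by exact_mod_cast hD.v i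
  have hxs : ∀ i < D.n, x i ≤ ∑ i ∈ Finset.range D.n, x i := fun i hi =>
    Finset.single_le_sum (f := x) (fun j hj => (hx j (Finset.mem_range.1 hj)).1)
      (Finset.mem_range.2 hi)
  have hzero : (∀ i < D.n, D.r i * x i ≤ 0) → (8 / 9) ^ 2 * ∑ i ∈ Finset.range D.n, D.r i * x i ≤
      (a : ℝ) := fun h0 => by
    have : ∑ i ∈ Finset.range D.n, D.r i * x i ≤ 0 :=
      Finset.sum_nonpos fun i hi => h0 i (Finset.mem_range.1 hi)
    linarith
  rcases hD.T.eq_or_lt with hT | hT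
  · rw [← hT, Rat.cast_zero] at hsum
    exact hzero fun i hi => mul_nonpos_of_nonneg_of_nonpos (hr i) (by linarith [hxs i hi])
  rcases Nat.eq_zero_or_pos D.n with hn | hn
  · exact hzero fun i hi => by omega
  have hn' : (0 : ℝ) < D.n := by exact_mod_cast hn
  have hT' : (0 : ℝ) < D.T := by exact_mod_cast hT
  -- the outside option absorbs the remaining customers
  obtain ⟨x₀, hx₀⟩ : ∃ x₀ : ℝ, x₀ = D.T - ∑ i ∈ Finset.range D.n, x i := ⟨_, rfl⟩
  have hxv : ∀ i < D.n, x i ≤ D.v i * x₀ := fun i hi =>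
    (hx i hi).2.2.trans (mul_le_mul_of_nonneg_left (by linarith) (hv i))
  have hTx : (D.T : ℝ) ≤ x₀ * (1 + ∑ i ∈ Finset.range D.n, (D.v i : ℝ)) := by
    have : ∑ i ∈ Finset.range D.n, x i ≤ (∑ i ∈ Finset.range D.n, (D.v i : ℝ)) * x₀ := by
      rw [Finset.sum_mul]
      exact Finset.sum_le_sum fun i hi => hxv i (Finset.mem_range.1 hi)
    linarith
  have hV' : (∑ i ∈ Finset.range D.n, (D.v i : ℝ)) < V - 1 := by exact_mod_cast hV
  have hv0 : (0 : ℝ) ≤ ∑ i ∈ Finset.range D.n, (D.v i : ℝ) := Finset.sum_nonneg fun i _ => hv i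
  have hx0 : 0 < x₀ := by
    by_contra h0
    nlinarith
  have hxT : x₀ ≤ D.T := by
    have : 0 ≤ ∑ i ∈ Finset.range D.n, x i :=
      Finset.sum_nonneg fun i hi => (hx i (Finset.mem_range.1 hi)).1
    linarith
  -- The grid point T (8/9)^(k+1) lies below x₀ by a factor of at most 8/9. Rounding down enlarges
  -- the capacity W, and scaling the sales by 8/9 restores the attraction bounds.
  obtain ⟨k, hk1, hk2⟩ := exists_nat_pow_near_of_lt_one (div_pos hx0 hT')
    ((div_le_one hT').2 hxT) (by norm_num : (0 : ℝ) < 8 / 9) (by norm_num)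
  rw [lt_div_iff₀ hT'] at hk1
  rw [div_le_iff₀ hT'] at hk2
  -- As x₀ ≥ T / (1 + ∑ v_i) > T / V, this k is among the guesses that are tried.
  have hVk : D.T < D.T * (8 / 9) ^ k * V := by
    have h1 : x₀ * (1 + ∑ i ∈ Finset.range D.n, (D.v i : ℝ)) < x₀ * V :=
      mul_lt_mul_of_pos_left (by linarith) hx0
    have h2 : x₀ * V ≤ (8 / 9) ^ k * D.T * V := mul_le_mul_of_nonneg_right hk2 (by linarith)
    have h3 : (D.T : ℝ) < D.T * (8 / 9) ^ k * V := by linarith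
    have h4 : (D.T : ℝ) < ((D.T * (8 / 9) ^ k * V : ℚ) : ℝ) := by
      push_cast
      exact h3
    exact Rat.cast_lt.1 h4
  obtain ⟨z₀, hz₀⟩ : ∃ z₀ : ℚ, z₀ = D.T * (8 / 9) ^ (k + 1) := ⟨_, rfl⟩
  obtain ⟨W, hWd⟩ : ∃ W : ℚ, W = D.T - z₀ := ⟨_, rfl⟩
  have hz0 : 0 ≤ z₀ := by rw [hz₀]; positivity
  have hz1 : (z₀ : ℝ) ≤ x₀ := by
    rw [hz₀]
    push_cast
    linarith
  have hz2 : 8 / 9 * x₀ ≤ z₀ := by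
    rw [hz₀]
    push_cast
    rw [pow_succ]
    linarith
  have hW : 0 < W := by
    have : ((8 : ℚ) / 9) ^ (k + 1) < 1 := pow_lt_one₀ (by norm_num) (by norm_num) (by omega)
    rw [hWd, hz₀]
    exact sub_pos.2 (mul_lt_of_lt_one_right hT this)
  have hW' : (0 : ℝ) < W := by exact_mod_cast hW
  have hxW : ∑ i ∈ Finset.range D.n, x i ≤ W := by
    rw [hWd]
    push_cast
    linarith
  have hxv' : ∀ i < D.n, 8 / 9 * x i ≤ D.v i * z₀ := fun i hi => by
    have := mul_le_mul_of_nonneg_left hz2 (hv i)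
    linarith [hxv i hi]
  have hci : ∀ i < D.n, D.b i * c i ≤ D.B := fun i hi =>
    (Finset.single_le_sum (f := fun i => D.b i * (c i : ℚ))
      (fun j _ => mul_nonneg (hD.b j) (Nat.cast_nonneg _)) (Finset.mem_range.2 hi)).trans hc
  have hpeak : ∀ i < D.n, 8 / 9 * x i ≤ D.peak i z₀ W := fun i hi =>
    D.le_peak hD (hxv' i hi) (by linarith [hxs i hi, (hx i hi).1])
      (by linarith [(hx i hi).2.1, (hx i hi).1]) (hci i hi)
  -- The right guess for j is the product with the largest revenue when sold alone; no product then
  -- yields more than 8 n g.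
  obtain ⟨j, hj, hmax⟩ := Finset.exists_max_image (Finset.range D.n)
    (fun i => D.r i * D.peak i z₀ W) ⟨0, Finset.mem_range.2 hn⟩
  rw [Finset.mem_range] at hj
  obtain ⟨G, hG⟩ : ∃ G, G = D.guess j k := ⟨_, rfl⟩
  have hGD : G.toData = D := by rw [hG]; rfl
  have hGx : G.x₀ = z₀ := by rw [hG, hz₀]; rfl
  have hGW : G.W = W := by rw [hG, hWd, hz₀]; rfl
  have hGg : 8 * D.n * G.g = D.r j * D.peak j z₀ W := by
    have : G.g = D.r j * D.peak j z₀ W / (8 * D.n) := by rw [hG, hWd, hz₀]; rfl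
    have hnq : (D.n : ℚ) ≠ 0 := by exact_mod_cast hn.ne'
    rw [this]
    field_simp
  have hrx : ∀ i < D.n, D.r i * (8 / 9 * x i) ≤ 8 * D.n * G.g := fun i hi => by
    have h1 : D.r i * (8 / 9 * x i) ≤ D.r i * D.peak i z₀ W :=
      mul_le_mul_of_nonneg_left (hpeak i hi) (hr i)
    have h2 : (D.r i * D.peak i z₀ W : ℝ) ≤ 8 * D.n * G.g := by
      have := hmax i (Finset.mem_range.2 hi)
      rw [← hGg] at this
      exact_mod_cast this
    exact h1.trans h2
  -- Without a positive unit, no product earns anything and the bound is trivial.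
  rcases le_or_gt G.g 0 with hg | hg
  · refine hzero fun i hi => ?_
    have h1 := hrx i hi
    have h2 : (8 * D.n * G.g : ℝ) ≤ 0 :=
      mul_nonpos_of_nonneg_of_nonpos (by positivity) (by exact_mod_cast hg)
    linarith
  have hg' : (0 : ℝ) < G.g := by exact_mod_cast hg
  have hdom := h j hj k hVk
  have hpk := le_of_dominates_peak hD hj hT (hG ▸ hg) hdom
  rw [← hG] at hdom hpk
  -- round the revenues down
  set p : ℕ → ℕ := fun i => ⌊D.r i * (8 / 9 * x i) / G.g⌋₊ with hp
  have hpg : ∀ i < D.n, p i * (G.g : ℝ) ≤ D.r i * (8 / 9 * x i) := fun i hi => by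
    rw [← le_div_iff₀ hg']
    exact Nat.floor_le (div_nonneg (mul_nonneg (hr i) (by linarith [(hx i hi).1])) hg'.le)
  have hGr : ∀ i, G.r i = D.r i := fun i => by rw [hGD]
  have hamount : ∀ i < D.n, (G.amount i (p i) : ℝ) ≤ 8 / 9 * x i := fun i hi =>
    Guess.amount_le (fun i => by rw [hGr]; exact hD.r i) (by linarith [(hx i hi).1])
      (by rw [hGr]; exact hpg i hi)
  have hplan : G.Plan G.n p (∑ l ∈ Finset.range G.n, p l)
      (∑ l ∈ Finset.range G.n, G.slots l (p l)) := by
    refine ⟨fun l hl => ?_, rfl, rfl⟩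
    rw [hGD] at hl
    unfold Guess.Attains
    rw [hGD, hGx]
    have h1 : (p l * G.g : ℝ) ≤ D.r l * (D.v l * z₀) :=
      (hpg l hl).trans (mul_le_mul_of_nonneg_left (hxv' l hl) (hr l))
    exact_mod_cast h1
  have hfin := hdom hg p _ _ hplan ?_ ?_ ?_
  -- Rounding down loses at most n g, and 8 n g ≤ a by the single-product plan. Hence 8/9 of the
  -- revenue is at most a + a / 8 = 9/8 a.
  · have h1 : ∑ i ∈ Finset.range D.n, D.r i * (8 / 9 * x i) ≤
        ((∑ l ∈ Finset.range D.n, p l : ℕ) + D.n) * (G.g : ℝ) := by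
      have : ∀ i ∈ Finset.range D.n, D.r i * (8 / 9 * x i) ≤ ((p i : ℝ) + 1) * G.g := fun i _ => by
        rw [← div_le_iff₀ hg']
        exact (Nat.lt_floor_add_one _).le
      refine (Finset.sum_le_sum this).trans_eq ?_
      rw [← Finset.sum_mul, Finset.sum_add_distrib]
      simp
    have h2 : ((∑ l ∈ Finset.range D.n, p l : ℕ) : ℝ) * G.g ≤ a := by
      rw [hGD] at hfin
      exact_mod_cast hfin
    have h3 : (8 * D.n * G.g : ℝ) ≤ a := by exact_mod_cast hpk
    have h4 : ∑ i ∈ Finset.range D.n, D.r i * (8 / 9 * x i) =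
        8 / 9 * ∑ i ∈ Finset.range D.n, D.r i * x i := by
      rw [Finset.mul_sum]
      exact Finset.sum_congr rfl fun i _ => by ring
    rw [h4] at h1
    linarith
  · rw [hGD]
    have : ∀ i ∈ Finset.range D.n, p i ≤ 8 * D.n := fun i hi => by
      refine Nat.floor_le_of_le ?_
      rw [div_le_iff₀ hg']
      push_cast
      exact hrx i (Finset.mem_range.1 hi)
    have h1 := Finset.sum_le_card_nsmul _ _ _ this
    rw [Finset.card_range, smul_eq_mul] at h1
    linarith
  · rw [hGD]
    have h1 : ((∑ l ∈ Finset.range D.n, G.slots l (p l) : ℕ) : ℝ) ≤ ((8 * D.n : ℕ) : ℝ) := by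
      have : ∀ i ∈ Finset.range D.n, (G.slots i (p i) : ℝ) ≤ x i * (8 * D.n / W) := fun i hi => by
        have hi' := Finset.mem_range.1 hi
        have h2 := Nat.floor_le (a := G.amount i (p i) * (8 * G.n) / G.W) (by
          rw [hGW]
          exact div_nonneg (mul_nonneg (Guess.amount_nonneg
            (fun i => by rw [hGr]; exact hD.r i) hg i _) (by positivity)) hW.le)
        have h3 : (G.slots i (p i) : ℝ) ≤ G.amount i (p i) * (8 * D.n) / W := by
          rw [hGW, hGD] at h2
          unfold Guess.slots
          rw [hGW, hGD]
          exact_mod_cast h2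
        rw [mul_div_assoc] at h3
        exact h3.trans (mul_le_mul_of_nonneg_right
          (by linarith [hamount i hi', (hx i hi').1]) (by positivity))
      push_cast
      refine (Finset.sum_le_sum this).trans ?_
      rw [← Finset.sum_mul, mul_div_assoc', div_le_iff₀ hW']
      have := mul_le_mul_of_nonneg_right hxW (by positivity : (0 : ℝ) ≤ 8 * D.n)
      linarith
    exact_mod_cast h1
  · rw [hGD]
    refine le_trans (Finset.sum_le_sum fun i hi => ?_) hc
    have hi' := Finset.mem_range.1 hi
    unfold Guess.price
    rw [hGD]
    refine mul_le_mul_of_nonneg_left ?_ (hD.b i)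
    -- The amount is at most the stock c_i, an integer, so rounding up does not exceed it.
    have h1 : ⌈G.amount i (p i)⌉ ≤ (c i : ℤ) := by
      rw [Int.ceil_le]
      have h2 : (G.amount i (p i) : ℝ) ≤ c i := by
        linarith [hamount i hi', (hx i hi').1, (hx i hi').2.1]
      exact_mod_cast h2
    exact_mod_cast h1

end Data

end Assortment

namespace RatRAM

/-! ### Notation for expressions, and assignments with known values -/

instance : Add Expr := ⟨Expr.add⟩
instance : Sub Expr := ⟨Expr.sub⟩
instance : Mul Expr := ⟨Expr.mul⟩
instance : Div Expr := ⟨Expr.div⟩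
instance (k : ℕ) : OfNat Expr k := ⟨Expr.const ((OfNat.ofNat k : ℕ) : ℚ)⟩

@[simp] theorem Expr.eval_add (σ : Memory) (x y : Expr) :
    (x + y).eval σ = x.eval σ + y.eval σ := rfl
@[simp] theorem Expr.eval_sub (σ : Memory) (x y : Expr) :
    (x - y).eval σ = x.eval σ - y.eval σ := rfl
@[simp] theorem Expr.eval_mul (σ : Memory) (x y : Expr) :
    (x * y).eval σ = x.eval σ * y.eval σ := rfl
@[simp] theorem Expr.eval_div (σ : Memory) (x y : Expr) :
    (x / y).eval σ = x.eval σ / y.eval σ := rfl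
@[simp] theorem Expr.eval_ofNat (σ : Memory) (k : ℕ) :
    (no_index (OfNat.ofNat k : Expr)).eval σ = ((OfNat.ofNat k : ℕ) : ℚ) := rfl
@[simp] theorem Expr.eval_const (σ : Memory) (q : ℚ) : (Expr.const q).eval σ = q := rfl
@[simp] theorem Expr.eval_floor (σ : Memory) (x : Expr) :
    (Expr.floor x).eval σ = (⌊x.eval σ⌋ : ℤ) := rfl

/-- The value rounded up. -/
def Expr.ceil (x : Expr) : Expr := 0 - Expr.floor (0 - x)

@[simp] theorem Expr.eval_ceil (σ : Memory) (x : Expr) :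
    (Expr.ceil x).eval σ = (⌈x.eval σ⌉ : ℤ) := by
  simp [Expr.ceil, Int.floor_neg]

theorem Expr.eval_get_of_eq {σ : Memory} {a k : ℕ} {e : Expr} (h : e.eval σ = k) :
    (Expr.get a e).eval σ = σ a k := by
  simp [Expr.eval, h]

theorem floor_natCast_div (a b : ℕ) : ((⌊(a : ℚ) / (b : ℚ)⌋ : ℤ) : ℚ) = ((a / b : ℕ) : ℚ) := by
  rw [Rat.floor_natCast_div_natCast]
  rfl

variable {R β : ℕ} {P : Program} {σ : Memory} {Q : Memory → Prop}

theorem Halts.assign_seq {a : ℕ} {e : Expr} (q : ℚ) (hσ : Small β σ) (hv : e.eval σ = q)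
    (hq : HeightLE β q)
    (h : ∀ τ, Small β τ → (∀ b, b ≠ a → τ b = σ b) → τ a 0 = q → Halts R β P τ Q) :
    Halts R β (.seq (.assign a e) P) σ Q :=
  Halts.seq (Halts.assign hσ (hv ▸ hq) (by
    rw [hv]
    exact h _ (hσ.store hq) (fun b hb => store_of_ne _ hb _ _) (store_same _ _ _ _)))

theorem Halts.assign_of_eq {a : ℕ} {e : Expr} (q : ℚ) (hσ : Small β σ) (hv : e.eval σ = q)
    (hq : HeightLE β q)
    (h : ∀ τ, (∀ b, b ≠ a → τ b = σ b) → τ a 0 = q → Q τ) :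
    Halts R β (.assign a e) σ Q :=
  Halts.assign hσ (hv ▸ hq) (by
    rw [hv]
    exact h _ (fun b hb => store_of_ne _ hb _ _) (store_same _ _ _ _))

theorem Halts.set_seq {a k : ℕ} {i e : Expr} (q : ℚ) (hσ : Small β σ) (hi : i.eval σ = k)
    (hv : e.eval σ = q) (hq : HeightLE β q)
    (h : Small β (store σ a k q) → Halts R β P (store σ a k q) Q) :
    Halts R β (.seq (.set a i e) P) σ Q :=
  Halts.seq (Halts.set hσ (hv ▸ hq) (by
    rw [hv, hi, Nat.floor_natCast]
    exact h (hσ.store hq)))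

theorem Halts.set_of_eq {a k : ℕ} {i e : Expr} (q : ℚ) (hσ : Small β σ) (hi : i.eval σ = k)
    (hv : e.eval σ = q) (hq : HeightLE β q)
    (h : Q (store σ a k q)) :
    Halts R β (.set a i e) σ Q :=
  Halts.set hσ (hv ▸ hq) (by
    rw [hv, hi, Nat.floor_natCast]
    exact h)

end RatRAM

namespace Assortment

open RatRAM

/-! ### The program

For every product `j` and every guess `x₀ = T (8 / 9) ^ (k + 1)` of the sales of the outside option,
a dynamic program over the products computes the least cost of each total of revenue, counted in
units of `g`, and of sales, counted in slots. The best inventory found is kept in the output.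

Arrays: `0` input, `1` output, `2` unit costs, `3` budget, `4` product `j` of the guess, `5` bound
for the total attraction, `6` sales of the outside option, `7` capacity, `8` largest sales of `j`,
`9` unit of revenue, `10` index of a table cell, `11` product, `12` units of revenue, `13` slots,
`14` costs, `15` codes of plans, `16` units of revenue from one product, `17` its sales, `18` its
slots, `19` cost of a candidate, `20` best revenue, `21` counter, `22` code, `23` counter, `24`
intermediate result, `25` to `27` dimensions of the table, `28` index of the preceding cell. -/

namespace Algorithm

open Expr

/-- Price of the product with the given index. -/
def priceOf (e : Expr) : Expr := .get 0 (2 + e)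

/-- Attraction of the product with the given index. -/
def attractionOf (e : Expr) : Expr := .get 0 (2 + var 0 + e)

/-- Unit cost of the product with the given index. -/
def costOf (e : Expr) : Expr := .get 2 e

/-- Improve a table cell by selling `p` units of revenue of the current product. -/
def attempt : Program :=
  .ite (priceOf (var 11) * (attractionOf (var 11) * var 6)) (var 16 * var 9) .skip
    (.seq (.assign 17 (var 16 * var 9 / priceOf (var 11)))
    (.seq (.assign 18 (.floor (var 17 * (8 * var 0) / var 7)))
    (.ite (var 13) (var 18) .skip
      (.seq (.assign 28 (var 10 - var 27 - var 16 * var 25 - var 18))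
      (.seq (.assign 19 (.get 14 (var 28) + costOf (var 11) * ceil (var 17)))
      (.ite (var 19) (.get 14 (var 10))
        (.seq (.set 15 (var 10) (.get 15 (var 28) * var 26 + var 16))
          (.set 14 (var 10) (var 19)))
        .skip))))))

/-- Fill one table cell. -/
def cell : Program :=
  .seq (.assign 11 (.floor (var 10 / var 27) - 1))
  (.seq (.assign 24 (var 10 - .floor (var 10 / var 27) * var 27))
  (.seq (.assign 12 (.floor (var 24 / var 25)))
  (.seq (.assign 13 (var 24 - var 12 * var 25))
  (.seq (.set 14 (var 10) (var 3 + 1))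
  (.seq (.set 15 (var 10) 0)
  (.ite (var 10) 1 (.set 14 (var 10) 0)
    (.ite (var 10) (var 27) .skip
      (.for 16 (var 12 + 1) attempt))))))))

/-- Fill the table. -/
def table : Program := .for 10 ((var 0 + 1) * var 27) cell

/-- Output the inventory of the plan with the given code. -/
def decode : Program :=
  .seq (.assign 22 (.get 15 (var 10)))
    (.for 23 (var 0)
      (.seq (.assign 24 (.floor (var 22 / var 26)))
      (.seq (.assign 16 (var 22 - var 24 * var 26))
      (.seq (.assign 22 (var 24))
        (.set 1 (var 0 - 1 - var 23)
          (ceil (var 16 * var 9 / priceOf (var 0 - 1 - var 23))))))))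

/-- Output the best plan in the table, if it improves on the best one so far. -/
def extract : Program :=
  .for 21 (var 27)
    (.seq (.assign 10 (var 0 * var 27 + var 21))
    (.seq (.assign 12 (.floor (var 21 / var 25)))
      (.ite (var 3) (.get 14 (var 10)) .skip
        (.ite (var 20) (var 12 * var 9) (.seq (.assign 20 (var 12 * var 9)) decode) .skip))))

/-- Compute the next guess. -/
def scale : Program :=
  .seq (.assign 6 (var 6 * .const (8 / 9)))
  (.seq (.assign 7 (.get 0 1 - var 6))
  (.seq (.assign 8 (attractionOf (var 4) * var 6))
  (.seq (.ite (var 7) (var 8) (.assign 8 (var 7)) .skip)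
  (.seq (.ite (var 3) (costOf (var 4) * ceil (var 8))
      (.assign 8 (.floor (var 3 / costOf (var 4)))) .skip)
    (.assign 9 (priceOf (var 4) * var 8 / (8 * var 0)))))))

/-- Try all guesses for the product `j`. -/
def guesses : Program :=
  .seq (.assign 6 (.get 0 1))
    (.loop (.get 0 1) (var 6 * var 5)
      (.seq scale (.ite 0 (var 9) (.seq table extract) .skip)))

/-- The algorithm, once the costs and the budget are in place. -/
def main : Program :=
  .seq (.assign 25 (8 * var 0 + 1))
  (.seq (.assign 26 (8 * var 0 * var 0 + 1))
  (.seq (.assign 27 (var 26 * var 25))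
  (.seq (.assign 5 2)
  (.seq (.for 23 (var 0) (.assign 5 (var 5 + attractionOf (var 23))))
    (.for 4 (var 0) guesses)))))

end Algorithm

/-! ### Correctness of the program -/

namespace Guess

variable (G : Guess)

/-- Number of values of the total units of revenue. -/
def rows : ℕ := 8 * G.n * G.n + 1

/-- Number of values of the total slots. -/
def cols : ℕ := 8 * G.n + 1

/-- Index of a table cell. -/
def index (i P S : ℕ) : ℕ := (i * G.rows + P) * G.cols + S

/-- The first `k` entries of a plan as one number. -/
def code (p : ℕ → ℕ) : ℕ → ℕ
  | 0 => 0
  | k + 1 => code p k * G.rows + p k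

/-- The table entry with cost `d` and code `c` is correct, with respect to the plans in `X`. -/
def Cell (i P S : ℕ) (X : (ℕ → ℕ) → Prop) (d c : ℚ) : Prop :=
  d ≤ G.B + 1 ∧
  (d = G.B + 1 ∧ c = 0 ∨ ∃ p, G.Plan i p P S ∧ d = G.cost p i ∧ c = G.code p i) ∧
  ∀ p, X p → G.Plan i p P S → G.cost p i ≤ G.B → d ≤ G.cost p i

variable {G}

theorem Plan.congr {k P S : ℕ} {p p' : ℕ → ℕ} (h : G.Plan k p P S) (hp : ∀ l < k, p' l = p l) :
    G.Plan k p' P S := by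
  obtain ⟨h1, h2, h3⟩ := h
  refine ⟨fun l hl => by rw [hp l hl]; exact h1 l hl, ?_, ?_⟩
  · rw [← h2]
    exact Finset.sum_congr rfl fun l hl => hp l (Finset.mem_range.1 hl)
  · rw [← h3]
    exact Finset.sum_congr rfl fun l hl => by rw [hp l (Finset.mem_range.1 hl)]

theorem cost_congr {k : ℕ} {p p' : ℕ → ℕ} (hp : ∀ l < k, p' l = p l) :
    G.cost p' k = G.cost p k :=
  Finset.sum_congr rfl fun l hl => by rw [hp l (Finset.mem_range.1 hl)]

theorem code_congr {p p' : ℕ → ℕ} : ∀ {k : ℕ}, (∀ l < k, p' l = p l) → G.code p' k = G.code p k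
  | 0, _ => rfl
  | k + 1, hp => by
    rw [code, code, code_congr fun l hl => hp l (by omega), hp k (by omega)]

theorem Plan.le {k P S l : ℕ} {p : ℕ → ℕ} (h : G.Plan k p P S) (hl : l < k) : p l ≤ P := by
  rw [← h.2.1]
  exact Finset.single_le_sum (fun _ _ => Nat.zero_le _) (Finset.mem_range.2 hl)

theorem Plan.succ {k P S q : ℕ} {p : ℕ → ℕ} (h : G.Plan k p P S) (hq : G.Attains k q)
    (hpk : p k = q) : G.Plan (k + 1) p (P + q) (S + G.slots k q) := by
  obtain ⟨h1, h2, h3⟩ := h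
  refine ⟨fun l hl => ?_, ?_, ?_⟩
  · rcases Nat.lt_succ_iff_lt_or_eq.1 hl with hl | rfl
    · exact h1 l hl
    · rw [hpk]; exact hq
  · rw [Finset.sum_range_succ, h2, hpk]
  · rw [Finset.sum_range_succ, h3, hpk]

/-- Together with `Plan.succ` this is the recursion of the dynamic program: a plan for k + 1
products is a plan for k products, with smaller totals, and one more entry. -/
theorem Plan.pred {k P S : ℕ} {p : ℕ → ℕ} (h : G.Plan (k + 1) p P S) :
    G.Attains k (p k) ∧ p k ≤ P ∧ G.slots k (p k) ≤ S ∧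
      G.Plan k p (P - p k) (S - G.slots k (p k)) := by
  obtain ⟨h1, h2, h3⟩ := h
  rw [Finset.sum_range_succ] at h2 h3
  exact ⟨h1 k (by omega), by omega, by omega, fun l hl => h1 l (by omega), by omega, by omega⟩

/-- The index is a number in mixed radix with digits i, P, S, and digits are unique. -/
theorem index_inj {i P S i' P' S' : ℕ} (hP : P < G.rows) (hS : S < G.cols) (hP' : P' < G.rows)
    (hS' : S' < G.cols) (h : G.index i P S = G.index i' P' S') : i = i' ∧ P = P' ∧ S = S' := by
  unfold index at h
  have key : ∀ {a b c d m : ℕ}, b < m → d < m → a * m + b = c * m + d → a = c ∧ b = d := by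
    intro a b c d m hb hd h
    have h1 : (a * m + b) % m = (c * m + d) % m := by rw [h]
    have h2 : (a * m + b) / m = (c * m + d) / m := by rw [h]
    have hm : 0 < m := by omega
    rw [Nat.mul_comm a, Nat.mul_comm c] at h1 h2
    rw [Nat.mul_add_mod, Nat.mul_add_mod, Nat.mod_eq_of_lt hb, Nat.mod_eq_of_lt hd] at h1
    rw [Nat.mul_add_div hm, Nat.mul_add_div hm, Nat.div_eq_of_lt hb, Nat.div_eq_of_lt hd] at h2
    exact ⟨by omega, h1⟩
  obtain ⟨h1, h2⟩ := key hS hS' h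
  obtain ⟨h3, h4⟩ := key hP hP' h1
  exact ⟨h3, h4, h2⟩

theorem index_div_mod (t : ℕ) :
    G.index (t / (G.rows * G.cols)) (t % (G.rows * G.cols) / G.cols)
      (t % (G.rows * G.cols) % G.cols) = t := by
  unfold index
  have h1 := Nat.div_add_mod t (G.rows * G.cols)
  have h2 := Nat.div_add_mod (t % (G.rows * G.cols)) G.cols
  nlinarith

/-- Bounds for the heights of the data and for the size of the table. -/
structure Heights (G : Guess) (γ : ℕ) : Prop where
  r : ∀ i < G.n, HeightLE γ (G.r i)
  b : ∀ i < G.n, HeightLE γ (G.b i)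
  B : HeightLE γ G.B
  g : HeightLE γ G.g
  W : HeightLE γ G.W
  table : (G.n + 1) * (G.rows * G.cols) + 2 ≤ 2 ^ γ

theorem index_lt {i P S : ℕ} (hi : i ≤ G.n) (hP : P < G.rows) (hS : S < G.cols) :
    G.index i P S < (G.n + 1) * (G.rows * G.cols) := by
  unfold index
  have h1 : i * G.rows + P + 1 ≤ (G.n + 1) * G.rows := by nlinarith
  have h2 := Nat.mul_le_mul_right G.cols h1
  nlinarith

theorem rows_pos : 0 < G.rows := Nat.succ_pos _
theorem cols_pos : 0 < G.cols := Nat.succ_pos _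

theorem Heights.amount {γ i p : ℕ} (h : G.Heights γ) (hi : i < G.n) (hp : p < G.rows) :
    HeightLE (3 * γ) (G.amount i p) := by
  have h1 := h.table
  have h2 : p + 1 ≤ 2 ^ γ := by
    have := G.cols_pos
    nlinarith [Nat.mul_le_mul hp.le this]
  exact (((heightLE_natCast h2).mul h.g).div (h.r i hi)).mono (by omega)

theorem Heights.price {γ i p : ℕ} (h : G.Heights γ) (hi : i < G.n) (hp : p < G.rows) :
    HeightLE (4 * γ) (G.price i p) :=
  ((h.b i hi).mul (h.amount hi hp).ceil).mono (by omega)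

theorem Heights.cost {γ k : ℕ} {p : ℕ → ℕ} (h : G.Heights γ) (hk : k ≤ G.n)
    (hp : ∀ l < k, p l < G.rows) : HeightLE (G.n * (4 * γ)) (G.cost p k) :=
  (heightLE_sum fun l hl => h.price (by omega) (hp l hl)).mono (Nat.mul_le_mul_right _ hk)

/-- By Horner's scheme, every further digit multiplies by a number and adds a number of height at
most 2^γ, so the exponent grows linearly in the number of digits. -/
theorem Heights.code {γ k : ℕ} {p : ℕ → ℕ} (h : G.Heights γ) (hk : k ≤ G.n)
    (hp : ∀ l < k, p l < G.rows) : HeightLE (G.n * (4 * γ)) (G.code p k : ℚ) := by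
  have h2 : G.rows + 1 ≤ 2 ^ γ := by
    have h1 := h.table
    have := G.cols_pos
    nlinarith [Nat.mul_le_mul_left G.rows this]
  have key : ∀ k, (∀ l < k, p l < G.rows) → HeightLE (k * (4 * γ)) (G.code p k : ℚ) := by
    intro k
    induction k with
    | zero => exact fun _ => by simpa [Guess.code] using heightLE_zero
    | succ k ih =>
      intro hp
      rw [Guess.code]
      push_cast
      have h3 : p k + 1 ≤ 2 ^ γ := by
        have := hp k (by omega)
        omega
      exact (((ih fun l hl => hp l (by omega)).mul (heightLE_natCast h2)).add
        (heightLE_natCast h3)).mono (by ring_nf; omega)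
  exact (key k hp).mono (Nat.mul_le_mul_right _ hk)

/-- A correct entry is a default value or belongs to an actual plan. Its height is therefore bounded
uniformly, however many improvements led to it. -/
theorem Cell.height_code {γ i P S : ℕ} {X : (ℕ → ℕ) → Prop} {d c : ℚ} (h : G.Cell i P S X d c)
    (hG : G.Heights γ) (hi : i ≤ G.n) (hP : P < G.rows) : HeightLE (G.n * (4 * γ)) c := by
  rcases h.2.1 with ⟨-, h1⟩ | ⟨p, hp, -, h1⟩
  · rw [h1]
    exact heightLE_zero
  · rw [h1]
    exact hG.code hi fun l hl => (hp.le hl).trans_lt hP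

theorem Cell.height {γ i P S : ℕ} {X : (ℕ → ℕ) → Prop} {d c : ℚ} (h : G.Cell i P S X d c)
    (hG : G.Heights γ) (hi : i ≤ G.n) (hP : P < G.rows) :
    HeightLE (G.n * (4 * γ) + γ + 1) d := by
  rcases h.2.1 with ⟨h1, -⟩ | ⟨p, hp, h1, -⟩
  · rw [h1]
    exact (hG.B.add heightLE_one).mono (by omega)
  · rw [h1]
    exact (hG.cost hi fun l hl => (hp.le hl).trans_lt hP).mono (by omega)

end Guess

open Guess

/-- The data are stored in the memory. -/
structure Data.Stored (D : Data) (σ : Memory) : Prop where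
  n : σ 0 0 = D.n
  T : σ 0 1 = D.T
  r : ∀ i < D.n, σ 0 (2 + i) = D.r i
  v : ∀ i < D.n, σ 0 (2 + D.n + i) = D.v i
  b : ∀ i < D.n, σ 2 i = D.b i
  B : σ 3 0 = D.B
  cols : σ 25 0 = ((8 * D.n + 1 : ℕ) : ℚ)
  rows : σ 26 0 = ((8 * D.n * D.n + 1 : ℕ) : ℚ)
  size : σ 27 0 = (((8 * D.n * D.n + 1) * (8 * D.n + 1) : ℕ) : ℚ)

/-- The guess is stored in the memory. -/
structure Guess.Stored (G : Guess) (σ : Memory) : Prop where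
  data : G.toData.Stored σ
  x₀ : σ 6 0 = G.x₀
  W : σ 7 0 = G.W
  g : σ 9 0 = G.g

theorem Data.Stored.congr {D : Data} {σ τ : Memory} (h : D.Stored σ)
    (hτ : ∀ a ∈ [0, 2, 3, 25, 26, 27], τ a = σ a) : D.Stored τ := by
  have h0 := hτ 0 (by simp)
  have h2 := hτ 2 (by simp)
  have h3 := hτ 3 (by simp)
  have h25 := hτ 25 (by simp)
  have h26 := hτ 26 (by simp)
  have h27 := hτ 27 (by simp)
  obtain ⟨h4, h5, h6, h7, h8, h9, h10, h11, h12⟩ := h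
  constructor <;> simpa only [h0, h2, h3, h25, h26, h27]

theorem Guess.Stored.congr {G : Guess} {σ τ : Memory} (h : G.Stored σ)
    (hτ : ∀ a ∈ [0, 2, 3, 6, 7, 9, 25, 26, 27], τ a = σ a) : G.Stored τ := by
  refine ⟨h.data.congr fun a ha => hτ a ?_, ?_, ?_, ?_⟩
  · simp only [List.mem_cons, List.not_mem_nil] at ha ⊢
    tauto
  · rw [hτ 6 (by simp)]; exact h.x₀
  · rw [hτ 7 (by simp)]; exact h.W
  · rw [hτ 9 (by simp)]; exact h.g

/-- Writing to one array keeps the guess. -/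
theorem Guess.Stored.of_ne {G : Guess} {σ τ : Memory} {a : ℕ} (h : G.Stored σ)
    (hτ : ∀ b, b ≠ a → τ b = σ b) (ha : a ∉ [0, 2, 3, 6, 7, 9, 25, 26, 27]) : G.Stored τ :=
  h.congr fun b hb => hτ b fun hba => ha (hba ▸ hb)

theorem Data.Stored.of_ne {D : Data} {σ τ : Memory} {a : ℕ} (h : D.Stored σ)
    (hτ : ∀ b, b ≠ a → τ b = σ b) (ha : a ∉ [0, 2, 3, 25, 26, 27]) : D.Stored τ :=
  h.congr fun b hb => hτ b fun hba => ha (hba ▸ hb)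

section Eval

variable {D : Data} {σ : Memory} {e : Expr} {i : ℕ}

theorem Data.Stored.eval_price (h : D.Stored σ) (he : e.eval σ = i) (hi : i < D.n) :
    (Algorithm.priceOf e).eval σ = D.r i := by
  rw [← h.r i hi]
  exact Expr.eval_get_of_eq (by simp [he])

theorem Data.Stored.eval_attraction (h : D.Stored σ) (he : e.eval σ = i) (hi : i < D.n) :
    (Algorithm.attractionOf e).eval σ = D.v i := by
  rw [← h.v i hi]
  exact Expr.eval_get_of_eq (by simp [he, h.n])

theorem Data.Stored.eval_cost (h : D.Stored σ) (he : e.eval σ = i) (hi : i < D.n) :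
    (Algorithm.costOf e).eval σ = D.b i := by
  rw [← h.b i hi]
  exact Expr.eval_get_of_eq he

end Eval

end Assortment

/-! ### The recursion for a single table cell -/

namespace Assortment

open RatRAM Guess

namespace Guess

variable {G : Guess}

theorem price_nonneg (hD : G.Nonneg) (hg : 0 < G.g) (i p : ℕ) : 0 ≤ G.price i p :=
  mul_nonneg (hD.b i) (by exact_mod_cast Int.ceil_nonneg (amount_nonneg hD.r hg i p))

/-- In this and the following lemmas the predicate `q i < p` expresses that the entries 0, …, p - 1
have been tried for product i. An entry p that is unattainable or takes too many slots occurs in no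
plan of the cell. -/
theorem Cell.of_not_plan {i P S p : ℕ} {d c : ℚ}
    (h : G.Cell (i + 1) P S (fun q => q i < p) d c)
    (hp : ¬ G.Attains i p ∨ S < G.slots i p) : G.Cell (i + 1) P S (fun q => q i < p + 1) d c := by
  refine ⟨h.1, h.2.1, fun q hq hplan hB => h.2.2 q ?_ hplan hB⟩
  refine (Nat.lt_succ_iff.1 hq).lt_of_ne ?_
  rintro rfl
  obtain ⟨h1, -, h2, -⟩ := hplan.pred
  rcases hp with hp | hp
  · exact hp h1
  · omega

/-- The optimality principle: a plan with entry p splits off a plan of the preceding cell. The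
latter is within the budget too, because prices are nonnegative. -/
theorem Cell.le_add_price {i P S p : ℕ} {d c d' c' : ℚ} (hD : G.Nonneg) (hg : 0 < G.g)
    (h : G.Cell (i + 1) P S (fun q => q i < p) d c)
    (h' : G.Cell i (P - p) (S - G.slots i p) (fun _ => True) d' c')
    (q : ℕ → ℕ) (hq : q i < p + 1) (hplan : G.Plan (i + 1) q P S)
    (hB : G.cost q (i + 1) ≤ G.B) :
    d ≤ G.cost q (i + 1) ∨ d' + G.price i p ≤ G.cost q (i + 1) := by
  rcases Nat.lt_succ_iff_lt_or_eq.1 hq with hq | rfl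
  · exact Or.inl (h.2.2 q hq hplan hB)
  · right
    have h1 : G.cost q (i + 1) = G.cost q i + G.price i (q i) := Finset.sum_range_succ _ _
    have h2 := h'.2.2 q trivial hplan.pred.2.2.2 (by linarith [price_nonneg hD hg i (q i)])
    linarith

theorem Cell.of_le {i P S p : ℕ} {d c d' c' : ℚ} (hD : G.Nonneg) (hg : 0 < G.g)
    (h : G.Cell (i + 1) P S (fun q => q i < p) d c)
    (h' : G.Cell i (P - p) (S - G.slots i p) (fun _ => True) d' c')
    (hlt : ¬ d' + G.price i p < d) : G.Cell (i + 1) P S (fun q => q i < p + 1) d c := by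
  refine ⟨h.1, h.2.1, fun q hq hplan hB => ?_⟩
  rcases h.le_add_price hD hg h' q hq hplan hB with h1 | h1 <;> linarith

/-- Entries never exceed the default cost B + 1, so a strict improvement cannot come from a
preceding cell that still has the default. That cell therefore holds a plan, which is extended by p.
-/
theorem Cell.of_lt {i P S p : ℕ} {d c d' c' : ℚ} (hD : G.Nonneg) (hg : 0 < G.g)
    (h : G.Cell (i + 1) P S (fun q => q i < p) d c)
    (h' : G.Cell i (P - p) (S - G.slots i p) (fun _ => True) d' c')
    (hlt : d' + G.price i p < d) (hA : G.Attains i p) (hp : p ≤ P) (hs : G.slots i p ≤ S) :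
    G.Cell (i + 1) P S (fun q => q i < p + 1) (d' + G.price i p) (c' * G.rows + p) := by
  have h0 := price_nonneg hD hg i p
  refine ⟨by linarith [h.1], Or.inr ?_, fun q hq hplan hB => ?_⟩
  · rcases h'.2.1 with ⟨h1, -⟩ | ⟨q, h1, h2, h3⟩
    · linarith [h.1]
    · have hq : ∀ l < i, Function.update q i p l = q l := fun l hl =>
        Function.update_of_ne (by omega) _ _
      refine ⟨Function.update q i p, ?_, ?_, ?_⟩
      · have := (h1.congr hq).succ hA (by simp)
        rwa [Nat.sub_add_cancel hp, Nat.sub_add_cancel hs] at this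
      · rw [h2, ← cost_congr hq]
        unfold cost
        rw [Finset.sum_range_succ, Function.update_self]
      · rw [code, code_congr hq, Function.update_self, h3]
        push_cast
        rfl
  · rcases h.le_add_price hD hg h' q hq hplan hB with h1 | h1 <;> linarith

theorem index_succ_eq {i P S p s : ℕ} (hp : p ≤ P) (hs : s ≤ S) :
    G.index (i + 1) P S = G.index i (P - p) (S - s) + G.rows * G.cols + p * G.cols + s := by
  obtain ⟨P', rfl⟩ := Nat.exists_eq_add_of_le' hp
  obtain ⟨S', rfl⟩ := Nat.exists_eq_add_of_le' hs
  unfold index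
  rw [Nat.add_sub_cancel, Nat.add_sub_cancel]
  ring

/-- All cells for i products precede those for i + 1, so filling the table by increasing index
respects the recursion. -/
theorem index_lt_index_succ {i P S P' S' : ℕ} (hP : P' < G.rows) (hS : S' < G.cols) :
    G.index i P' S' < G.index (i + 1) P S := by
  unfold index
  have h1 : i * G.rows + P' + 1 ≤ (i + 1) * G.rows + P := by nlinarith
  have h2 := Nat.mul_le_mul_right G.cols h1
  nlinarith

end Guess

/-- Standing assumptions on the guess and on the bound for the heights. -/
structure Guess.Admissible (G : Guess) (γ β : ℕ) : Prop where
  nonneg : G.Nonneg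
  g : 0 < G.g
  W : 0 < G.W
  heights : G.Heights γ
  bound : G.n * (4 * γ) + 12 * γ + 12 ≤ β

section Specs

variable {G : Guess} {γ β R : ℕ} {σ : Memory}

theorem Guess.Admissible.natCast (h : G.Admissible γ β) {k : ℕ}
    (hk : k ≤ (G.n + 1) * (G.rows * G.cols) + 1) : HeightLE γ (k : ℚ) :=
  heightLE_natCast (by have := h.heights.table; omega)

theorem slots_eq (h : G.Admissible γ β) (i p : ℕ) :
    ((⌊G.amount i p * (8 * G.n) / G.W⌋ : ℤ) : ℚ) = G.slots i p := by
  have h0 : 0 ≤ G.amount i p * (8 * G.n) / G.W := div_nonneg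
    (mul_nonneg (amount_nonneg h.nonneg.r h.g i p) (by positivity)) h.W.le
  unfold Guess.slots
  rw [natCast_floor_eq_intCast_floor h0]

/-- The branches of the program correspond to `Cell.of_not_plan` (twice), `Cell.of_lt` and
`Cell.of_le`. -/
theorem attempt_spec (hG : G.Admissible γ β) (hσ : Small β σ) (hE : G.Stored σ)
    {i P S p : ℕ} (hi : i < G.n) (hP : P < G.rows) (hS : S < G.cols) (hp : p ≤ P)
    (h10 : σ 10 0 = G.index (i + 1) P S) (h11 : σ 11 0 = i) (h13 : σ 13 0 = S) (h16 : σ 16 0 = p)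
    (hprev : ∀ P' S', P' < G.rows → S' < G.cols →
      G.Cell i P' S' (fun _ => True) (σ 14 (G.index i P' S')) (σ 15 (G.index i P' S')))
    (hcur : G.Cell (i + 1) P S (fun q => q i < p) (σ 14 (G.index (i + 1) P S))
      (σ 15 (G.index (i + 1) P S))) :
    Halts R β Algorithm.attempt σ fun τ =>
      G.Cell (i + 1) P S (fun q => q i < p + 1) (τ 14 (G.index (i + 1) P S))
        (τ 15 (G.index (i + 1) P S)) ∧
      ∀ t, t ≠ G.index (i + 1) P S → τ 14 t = σ 14 t ∧ τ 15 t = σ 15 t := by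
  have hβ := hG.bound
  have hpr : p < G.rows := by omega
  have ham := hG.heights.amount hi hpr
  have hidx := G.index_lt (i := i + 1) hi hP hS
  have h11' : (Expr.var 11).eval σ = i := by simp [h11]
  refine Halts.ite hσ (fun hlt => Halts.skip hσ ⟨hcur.of_not_plan (Or.inl ?_), by simp⟩)
    fun hlt => ?_
  · rw [Expr.eval_mul, Expr.eval_mul, hE.data.eval_price h11' hi,
      hE.data.eval_attraction h11' hi] at hlt
    simpa [Guess.Attains, hE.x₀, hE.g, h16] using hlt
  have hA : G.Attains i p := by
    rw [Expr.eval_mul, Expr.eval_mul, hE.data.eval_price h11' hi,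
      hE.data.eval_attraction h11' hi] at hlt
    simpa [Guess.Attains, hE.x₀, hE.g, h16] using hlt
  refine Halts.assign_seq (G.amount i p) hσ ?_ (ham.mono (by omega)) fun σ1 hσ1 hn1 h17 => ?_
  · rw [Expr.eval_div, hE.data.eval_price h11' hi]
    simp [Guess.amount, h16, hE.g]
  have hE1 := hE.of_ne hn1 (by simp)
  refine Halts.assign_seq (G.slots i p) hσ1 ?_ ?_ fun σ2 hσ2 hn2 h18 => ?_
  · rw [← slots_eq hG]
    simp [h17, hE1.data.n, hE1.W]
  · rw [← slots_eq hG]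
    have h8 : HeightLE γ (8 * G.n : ℚ) := by
      have := hG.natCast (k := 8 * G.n) (by
        have h1 := G.rows_pos
        have h2 : 8 * G.n ≤ G.rows * G.cols := by
          have : 8 * G.n ≤ G.cols := by unfold Guess.cols; omega
          nlinarith
        nlinarith)
      simpa using this
    exact ((ham.mul h8).div hG.heights.W).floor.mono (by omega)
  have hE2 := hE1.of_ne hn2 (by simp)
  have h13' : σ2 13 0 = S := by rw [hn2 13 (by simp), hn1 13 (by simp), h13]
  have h14' : σ2 14 = σ 14 := by rw [hn2 14 (by simp), hn1 14 (by simp)]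
  have h15' : σ2 15 = σ 15 := by rw [hn2 15 (by simp), hn1 15 (by simp)]
  refine Halts.ite hσ2 (fun hlt => Halts.skip hσ2 ⟨?_, by simp [h14', h15']⟩) fun hlt => ?_
  · rw [h14', h15']
    refine hcur.of_not_plan (Or.inr ?_)
    simpa [h13', h18] using hlt
  have hs : G.slots i p ≤ S := by simpa [h13', h18] using hlt
  have hS' : S - G.slots i p < G.cols := by omega
  have hP' : P - p < G.rows := by omega
  have hcell := hprev (P - p) (S - G.slots i p) hP' hS'
  refine Halts.assign_seq (G.index i (P - p) (S - G.slots i p) : ℕ) hσ2 ?_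
    ((hG.natCast ?_).mono (by omega)) fun σ3 hσ3 hn3 h28 => ?_
  · have h10' : σ2 10 0 = G.index (i + 1) P S := by
      rw [hn2 10 (by simp), hn1 10 (by simp), h10]
    have h16' : σ2 16 0 = p := by rw [hn2 16 (by simp), hn1 16 (by simp), h16]
    have h25' : σ2 25 0 = (G.cols : ℚ) := hE2.data.cols
    have h27' : σ2 27 0 = (G.rows * G.cols : ℕ) := hE2.data.size
    have := index_succ_eq (G := G) (i := i) hp hs
    simp only [Expr.eval_sub, Expr.eval_mul, Expr.eval_var, h10', h16', h25', h27', h18, this]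
    push_cast
    ring
  · have := G.index_lt (i := i) hi.le hP' hS'
    omega
  have hE3 := hE2.of_ne hn3 (by simp)
  have h11'' : (Expr.var 11).eval σ3 = i := by
    simp [hn3 11, hn2 11, hn1 11, h11]
  have h28' : (Expr.var 28).eval σ3 = (G.index i (P - p) (S - G.slots i p) : ℕ) := by
    simp [h28]
  have h14'' : σ3 14 = σ 14 := by rw [hn3 14 (by simp), h14']
  have h15'' : σ3 15 = σ 15 := by rw [hn3 15 (by simp), h15']
  refine Halts.assign_seq (σ 14 (G.index i (P - p) (S - G.slots i p)) + G.price i p) hσ3 ?_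
    (((hcell.height hG.heights hi.le hP').add (hG.heights.price hi hpr)).mono (by omega))
    fun σ4 hσ4 hn4 h19 => ?_
  · rw [Expr.eval_add, Expr.eval_mul, Expr.eval_get_of_eq h28', hE3.data.eval_cost h11'' hi]
    simp [h14'', Guess.price, hn3 17, hn2 17, h17]
  have h10'' : (Expr.var 10).eval σ4 = (G.index (i + 1) P S : ℕ) := by
    simp [hn4 10, hn3 10, hn2 10, hn1 10, h10]
  have h14e : σ4 14 = σ 14 := by rw [hn4 14 (by simp), h14'']
  have h15e : σ4 15 = σ 15 := by rw [hn4 15 (by simp), h15'']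
  have hE4 := hE3.of_ne hn4 (by simp)
  refine Halts.ite hσ4 (fun hlt => ?_) fun hlt => Halts.skip hσ4 ⟨?_, by simp [h14e, h15e]⟩
  · rw [Expr.eval_get_of_eq h10'', Expr.eval_var, h19, h14e] at hlt
    have hnew := hcur.of_lt hG.nonneg hG.g hcell hlt hA hp hs
    refine Halts.set_seq (σ 15 (G.index i (P - p) (S - G.slots i p)) * G.rows + p) hσ4 h10'' ?_
      ((hnew.height_code hG.heights hi hP).mono (by omega)) fun hσ5 => ?_
    · have h28'' : (Expr.var 28).eval σ4 = (G.index i (P - p) (S - G.slots i p) : ℕ) := by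
        simp [hn4 28, h28]
      have h26 : σ4 26 0 = (G.rows : ℚ) := hE4.data.rows
      rw [Expr.eval_add, Expr.eval_mul, Expr.eval_get_of_eq h28'']
      simp [h15e, h26, hn4 16, hn3 16, hn2 16, hn1 16, h16]
    refine Halts.set_of_eq (σ 14 (G.index i (P - p) (S - G.slots i p)) + G.price i p) hσ5
      (k := G.index (i + 1) P S) ?_ ?_
      ((hnew.height hG.heights hi hP).mono (by omega)) ⟨?_, fun t ht => ⟨?_, ?_⟩⟩
    · simpa [store_apply] using h10''
    · simp [store_apply, h19]
    · simpa [store_apply] using hnew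
    · simp [store_apply, ht, h14e]
    · simp [store_apply, ht, h15e]
  · rw [Expr.eval_get_of_eq h10'', Expr.eval_var, h19, h14e] at hlt
    rw [h14e, h15e]
    exact hcur.of_le hG.nonneg hG.g hcell hlt

end Specs

end Assortment

/-! ### Filling the table -/

namespace Assortment

open RatRAM Guess

/-- The cells of the table with index less than `t` are correct. -/
def Guess.TableUpTo (G : Guess) (t : ℕ) (σ : Memory) : Prop :=
  ∀ i P S, i ≤ G.n → P < G.rows → S < G.cols → G.index i P S < t →
    G.Cell i P S (fun _ => True) (σ 14 (G.index i P S)) (σ 15 (G.index i P S))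

section Specs

variable {G : Guess} {γ β R : ℕ} {σ : Memory}

theorem Guess.Cell.initial {i P S : ℕ} {X : (ℕ → ℕ) → Prop}
    (h : ∀ p, X p → ¬ G.Plan i p P S) : G.Cell i P S X (G.B + 1) 0 :=
  ⟨le_rfl, Or.inl ⟨rfl, rfl⟩, fun p hX hp => absurd hp (h p hX)⟩

theorem cell_spec (hG : G.Admissible γ β) (hR : G.rows ≤ R) (hσ : Small β σ) (hE : G.Stored σ)
    {t : ℕ} (ht : t < (G.n + 1) * (G.rows * G.cols)) (h10 : σ 10 0 = t)
    (htab : G.TableUpTo t σ) :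
    Halts R β Algorithm.cell σ fun τ => G.Stored τ ∧ G.TableUpTo (t + 1) τ := by
  have hβ := hG.bound
  have hq0 : 0 < G.rows * G.cols := Nat.mul_pos G.rows_pos G.cols_pos
  have hidx := G.index_div_mod t
  have hin : t / (G.rows * G.cols) ≤ G.n :=
    Nat.lt_succ_iff.1 ((Nat.div_lt_iff_lt_mul hq0).2 ht)
  have hi0 : t < G.rows * G.cols ↔ t / (G.rows * G.cols) = 0 :=
    ⟨Nat.div_eq_of_lt, fun h => (Nat.div_eq_zero_iff_lt hq0).1 h⟩
  have hqt : t % (G.rows * G.cols) + t / (G.rows * G.cols) * (G.rows * G.cols) = t :=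
    Nat.mod_add_div' _ _
  have hql := Nat.mod_lt t hq0
  generalize hi : t / (G.rows * G.cols) = i at *
  generalize hq : t % (G.rows * G.cols) = q at *
  have hP : q / G.cols < G.rows := (Nat.div_lt_iff_lt_mul G.cols_pos).2 hql
  have hS := Nat.mod_lt q G.cols_pos
  have hPS : q % G.cols + q / G.cols * G.cols = q :=
    Nat.mod_add_div' _ _
  generalize hPd : q / G.cols = P at *
  generalize hSd : q % G.cols = S at *
  have h27 : σ 27 0 = (G.rows * G.cols : ℕ) := hE.data.size
  have hdiv : (Expr.floor (.var 10 / .var 27)).eval σ = i := by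
    simp only [Expr.eval_floor, Expr.eval_div, Expr.eval_var, h10, h27]
    rw [floor_natCast_div, hi]
  -- The last product of the cell is i - 1. In the layer i = 0 this is -1, but there it is never
  -- used.
  refine Halts.assign_seq ((i : ℚ) - 1) hσ (by rw [Expr.eval_sub, hdiv]; simp) ?_
    fun σ1 hσ1 hn1 h11 => ?_
  · exact ((hG.natCast (k := i) (by nlinarith)).sub heightLE_one).mono (by omega)
  have h10' : σ1 10 0 = t := by rw [hn1 10 (by simp), h10]
  have h27' : σ1 27 0 = (G.rows * G.cols : ℕ) := by rw [hn1 27 (by simp), h27]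
  have hdiv' : (Expr.floor (.var 10 / .var 27)).eval σ1 = i := by
    simp only [Expr.eval_floor, Expr.eval_div, Expr.eval_var, h10', h27']
    rw [floor_natCast_div, hi]
  refine Halts.assign_seq (q : ℚ) hσ1 ?_ ((hG.natCast (by omega)).mono (by omega))
    fun σ2 hσ2 hn2 h24 => ?_
  · rw [Expr.eval_sub, Expr.eval_mul, hdiv', Expr.eval_var, Expr.eval_var, h10', h27', ← hqt]
    push_cast
    ring
  have h25 : σ2 25 0 = (G.cols : ℚ) := by
    rw [hn2 25 (by simp), hn1 25 (by simp)]
    exact hE.data.cols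
  have hcast : q ≤ (G.n + 1) * (G.rows * G.cols) + 1 := by omega
  have hPq : P ≤ q := hPd ▸ Nat.div_le_self _ _
  refine Halts.assign_seq (P : ℚ) hσ2 ?_ ((hG.natCast (by omega)).mono (by omega))
    fun σ3 hσ3 hn3 h12 => ?_
  · simp only [Expr.eval_floor, Expr.eval_div, Expr.eval_var, h24, h25]
    rw [floor_natCast_div, hPd]
  refine Halts.assign_seq (S : ℚ) hσ3 ?_ ((hG.natCast (by omega)).mono (by omega))
    fun σ4 hσ4 hn4 h13 => ?_
  · rw [Expr.eval_sub, Expr.eval_mul, Expr.eval_var, Expr.eval_var, Expr.eval_var, h12,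
      hn3 24 (by simp), h24, hn3 25 (by simp), h25, ← hPS]
    push_cast
    ring
  have hE4 : G.Stored σ4 := (((hE.of_ne hn1 (by simp)).of_ne hn2 (by simp)).of_ne hn3
    (by simp)).of_ne hn4 (by simp)
  have h10'' : (Expr.var 10).eval σ4 = t := by
    simp [hn4 10, hn3 10, hn2 10, h10']
  have h11' : σ4 11 0 = (i : ℚ) - 1 := by
    rw [hn4 11 (by simp), hn3 11 (by simp), hn2 11 (by simp), h11]
  have h12' : σ4 12 0 = (P : ℚ) := by rw [hn4 12 (by simp), h12]
  have h14 : σ4 14 = σ 14 := by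
    rw [hn4 14 (by simp), hn3 14 (by simp), hn2 14 (by simp), hn1 14 (by simp)]
  have h15 : σ4 15 = σ 15 := by
    rw [hn4 15 (by simp), hn3 15 (by simp), hn2 15 (by simp), hn1 15 (by simp)]
  have hB1 : HeightLE β (G.B + 1) :=
    (hG.heights.B.add heightLE_one).mono (by omega)
  refine Halts.set_seq (G.B + 1) hσ4 h10'' (by simp [hE4.data.B]) hB1 fun hσ5 => ?_
  refine Halts.set_seq 0 hσ5 (k := t) (by simpa [store_apply] using h10'') (by simp) heightLE_zero
    fun hσ6 => ?_
  generalize hσ6d : store (store σ4 14 t (G.B + 1)) 15 t 0 = σ6 at *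
  have hoth : ∀ a, a ≠ 14 → a ≠ 15 → σ6 a = σ4 a := fun a h1 h2 => by
    rw [← hσ6d, store_of_ne _ h2, store_of_ne _ h1]
  have h14t : σ6 14 t = G.B + 1 := by rw [← hσ6d]; simp [store_apply]
  have h15t : σ6 15 t = 0 := by rw [← hσ6d]; simp
  have h14o : ∀ s, s ≠ t → σ6 14 s = σ 14 s := fun s hs => by
    rw [← hσ6d]; simp [store_apply, hs, h14]
  have h15o : ∀ s, s ≠ t → σ6 15 s = σ 15 s := fun s hs => by
    rw [← hσ6d]; simp [store_apply, hs, h15]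
  have hE6 : G.Stored σ6 := hE4.congr fun a ha => hoth a (by rintro rfl; simp at ha)
    (by rintro rfl; simp at ha)
  have h10t : (Expr.var 10).eval σ6 = t := by
    simpa [hoth] using h10''
  -- a correct entry completes the table
  have hfin : ∀ τ : Memory, (∀ s, s ≠ t → τ 14 s = σ 14 s) → (∀ s, s ≠ t → τ 15 s = σ 15 s) →
      G.Cell i P S (fun _ => True) (τ 14 t) (τ 15 t) → G.TableUpTo (t + 1) τ := by
    intro τ h1 h2 h3 i' P' S' hi' hP' hS' hlt
    rcases Nat.lt_succ_iff_lt_or_eq.1 hlt with hlt | heq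
    · rw [h1 _ hlt.ne, h2 _ hlt.ne]
      exact htab i' P' S' hi' hP' hS' hlt
    · obtain ⟨rfl, rfl, rfl⟩ := index_inj hP' hS' hP hS (heq.trans hidx.symm)
      rw [heq]
      exact h3
  -- In the layer i = 0 only the empty plan exists, with both totals 0, that is, in the cell of
  -- index 0.
  refine Halts.ite hσ6 (fun hlt => ?_) fun hlt => ?_
  · have ht0 : t = 0 := by
      rw [h10t] at hlt
      have : (t : ℚ) < (1 : ℕ) := hlt
      have := Nat.cast_lt.1 this
      omega
    refine Halts.set_of_eq 0 hσ6 h10t (by simp) heightLE_zero ⟨?_, hfin _ ?_ ?_ ?_⟩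
    · exact hE6.of_ne (a := 14) (fun b hb => store_of_ne _ hb _ _) (by simp)
    · intro s hs
      simp [store_apply, hs, h14o]
    · intro s hs
      simp [store_apply, h15o, hs]
    · obtain ⟨rfl, rfl, rfl⟩ := index_inj hP hS G.rows_pos G.cols_pos
        (hidx.trans (ht0.trans (by simp [Guess.index] : 0 = G.index 0 0 0)))
      refine ⟨?_, Or.inr ⟨fun _ => 0, ⟨by simp, by simp, by simp⟩, ?_, ?_⟩, fun p _ _ _ => ?_⟩
      · simpa [store_apply] using by linarith [hG.nonneg.B]
      · simp [Guess.cost]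
      · simp [store_apply, h15t, Guess.code]
      · simp [Guess.cost]
  · have ht0 : t ≠ 0 := by
      rintro rfl
      rw [h10t] at hlt
      simp at hlt
    refine Halts.ite hσ6 (fun hlt' => Halts.skip hσ6 ⟨hE6, hfin _ h14o h15o ?_⟩) fun hlt' => ?_
    · rw [h10t, Expr.eval_var, hE6.data.size] at hlt'
      have hi' := hi0.1 (Nat.cast_lt.1 hlt')
      subst hi'
      rw [h14t, h15t]
      refine Cell.initial fun p _ hp => ht0 ?_
      obtain ⟨-, h1, h2⟩ := hp
      simp only [Finset.range_zero, Finset.sum_empty] at h1 h2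
      rw [← hidx, ← h1, ← h2]
      simp [Guess.index]
    · rw [h10t, Expr.eval_var, hE6.data.size] at hlt'
      have hi1 : i ≠ 0 := fun h => hlt' (Nat.cast_lt.2 (hi0.2 h))
      obtain ⟨l, rfl⟩ := Nat.exists_eq_succ_of_ne_zero hi1
      -- After k iterations the cell is correct with respect to the plans whose last entry is less
      -- than k. An entry is at most P, so P + 1 iterations cover all plans.
      refine Halts.for (fun k τ => G.Stored τ ∧ τ 10 0 = t ∧ τ 11 0 = l ∧ τ 12 0 = P ∧
          τ 13 0 = S ∧ (∀ s, s ≠ t → τ 14 s = σ 14 s ∧ τ 15 s = σ 15 s) ∧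
          G.Cell (l + 1) P S (fun p => p l < k) (τ 14 t) (τ 15 t)) (P + 1) (by omega) ?_ hσ6
        ⟨hE6, ?_, ?_, ?_, ?_, fun s hs => ⟨h14o s hs, h15o s hs⟩, ?_⟩ rfl ?_ ?_ ?_ ?_
      · have := hG.heights.table
        have : 2 ^ γ ≤ 2 ^ β := Nat.pow_le_pow_right (by norm_num) (by omega)
        omega
      · simpa using h10t
      · rw [hoth 11 (by simp) (by simp), h11']
        push_cast
        ring
      · rw [hoth 12 (by simp) (by simp), h12']
      · rw [hoth 13 (by simp) (by simp), h13]
      · rw [h14t, h15t]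
        exact Cell.initial fun p hp => absurd hp (Nat.not_lt_zero _)
      · rintro k τ υ hυ ⟨h1, h2, h3, h4, h5, h6, h7⟩
        refine ⟨h1.of_ne hυ (by simp), ?_, ?_, ?_, ?_, ?_, ?_⟩
        · rwa [hυ 10 (by simp)]
        · rwa [hυ 11 (by simp)]
        · rwa [hυ 12 (by simp)]
        · rwa [hυ 13 (by simp)]
        · rwa [hυ 14 (by simp), hυ 15 (by simp)]
        · rwa [hυ 14 (by simp), hυ 15 (by simp)]
      · rintro k τ ⟨-, -, -, h4, -⟩
        simp [h4]
      · rintro k τ hτ ⟨h1, h2, h3, h4, h5, h6, h7⟩ h16 hk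
        rw [← hidx] at h2 h6 h7
        refine (attempt_spec hG hτ h1 hin hP hS (Nat.lt_succ_iff.1 hk) h2 h3 h5 h16 ?_ h7).frame.mono
          ?_
        · intro P' S' hP' hS'
          have hlt := index_lt_index_succ (G := G) (i := l) (P := P) (S := S) hP' hS'
          rw [(h6 _ hlt.ne).1, (h6 _ hlt.ne).2]
          exact htab l P' S' (by omega) hP' hS' (by rwa [← hidx])
        · rintro υ ⟨-, hfr, h8, h9⟩
          rw [← hidx]
          refine ⟨h1.congr fun a ha => hfr a ?_, ?_, ?_, ?_, ?_, fun s hs => ?_, h8⟩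
          · simp only [List.mem_cons, List.not_mem_nil, or_false] at ha
            rcases ha with rfl | rfl | rfl | rfl | rfl | rfl | rfl | rfl | rfl <;> rfl
          · rw [hfr 10 rfl, h2]
          · rw [hfr 11 rfl, h3]
          · rw [hfr 12 rfl, h4]
          · rw [hfr 13 rfl, h5]
          · rw [(h9 s hs).1, (h9 s hs).2]
            exact h6 s hs
      · rintro τ ⟨h1, -, -, -, -, h6, h7⟩
        refine ⟨h1, hfin τ (fun s hs => (h6 s hs).1) (fun s hs => (h6 s hs).2)
          ⟨h7.1, h7.2.1, fun p _ hp hB => h7.2.2 p ?_ hp hB⟩⟩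
        exact Nat.lt_succ_of_le (hp.le (Nat.lt_succ_self l))

theorem table_spec (hG : G.Admissible γ β) (hR : (G.n + 1) * (G.rows * G.cols) ≤ R)
    (hσ : Small β σ) (hE : G.Stored σ) :
    Halts R β Algorithm.table σ fun τ =>
      G.Stored τ ∧ G.TableUpTo ((G.n + 1) * (G.rows * G.cols)) τ := by
  have hβ := hG.bound
  refine Halts.for (fun t τ => G.Stored τ ∧ G.TableUpTo t τ) _ hR ?_ hσ
    ⟨hE, fun i P S _ _ _ h => absurd h (Nat.not_lt_zero _)⟩ rfl ?_ ?_ ?_ (fun _ h => h)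
  · have := hG.heights.table
    have : 2 ^ γ ≤ 2 ^ β := Nat.pow_le_pow_right (by norm_num) (by omega)
    omega
  · rintro k τ υ hυ ⟨h1, h2⟩
    refine ⟨h1.of_ne hυ (by simp), fun i P S => ?_⟩
    rw [hυ 14 (by simp), hυ 15 (by simp)]
    exact h2 i P S
  · rintro k τ ⟨h1, -⟩
    have h27 : τ 27 0 = (G.rows * G.cols : ℕ) := h1.data.size
    simp [h1.data.n, h27]
  · rintro k τ hτ ⟨h1, h2⟩ h10 hk
    refine cell_spec hG (le_trans ?_ hR) hτ h1 hk h10 h2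
    have := G.cols_pos
    nlinarith [Nat.mul_le_mul_left G.rows this, Nat.zero_le (G.n * (G.rows * G.cols))]

end Specs

end Assortment

/-! ### Decoding plans and keeping the best one -/

namespace Assortment

open RatRAM Guess

/-- The output array holds a feasible inventory that certifies the best revenue so far. -/
def Data.Output (D : Data) (σ : Memory) : Prop :=
  ∃ c : ℕ → ℕ, (∀ i < D.n, σ 1 i = c i) ∧ ∑ i ∈ Finset.range D.n, D.b i * c i ≤ D.B ∧
    0 ≤ σ 20 0 ∧ D.Sells c ((8 / 9 * σ 20 0 : ℚ) : ℝ)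

theorem Data.Output.congr {D : Data} {σ τ : Memory} (h : D.Output σ) (h1 : τ 1 = σ 1)
    (h20 : τ 20 = σ 20) : D.Output τ := by
  unfold Data.Output
  rwa [h1, h20]

section Specs

variable {G : Guess} {γ β R : ℕ} {σ : Memory}

theorem Guess.code_succ_div {p : ℕ → ℕ} {k : ℕ} (hp : p k < G.rows) :
    G.code p (k + 1) / G.rows = G.code p k := by
  rw [Guess.code, mul_comm, Nat.mul_add_div G.rows_pos, Nat.div_eq_of_lt hp, add_zero]

/-- Division with remainder yields the last digit first, so the output is written from the last
product backwards; after k rounds the code of the first n - k entries remains. -/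
theorem decode_spec (hG : G.Admissible γ β) (hR : G.n ≤ R) (hσ : Small β σ) (hE : G.Stored σ)
    {t : ℕ} (h10 : σ 10 0 = t) {p : ℕ → ℕ} (hp : ∀ l < G.n, p l < G.rows)
    (h15 : σ 15 t = G.code p G.n) :
    Halts R β Algorithm.decode σ fun τ =>
      ∀ i < G.n, τ 1 i = ((⌈G.amount i (p i)⌉ : ℤ) : ℚ) := by
  have hβ := hG.bound
  have hrow : ∀ k < G.rows, k + 1 ≤ 2 ^ γ := fun k hk => by
    have h1 := hG.heights.table
    have := G.cols_pos
    nlinarith [Nat.mul_le_mul_left G.rows this, Nat.zero_le (G.n * (G.rows * G.cols))]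
  have hcode : ∀ k ≤ G.n, HeightLE β (G.code p k : ℚ) := fun k hk =>
    (hG.heights.code hk fun l hl => hp l (by omega)).mono (by omega)
  refine Halts.assign_seq (G.code p G.n : ℚ) hσ ?_ (hcode _ le_rfl) fun σ1 hσ1 hn1 h22 => ?_
  · rw [Expr.eval_get_of_eq (k := t) (by simpa using h10), h15]
  refine Halts.for (fun k τ => G.Stored τ ∧ τ 22 0 = G.code p (G.n - k) ∧
    ∀ i < G.n, G.n - k ≤ i → τ 1 i = ((⌈G.amount i (p i)⌉ : ℤ) : ℚ)) G.n hR ?_ hσ1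
    ⟨hE.of_ne hn1 (by simp), by simpa using h22, fun i hi h => by omega⟩ rfl ?_ ?_ ?_ ?_
  · have := hG.heights.table
    have h1 : 2 ^ γ ≤ 2 ^ β := Nat.pow_le_pow_right (by norm_num) (by omega)
    have : 0 < G.rows * G.cols := Nat.mul_pos G.rows_pos G.cols_pos
    nlinarith
  · rintro k τ υ hυ ⟨h1, h2, h3⟩
    refine ⟨h1.of_ne hυ (by simp), by rwa [hυ 22 (by simp)], ?_⟩
    rwa [hυ 1 (by simp)]
  · rintro k τ ⟨h1, -⟩
    simp [h1.data.n]
  · rintro k τ hτ ⟨h1, h2, h3⟩ h23 hk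
    obtain ⟨m, hm⟩ : ∃ m, G.n = m + 1 + k := ⟨G.n - k - 1, by omega⟩
    have hmk : G.n - k = m + 1 := by omega
    have hmk' : G.n - (k + 1) = m := by omega
    have hmn : m < G.n := by omega
    rw [hmk] at h2 h3
    rw [hmk']
    have hdiv := G.code_succ_div (hp m hmn)
    have h26 : ∀ {τ : Memory}, G.Stored τ → τ 26 0 = (G.rows : ℚ) := fun h => h.data.rows
    refine Halts.assign_seq (G.code p m : ℚ) hτ ?_ (hcode m hmn.le) fun τ1 hτ1 hm1 h24 => ?_
    · simp only [Expr.eval_floor, Expr.eval_div, Expr.eval_var, h2, h26 h1]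
      rw [floor_natCast_div, hdiv]
    have hE1 := h1.of_ne hm1 (by simp)
    refine Halts.assign_seq (p m : ℚ) hτ1 ?_
      ((heightLE_natCast (hrow _ (hp m hmn))).mono (by omega)) fun τ2 hτ2 hm2 h16 => ?_
    · simp only [Expr.eval_sub, Expr.eval_mul, Expr.eval_var, hm1 22 (by simp), h2, h24, h26 hE1,
        Guess.code]
      push_cast
      ring
    have hE2 := hE1.of_ne hm2 (by simp)
    refine Halts.assign_seq (G.code p m : ℚ) hτ2 ?_ (hcode m hmn.le) fun τ3 hτ3 hm3 h22' => ?_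
    · rw [Expr.eval_var, hm2 24 (by simp), h24]
    have hE3 := hE2.of_ne hm3 (by simp)
    have hidx : (Expr.var 0 - 1 - Expr.var 23).eval τ3 = m := by
      have h23' : τ3 23 0 = k := by rw [hm3 23 (by simp), hm2 23 (by simp), hm1 23 (by simp), h23]
      simp only [Expr.eval_sub, Expr.eval_var, Expr.eval_ofNat, hE3.data.n, h23', hm]
      push_cast
      ring
    refine Halts.set_of_eq ((⌈G.amount m (p m)⌉ : ℤ) : ℚ) hτ3 hidx ?_
      ((hG.heights.amount hmn (hp m hmn)).ceil.mono (by omega)) ⟨?_, ?_, ?_⟩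
    · have h16' : τ3 16 0 = p m := by rw [hm3 16 (by simp), h16]
      rw [Expr.eval_ceil, Expr.eval_div, hE3.data.eval_price hidx hmn]
      simp [h16', hE3.g, Guess.amount]
    · exact hE3.of_ne (a := 1) (fun b hb => store_of_ne _ hb _ _) (by simp)
    · simpa [store_apply] using h22'
    · intro i hi hmi
      rcases hmi.eq_or_lt with rfl | hmi
      · simp
      · rw [store_apply, if_neg (by omega), hm3 1 (by simp), hm2 1 (by simp), hm1 1 (by simp)]
        exact h3 i hi hmi
  · rintro τ ⟨-, -, h3⟩ i hi
    exact h3 i hi (by omega)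

/-- The scan covers the cells for all n products. The variable 20 keeps the nominal revenue P g, of
which `sells_of_plan` certifies the fraction 8/9 for the inventory in the output. -/
theorem extract_spec (hG : G.Admissible γ β) (hR : (G.n + 1) * (G.rows * G.cols) ≤ R)
    (hx₀ : 0 ≤ G.x₀) (hT : G.W + G.x₀ ≤ G.T) (hσ : Small β σ) (hE : G.Stored σ)
    (htab : G.TableUpTo ((G.n + 1) * (G.rows * G.cols)) σ) (hout : G.Output σ) :
    Halts R β Algorithm.extract σ fun τ =>
      G.Output τ ∧ σ 20 0 ≤ τ 20 0 ∧ Data.Dominates G (τ 20 0) := by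
  have hβ := hG.bound
  have hpos : 0 < G.rows * G.cols := Nat.mul_pos G.rows_pos G.cols_pos
  refine Halts.for (fun q τ => G.Stored τ ∧ τ 14 = σ 14 ∧ τ 15 = σ 15 ∧ G.Output τ ∧
    σ 20 0 ≤ τ 20 0 ∧ ∀ P S, P < G.rows → S < G.cols → P * G.cols + S < q →
      σ 14 (G.index G.n P S) ≤ G.B → P * G.g ≤ τ 20 0) (G.rows * G.cols) ?_ ?_ hσ
    ⟨hE, rfl, rfl, hout, le_rfl, fun P S _ _ h => absurd h (Nat.not_lt_zero _)⟩ rfl ?_ ?_ ?_ ?_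
  · nlinarith
  · have := hG.heights.table
    have : 2 ^ γ ≤ 2 ^ β := Nat.pow_le_pow_right (by norm_num) (by omega)
    nlinarith
  · rintro k τ υ hυ ⟨h1, h2, h3, h4, h5, h6⟩
    refine ⟨h1.of_ne hυ (by simp), by rwa [hυ 14 (by simp)], by rwa [hυ 15 (by simp)],
      h4.congr (hυ 1 (by simp)) (hυ 20 (by simp)), ?_, ?_⟩
    · rwa [hυ 20 (by simp)]
    · rwa [hυ 20 (by simp)]
  · rintro k τ ⟨h1, -⟩
    have h27 : τ 27 0 = (G.rows * G.cols : ℕ) := h1.data.size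
    simp [h27]
  · rintro q τ hτ ⟨h1, h2, h3, h4, h5, h6⟩ h21 hq
    have hP : q / G.cols < G.rows := (Nat.div_lt_iff_lt_mul G.cols_pos).2 hq
    have hS := Nat.mod_lt q G.cols_pos
    have hPS : q / G.cols * G.cols + q % G.cols = q := Nat.div_add_mod' _ _
    have hPq : q / G.cols ≤ q := Nat.div_le_self _ _
    generalize hPd : q / G.cols = P at *
    generalize hSd : q % G.cols = S at *
    have hidx : G.index G.n P S = G.n * (G.rows * G.cols) + q := by
      unfold Guess.index
      rw [← hPS]
      ring
    have hcell := htab G.n P S le_rfl hP hS (G.index_lt le_rfl hP hS)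
    have huniq : ∀ P' S', P' < G.rows → S' < G.cols → P' * G.cols + S' < q + 1 →
        P' * G.cols + S' < q ∨ P' = P ∧ S' = S := by
      intro P' S' hP' hS' hlt
      rcases Nat.lt_succ_iff_lt_or_eq.1 hlt with hlt | heq
      · exact Or.inl hlt
      · right
        have := G.index_inj (i := 0) (i' := 0) hP' hS' hP hS (by
          unfold Guess.index
          simpa [hPS] using heq)
        exact this.2
    refine Halts.assign_seq (G.index G.n P S : ℚ) hτ ?_
      ((hG.natCast (by have := G.index_lt le_rfl hP hS; omega)).mono (by omega))
      fun τ1 hτ1 hn1 h10 => ?_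
    · have h27 : τ 27 0 = (G.rows * G.cols : ℕ) := h1.data.size
      simp only [Expr.eval_add, Expr.eval_mul, Expr.eval_var, h1.data.n, h27, h21, hidx]
      push_cast
      ring
    have hE1 := h1.of_ne hn1 (by simp)
    have h25 : τ1 25 0 = (G.cols : ℚ) := hE1.data.cols
    refine Halts.assign_seq (P : ℚ) hτ1 ?_ ((hG.natCast (by nlinarith)).mono (by omega))
      fun τ2 hτ2 hn2 h12 => ?_
    · simp only [Expr.eval_floor, Expr.eval_div, Expr.eval_var, hn1 21 (by simp), h21, h25]
      rw [floor_natCast_div, hPd]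
    have hE2 := hE1.of_ne hn2 (by simp)
    have h14 : τ2 14 = σ 14 := by rw [hn2 14 (by simp), hn1 14 (by simp), h2]
    have h15 : τ2 15 = σ 15 := by rw [hn2 15 (by simp), hn1 15 (by simp), h3]
    have h20 : τ2 20 = τ 20 := by rw [hn2 20 (by simp), hn1 20 (by simp)]
    have h10' : (Expr.var 10).eval τ2 = (G.index G.n P S : ℕ) := by
      simp [hn2 10, h10]
    have hO2 : G.Output τ2 :=
      h4.congr (by rw [hn2 1 (by simp), hn1 1 (by simp)]) h20
    refine Halts.ite hτ2 (fun hlt => Halts.skip hτ2 ?_) fun hlt => ?_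
    · rw [Expr.eval_get_of_eq h10', Expr.eval_var, hE2.data.B, h14] at hlt
      refine ⟨hE2, h14, h15, hO2, h20 ▸ h5, fun P' S' hP' hS' hl hB => ?_⟩
      rw [h20]
      rcases huniq P' S' hP' hS' hl with hl | ⟨rfl, rfl⟩
      · exact h6 P' S' hP' hS' hl hB
      · exact absurd hB (not_le.2 hlt)
    · rw [Expr.eval_get_of_eq h10', Expr.eval_var, hE2.data.B, h14, not_lt] at hlt
      have hval : (Expr.var 12 * Expr.var 9).eval τ2 = P * G.g := by
        simp [h12, hE2.g]
      refine Halts.ite hτ2 (fun hlt' => ?_) fun hlt' => Halts.skip hτ2 ?_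
      · rw [hval, Expr.eval_var] at hlt'
        obtain ⟨p, hplan, hcost, hcode⟩ : ∃ p, G.Plan G.n p P S ∧
            σ 14 (G.index G.n P S) = G.cost p G.n ∧ σ 15 (G.index G.n P S) = G.code p G.n := by
          -- The default cost B + 1 is over budget, so an affordable cell carries a plan.
          rcases hcell.2.1 with ⟨h, -⟩ | h
          · linarith
          · exact h
        refine Halts.assign_seq (P * G.g) hτ2 hval ?_ fun τ3 hτ3 hn3 h20' => ?_
        · exact ((hG.natCast (by nlinarith)).mul hG.heights.g).mono (by omega)
        refine (decode_spec hG (by nlinarith) hτ3 (hE2.of_ne hn3 (by simp))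
          (by rw [hn3 10 (by simp)]; simpa using h10')
          (fun l hl => (hplan.le hl).trans_lt hP) (by rw [hn3 15 (by simp), h15, hcode])).frame.mono
          ?_
        rintro υ ⟨-, hfr, hdec⟩
        have h20υ : υ 20 0 = P * G.g := by rw [hfr 20 rfl, h20']
        refine ⟨(hE2.of_ne hn3 (by simp)).congr fun a ha => hfr a ?_, ?_, ?_, ?_, ?_, ?_⟩
        · simp only [List.mem_cons, List.not_mem_nil, or_false] at ha
          rcases ha with rfl | rfl | rfl | rfl | rfl | rfl | rfl | rfl | rfl <;> rfl
        · rw [hfr 14 rfl, hn3 14 (by simp), h14]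
        · rw [hfr 15 rfl, hn3 15 (by simp), h15]
        · have hcl : ∀ i, ((⌈G.amount i (p i)⌉ : ℤ) : ℚ) = (⌈G.amount i (p i)⌉₊ : ℚ) := fun i =>
            (natCast_ceil_eq_intCast_ceil (amount_nonneg hG.nonneg.r hG.g i (p i))).symm
          refine ⟨fun i => ⌈G.amount i (p i)⌉₊, fun i hi => ?_, ?_, ?_, ?_⟩
          · rw [hdec i hi, hcl]
          · rw [hcost] at hlt
            refine le_trans (le_of_eq (Finset.sum_congr rfl fun i _ => ?_)) hlt
            rw [Guess.price, hcl]
          · rw [h20υ]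
            have := hG.g
            positivity
          · rw [h20υ]
            refine sells_of_plan hG.nonneg hG.g hG.W hx₀ hT hplan ?_
            exact Nat.lt_succ_iff.1 hS
        · rw [h20υ]
          rw [h20] at hlt'
          linarith
        · intro P' S' hP' hS' hl hB
          rw [h20υ]
          rcases huniq P' S' hP' hS' hl with hl | ⟨rfl, rfl⟩
          · have := h6 P' S' hP' hS' hl hB
            rw [h20] at hlt'
            linarith
          · exact le_rfl
      · rw [hval, Expr.eval_var, not_lt] at hlt'
        refine ⟨hE2, h14, h15, hO2, h20 ▸ h5, fun P' S' hP' hS' hl hB => ?_⟩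
        rcases huniq P' S' hP' hS' hl with hl | ⟨rfl, rfl⟩
        · rw [h20]
          exact h6 P' S' hP' hS' hl hB
        · exact hlt'
  · rintro τ ⟨-, -, -, h4, h5, h6⟩
    refine ⟨h4, h5, fun _ p P S hplan hP hS hcost => ?_⟩
    have hP' : P < G.rows := Nat.lt_succ_iff.2 hP
    have hS' : S < G.cols := Nat.lt_succ_iff.2 hS
    refine h6 P S hP' hS' ?_ ?_
    · nlinarith [Nat.mul_le_mul_right G.cols (Nat.succ_le_of_lt hP')]
    -- The stored cost is at most that of any affordable plan of the cell, so the scan has taken the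
    -- cell into account.
    · exact ((htab G.n P S le_rfl hP' hS' (G.index_lt le_rfl hP' hS')).2.2 p trivial hplan
        hcost).trans hcost

end Specs

end Assortment

/-! ### The search over all guesses, with its bounds -/

namespace Assortment

open RatRAM Guess

/-- Bounds for the heights of the data. -/
structure Data.Heights (D : Data) (m : ℕ) : Prop where
  n : D.n + 1 ≤ 2 ^ m
  r : ∀ i < D.n, HeightLE m (D.r i)
  v : ∀ i < D.n, HeightLE m (D.v i)
  b : ∀ i < D.n, HeightLE m (D.b i)
  T : HeightLE m D.T
  B : HeightLE m D.B

/-- Bound for the number of guesses for the sales of the outside option. -/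
def Data.steps (D : Data) (m : ℕ) : ℕ := 8 * (D.n * m + 2)

/-- Bound for the heights of the quantities of a guess. -/
def Data.guessHeight (D : Data) (m : ℕ) : ℕ := 5 * m + 5 * D.steps m + 10

/-- Bound for the heights of all numbers that occur. -/
def Data.memoryHeight (D : Data) (m : ℕ) : ℕ :=
  D.n * (4 * D.guessHeight m) + 12 * D.guessHeight m + 12

/-- Bound for the number of iterations of all loops. -/
def Data.iterations (D : Data) (m : ℕ) : ℕ :=
  D.steps m + (D.n + 1) * ((8 * D.n * D.n + 1) * (8 * D.n + 1))

section Specs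

variable {D : Data} {m j k R : ℕ} {σ : Memory}

theorem heightLE_pow (k : ℕ) : HeightLE (k * 5 + 1) ((8 / 9 : ℚ) ^ k) := by
  -- The exponent 5 comes from 8 + 9 ≤ 2^5.
  refine HeightLE.pow (HeightLE.of_eq_div (a := 8) (b := 9) (by norm_num) (by norm_num) ?_) k
  norm_num

theorem Data.Heights.table (h : D.Heights m) {γ : ℕ} (hγ : 4 * m + 8 ≤ γ) :
    (D.n + 1) * ((8 * D.n * D.n + 1) * (8 * D.n + 1)) + 2 ≤ 2 ^ γ := by
  have hn := h.n
  have h1 : 8 * D.n * D.n + 1 ≤ 8 * (2 ^ m * 2 ^ m) := by nlinarith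
  have h2 : 8 * D.n + 1 ≤ 8 * 2 ^ m := by omega
  have h3 := Nat.mul_le_mul hn (Nat.mul_le_mul h1 h2)
  have h4 : 2 ^ (4 * m + 8) ≤ 2 ^ γ := Nat.pow_le_pow_right (by norm_num) hγ
  have h5 : 2 ^ (4 * m + 8) = 4 * (2 ^ m * (8 * (2 ^ m * 2 ^ m) * (8 * 2 ^ m))) := by
    ring
  have h6 : 0 < 2 ^ m * (8 * (2 ^ m * 2 ^ m) * (8 * 2 ^ m)) := by positivity
  omega

theorem Data.Heights.eight_mul (h : D.Heights m) : HeightLE (m + 4) (8 * D.n : ℚ) := by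
  have hn := h.n
  have : ((8 * D.n : ℕ) : ℚ) = 8 * D.n := by push_cast; rfl
  rw [← this]
  refine heightLE_natCast ?_
  rw [pow_add]
  omega

/-- Bound for the heights of the sales of the outside option. -/
theorem Data.Heights.x₀ (h : D.Heights m) (hk : k ≤ D.steps m) :
    HeightLE (m + (5 * D.steps m + 1)) (D.T * (8 / 9) ^ k) :=
  (h.T.mul (heightLE_pow k)).mono (by omega)

theorem Data.Heights.peak (h : D.Heights m) (hj : j < D.n) {γ : ℕ} {x₀ W : ℚ}
    (hx : HeightLE γ x₀) (hW : HeightLE (m + γ) W) (hm : m ≤ γ) :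
    HeightLE (m + γ) (D.peak j x₀ W) := by
  unfold Data.peak
  split_ifs
  · exact ((h.B.div (h.b j hj)).floor).mono (by omega)
  · rcases min_choice (D.v j * x₀) W with h1 | h1 <;> rw [h1]
    · exact ((h.v j hj).mul hx).mono (by omega)
    · exact hW

theorem Data.Heights.guess (h : D.Heights m) (hj : j < D.n) (hk : k < D.steps m) :
    (D.guess j k).Heights (D.guessHeight m) where
  r := fun i hi => (h.r i hi).mono (by unfold guessHeight; omega)
  b := fun i hi => (h.b i hi).mono (by unfold guessHeight; omega)
  B := h.B.mono (by unfold guessHeight; omega)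
  W := (h.T.sub (h.x₀ (k := k + 1) hk)).mono (by unfold guessHeight; omega)
  g := (((h.r j hj).mul (h.peak hj (h.x₀ (k := k + 1) hk) (h.T.sub (h.x₀ (k := k + 1) hk))
    (by omega))).div h.eight_mul).mono (by unfold guessHeight; omega)
  table := h.table (by unfold guessHeight; omega)

theorem guess_W_pos (hT : 0 < D.T) : 0 < (D.guess j k).W := by
  have : ((8 : ℚ) / 9) ^ (k + 1) < 1 := pow_lt_one₀ (by norm_num) (by norm_num) (by omega)
  exact sub_pos.2 (mul_lt_of_lt_one_right hT this)

theorem scale_spec (hh : D.Heights m) (hσ : Small (D.memoryHeight m) σ) (hS : D.Stored σ)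
    (hj : j < D.n) (hk : k < D.steps m) (h4 : σ 4 0 = j) (h6 : σ 6 0 = D.T * (8 / 9) ^ k) :
    Halts R (D.memoryHeight m) Algorithm.scale σ (D.guess j k).Stored := by
  have hx := hh.x₀ (k := k + 1) hk
  have hWh := hh.T.sub hx
  have hg := (hh.guess hj hk).g
  have hβ : D.guessHeight m ≤ D.memoryHeight m := by unfold Data.memoryHeight; omega
  have hγ : D.guessHeight m = 5 * m + 5 * D.steps m + 10 := rfl
  obtain ⟨x₀, hx₀⟩ : ∃ x₀, x₀ = D.T * (8 / 9) ^ (k + 1) := ⟨_, rfl⟩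
  obtain ⟨W, hW⟩ : ∃ W, W = D.T - x₀ := ⟨_, rfl⟩
  rw [← hx₀] at hx hWh
  rw [← hW] at hWh
  refine Halts.assign_seq x₀ hσ ?_ (hx.mono (by omega)) fun σ1 hσ1 hn1 h6' => ?_
  · rw [hx₀, Expr.eval_mul, Expr.eval_var, h6, Expr.eval_const, pow_succ, mul_assoc]
  have hS1 := hS.of_ne hn1 (by simp)
  refine Halts.assign_seq W hσ1 ?_ (hWh.mono (by omega)) fun σ2 hσ2 hn2 h7 => ?_
  · rw [Expr.eval_sub, Expr.eval_get_of_eq (k := 1) (by simp), hS1.T, Expr.eval_var, h6', hW]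
  have hS2 := hS1.of_ne hn2 (by simp)
  have h4' : (Expr.var 4).eval σ2 = j := by simp [hn2 4, hn1 4, h4]
  have hvx := (hh.v j hj).mul hx
  refine Halts.assign_seq (D.v j * x₀) hσ2 ?_ (hvx.mono (by omega)) fun σ3 hσ3 hn3 h8 => ?_
  · rw [Expr.eval_mul, hS2.eval_attraction h4' hj, Expr.eval_var, hn2 6 (by simp), h6']
  -- the state after each conditional
  have hS3 := hS2.of_ne hn3 (by simp)
  have h4'' : σ3 4 0 = j := by rw [hn3 4 (by simp)]; simpa using h4'
  have h6'' : σ3 6 0 = x₀ := by rw [hn3 6 (by simp), hn2 6 (by simp), h6']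
  have h7' : σ3 7 0 = W := by rw [hn3 7 (by simp), h7]
  have hmin : HeightLE (D.memoryHeight m) (min (D.v j * x₀) W) := by
    rcases min_choice (D.v j * x₀) W with h1 | h1 <;> rw [h1]
    · exact hvx.mono (by omega)
    · exact hWh.mono (by omega)
  have step1 : Halts R (D.memoryHeight m) (.ite (.var 7) (.var 8) (.assign 8 (.var 7)) .skip) σ3
      fun τ => (∀ b, b ≠ 8 → τ b = σ3 b) ∧ τ 8 0 = min (D.v j * x₀) W := by
    refine Halts.ite hσ3 (fun hlt => ?_) fun hlt => Halts.skip hσ3 ⟨fun _ _ => rfl, ?_⟩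
    · simp only [Expr.eval_var, h7', h8] at hlt
      refine Halts.assign_of_eq W hσ3 (by simpa using h7') (hWh.mono (by omega)) fun τ h1 h2 =>
        ⟨h1, ?_⟩
      rw [h2, min_eq_right hlt.le]
    · simp only [Expr.eval_var, h7', h8, not_lt] at hlt
      rw [h8, min_eq_left hlt]
  refine Halts.seq (step1.frame.mono ?_)
  rintro σ4 ⟨hσ4, -, hn4, h8'⟩
  have hS4 := hS3.of_ne hn4 (by simp)
  have h4e : (Expr.var 4).eval σ4 = j := by simp [hn4 4, h4'']
  have step2 : Halts R (D.memoryHeight m) (.ite (.var 3) (Algorithm.costOf (.var 4) * .ceil (.var 8))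
      (.assign 8 (.floor (.var 3 / Algorithm.costOf (.var 4)))) .skip) σ4
      fun τ => (∀ b, b ≠ 8 → τ b = σ4 b) ∧ τ 8 0 = D.peak j x₀ W := by
    refine Halts.ite hσ4 (fun hlt => ?_) fun hlt => Halts.skip hσ4 ⟨fun _ _ => rfl, ?_⟩
    · rw [Expr.eval_mul, hS4.eval_cost h4e hj, Expr.eval_ceil, Expr.eval_var, Expr.eval_var,
        hS4.B, h8'] at hlt
      refine Halts.assign_of_eq ((⌊D.B / D.b j⌋ : ℤ) : ℚ) hσ4 ?_
        ((hh.B.div (hh.b j hj)).floor.mono (by omega)) fun τ h1 h2 => ⟨h1, ?_⟩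
      · rw [Expr.eval_floor, Expr.eval_div, hS4.eval_cost h4e hj, Expr.eval_var, hS4.B]
      · rw [h2, Data.peak, if_pos hlt]
    · rw [Expr.eval_mul, hS4.eval_cost h4e hj, Expr.eval_ceil, Expr.eval_var, Expr.eval_var,
        hS4.B, h8'] at hlt
      rw [h8', Data.peak, if_neg hlt]
  refine Halts.seq (step2.frame.mono ?_)
  rintro σ5 ⟨hσ5, -, hn5, h8''⟩
  have hS5 := hS4.of_ne hn5 (by simp)
  have h4f : (Expr.var 4).eval σ5 = j := by simp [hn5 4, hn4 4, h4'']
  refine Halts.assign_of_eq (D.guess j k).g hσ5 ?_ (hg.mono hβ) fun τ h1 h2 =>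
    ⟨hS5.of_ne h1 (by simp), ?_, ?_, h2⟩
  · rw [Expr.eval_div, Expr.eval_mul, hS5.eval_price h4f hj, Expr.eval_var, h8'', hW, hx₀]
    simp [Data.guess, hS5.n]
  · rw [h1 6 (by simp), hn5 6 (by simp), hn4 6 (by simp), h6'', hx₀]
    rfl
  · rw [h1 7 (by simp), hn5 7 (by simp), hn4 7 (by simp), h7', hW, hx₀]
    rfl

theorem Data.Dominates.mono {G : Guess} {a a' : ℚ} (h : Data.Dominates G a) (ha : a ≤ a') :
    Data.Dominates G a' :=
  fun hg p P S h1 h2 h3 h4 => (h hg p P S h1 h2 h3 h4).trans ha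

/-- The bound for the total attraction that the program computes. -/
def Data.attraction (D : Data) : ℚ := 2 + ∑ i ∈ Finset.range D.n, D.v i

theorem heightLE_two : HeightLE 2 2 := by
  have := heightLE_natCast (m := 2) (k := 2) (by norm_num)
  simpa using this

theorem Data.Heights.partial_sum (h : D.Heights m) (hk : k ≤ D.n) :
    HeightLE (D.steps m) (2 + ∑ i ∈ Finset.range k, D.v i) :=
  (heightLE_two.add (heightLE_sum fun i hi => h.v i (by omega))).mono (by
    unfold Data.steps
    nlinarith [Nat.mul_le_mul_right m hk])

/-- The total attraction is at most 2^(n m + 2), and eight steps of the grid more than halve x₀,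
since 2 (8/9)^8 < 1. -/
theorem lt_steps (hD : D.Nonneg) (hh : D.Heights m)
    (h : D.T < D.T * (8 / 9) ^ k * D.attraction) : k < D.steps m := by
  have hT : 0 < D.T := hD.T.lt_of_ne fun h0 => by
    rw [← h0] at h
    simp at h
  have hV0 : 0 ≤ D.attraction :=
    add_nonneg (by norm_num) (Finset.sum_nonneg fun i _ => hD.v i)
  have hV : D.attraction ≤ 2 ^ (D.n * m + 2) := by
    have h1 : HeightLE (D.n * m + 2) D.attraction :=
      (heightLE_two.add (heightLE_sum fun i hi => hh.v i hi)).mono (by omega)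
    have h2 : D.attraction.num.natAbs ≤ 2 ^ (D.n * m + 2) := by
      unfold HeightLE at h1
      omega
    calc D.attraction ≤ D.attraction.num := by
          rw [Rat.le_iff]
          have : 0 ≤ D.attraction.num := Rat.num_nonneg.2 hV0
          have := D.attraction.den_pos
          simp only [Rat.num_intCast, Rat.den_intCast]
          push_cast
          nlinarith
      _ ≤ (D.attraction.num.natAbs : ℚ) := by
          have := Int.le_natAbs (a := D.attraction.num)
          have h3 : (D.attraction.num : ℚ) ≤ ((D.attraction.num.natAbs : ℤ) : ℚ) :=
            Int.cast_le.2 this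
          rwa [Int.cast_natCast] at h3
      _ ≤ 2 ^ (D.n * m + 2) := by exact_mod_cast h2
  by_contra hk
  rw [not_lt] at hk
  have h1 : ((8 : ℚ) / 9) ^ k ≤ (8 / 9) ^ D.steps m :=
    pow_le_pow_of_le_one (by norm_num) (by norm_num) hk
  have h2 : ((8 : ℚ) / 9) ^ k * D.attraction ≤ 1 := by
    calc ((8 : ℚ) / 9) ^ k * D.attraction ≤ (8 / 9) ^ D.steps m * 2 ^ (D.n * m + 2) :=
          mul_le_mul h1 hV hV0 (by positivity)
      _ = ((8 / 9) ^ 8 * 2) ^ (D.n * m + 2) := by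
          rw [Data.steps, pow_mul, mul_pow]
      _ ≤ 1 := pow_le_one₀ (by norm_num) (by norm_num)
  nlinarith

theorem guesses_spec (hD : D.Nonneg) (hh : D.Heights m)
    (hσ : Small (D.memoryHeight m) σ) (hS : D.Stored σ)
    (hj : j < D.n) (h4 : σ 4 0 = j) (h5 : σ 5 0 = D.attraction) (hout : D.Output σ) :
    Halts (D.iterations m) (D.memoryHeight m) Algorithm.guesses σ fun τ =>
      D.Stored τ ∧ D.Output τ ∧ σ 20 0 ≤ τ 20 0 ∧
      ∀ k, D.T < D.T * (8 / 9) ^ k * D.attraction →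
        Data.Dominates (D.guess j k) (τ 20 0) := by
  have hβ : D.guessHeight m ≤ D.memoryHeight m := by unfold Data.memoryHeight; omega
  have hγ : D.guessHeight m = 5 * m + 5 * D.steps m + 10 := rfl
  have hV0 : 0 ≤ D.attraction :=
    add_nonneg (by norm_num) (Finset.sum_nonneg fun i _ => hD.v i)
  refine Halts.assign_seq D.T hσ ?_ (hh.T.mono (by omega)) fun σ1 hσ1 hn1 h6 => ?_
  · rw [Expr.eval_get_of_eq (k := 1) (by simp), hS.T]
  refine Halts.loop (fun k τ => D.Stored τ ∧ τ 4 0 = j ∧ τ 5 0 = D.attraction ∧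
      τ 6 0 = D.T * (8 / 9) ^ k ∧ D.Output τ ∧ σ 20 0 ≤ τ 20 0 ∧
      ∀ k' < k, Data.Dominates (D.guess j k') (τ 20 0)) (D.steps m)
    (by unfold Data.iterations; omega) hσ1 ⟨hS.of_ne hn1 (by simp), ?_, ?_, by simpa using h6,
      hout.congr (hn1 1 (by simp)) (hn1 20 (by simp)), ?_, fun k hk => absurd hk (Nat.not_lt_zero _)⟩
    ?_ ?_
  · rw [hn1 4 (by simp), h4]
  · rw [hn1 5 (by simp), h5]
  · rw [hn1 20 (by simp)]
  · rintro k τ hτ ⟨g1, g2, g3, g4, g5, g6, g7⟩ hlt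
    rw [Expr.eval_get_of_eq (k := 1) (by simp), g1.T, Expr.eval_mul, Expr.eval_var, Expr.eval_var,
      g4, g3] at hlt
    have hk := lt_steps hD hh hlt
    have hT : 0 < D.T := hD.T.lt_of_ne fun h0 => by
      rw [← h0] at hlt
      simp at hlt
    refine ⟨hk, Halts.seq ((scale_spec hh hτ g1 hj hk g2 g4).frame.mono ?_)⟩
    rintro υ ⟨hυ, hfr, hE⟩
    have hO : D.Output υ := g5.congr (hfr 1 rfl) (hfr 20 rfl)
    have h20 : υ 20 = τ 20 := hfr 20 rfl
    refine Halts.ite hυ (fun hg => ?_) fun hg => Halts.skip hυ ?_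
    · have hg' : 0 < (D.guess j k).g := by simpa [hE.g] using hg
      have hA : (D.guess j k).Admissible (D.guessHeight m) (D.memoryHeight m) :=
        ⟨hD, hg', guess_W_pos hT, hh.guess hj hk, le_rfl⟩
      have hR : ((D.guess j k).n + 1) * ((D.guess j k).rows * (D.guess j k).cols) ≤
          D.iterations m := Nat.le_add_left _ _
      refine Halts.seq ((table_spec hA hR hυ hE).frame.mono ?_)
      rintro ω ⟨hω, hfr', hE', htab⟩
      have h20' : ω 20 = υ 20 := hfr' 20 rfl
      refine (extract_spec hA hR (mul_nonneg hT.le (by positivity)) (sub_add_cancel _ _).le hω hE'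
        htab (hO.congr (hfr' 1 rfl) h20')).frame.mono ?_
      rintro ξ ⟨-, hfr'', hO', hle, hdom⟩
      rw [h20', h20] at hle
      refine ⟨hE'.data.congr fun a ha => hfr'' a ?_, ?_, ?_, ?_, hO', g6.trans hle,
        fun k' hk' => ?_⟩
      · simp only [List.mem_cons, List.not_mem_nil, or_false] at ha
        rcases ha with rfl | rfl | rfl | rfl | rfl | rfl <;> rfl
      · rw [hfr'' 4 rfl, hfr' 4 rfl, hfr 4 rfl, g2]
      · rw [hfr'' 5 rfl, hfr' 5 rfl, hfr 5 rfl, g3]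
      · rw [hfr'' 6 rfl, hE'.x₀]
        rfl
      · rcases Nat.lt_succ_iff_lt_or_eq.1 hk' with hk' | rfl
        · exact (g7 k' hk').mono hle
        · exact hdom
    · refine ⟨hE.data, ?_, ?_, hE.x₀, hO, ?_, fun k' hk' => ?_⟩
      · rw [hfr 4 rfl, g2]
      · rw [hfr 5 rfl, g3]
      · rwa [h20]
      · rw [h20]
        rcases Nat.lt_succ_iff_lt_or_eq.1 hk' with hk' | rfl
        -- For the current guess, the skipped branch has g ≤ 0, and `Dominates` then holds
        -- vacuously.
        · exact g7 k' hk'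
        · intro hg'
          refine absurd ?_ hg
          simpa [hE.g] using hg'
  · rintro k τ ⟨g1, g2, g3, g4, g5, g6, g7⟩ hlt
    rw [Expr.eval_get_of_eq (k := 1) (by simp), g1.T, Expr.eval_mul, Expr.eval_var, Expr.eval_var,
      g4, g3] at hlt
    refine ⟨g1, g5, g6, fun k' hk' => g7 k' ?_⟩
    -- The test of the loop is monotone in k: having failed at k, it fails at every later k', so all
    -- relevant guesses have been tried.
    by_contra hkk
    refine hlt (hk'.trans_le ?_)
    have : ((8 : ℚ) / 9) ^ k' ≤ (8 / 9) ^ k :=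
      pow_le_pow_of_le_one (by norm_num) (by norm_num) (not_lt.1 hkk)
    have := hD.T
    gcongr

/-- The memory when the costs and the budget are in place. -/
structure Data.Loaded (D : Data) (σ : Memory) : Prop where
  n : σ 0 0 = D.n
  T : σ 0 1 = D.T
  r : ∀ i < D.n, σ 0 (2 + i) = D.r i
  v : ∀ i < D.n, σ 0 (2 + D.n + i) = D.v i
  b : ∀ i < D.n, σ 2 i = D.b i
  B : σ 3 0 = D.B
  output : ∀ i < D.n, σ 1 i = 0
  best : σ 20 0 = 0

theorem sells_zero (hD : D.Nonneg) : D.Sells (fun _ => 0) 0 := by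
  refine ⟨fun _ => 0, 0, fun i _ => ⟨le_rfl, by simp, by simp⟩, le_rfl, ?_, by simp⟩
  have : (0 : ℝ) ≤ D.T := by exact_mod_cast hD.T
  simpa using this

/-- The search starts from the empty inventory, which certifies revenue 0. Afterwards the value `a`
dominates all guesses, and `Data.le_of_dominates` applies to it. -/
theorem main_spec (hD : D.Nonneg) (hh : D.Heights m) (hσ : Small (D.memoryHeight m) σ)
    (hL : D.Loaded σ) :
    Halts (D.iterations m) (D.memoryHeight m) Algorithm.main σ fun τ =>
      ∃ (c : ℕ → ℕ) (a : ℚ), (∀ i < D.n, τ 1 i = c i) ∧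
        ∑ i ∈ Finset.range D.n, D.b i * c i ≤ D.B ∧ D.Sells c ((8 / 9 * a : ℚ) : ℝ) ∧
        ∀ (c' : ℕ → ℕ) (A : ℝ), ∑ i ∈ Finset.range D.n, D.b i * c' i ≤ D.B → D.Sells c' A →
          (8 / 9) ^ 2 * A ≤ a := by
  have hβ : D.guessHeight m ≤ D.memoryHeight m := by unfold Data.memoryHeight; omega
  have hγ : D.guessHeight m = 5 * m + 5 * D.steps m + 10 := rfl
  have htab := hh.table (γ := D.memoryHeight m) (by omega)
  have hnat : ∀ k : ℕ, k ≤ (D.n + 1) * ((8 * D.n * D.n + 1) * (8 * D.n + 1)) →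
      HeightLE (D.memoryHeight m) (k : ℚ) := fun k hk => heightLE_natCast (by omega)
  have hn : D.n ≤ D.iterations m := by
    refine le_trans ?_ (Nat.le_add_left _ _)
    exact (Nat.le_succ _).trans
      (Nat.le_mul_of_pos_right _ (Nat.mul_pos (Nat.succ_pos _) (Nat.succ_pos _)))
  have hn' : D.n + 1 ≤ 2 ^ D.memoryHeight m :=
    hh.n.trans (Nat.pow_le_pow_right (by norm_num) (by omega))
  refine Halts.assign_seq ((8 * D.n + 1 : ℕ) : ℚ) hσ ?_ (hnat _ ?_) fun σ1 hσ1 hn1 h25 => ?_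
  · simp [hL.n]
  · exact (Nat.le_mul_of_pos_left _ (Nat.succ_pos _)).trans
      (Nat.le_mul_of_pos_left _ (Nat.succ_pos _))
  refine Halts.assign_seq ((8 * D.n * D.n + 1 : ℕ) : ℚ) hσ1 ?_ (hnat _ ?_) fun σ2 hσ2 hn2 h26 => ?_
  · simp [hn1 0, hL.n]
  · exact (Nat.le_mul_of_pos_right _ (Nat.succ_pos _)).trans
      (Nat.le_mul_of_pos_left _ (Nat.succ_pos _))
  refine Halts.assign_seq (((8 * D.n * D.n + 1) * (8 * D.n + 1) : ℕ) : ℚ) hσ2 ?_ (hnat _ ?_)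
    fun σ3 hσ3 hn3 h27 => ?_
  · simp [h26, hn2 25, h25]
  · exact Nat.le_mul_of_pos_left _ (Nat.succ_pos _)
  refine Halts.assign_seq 2 hσ3 (by simp) (heightLE_two.mono (by omega)) fun σ4 hσ4 hn4 h5 => ?_
  have hS4 : D.Stored σ4 := by
    have h0 : ∀ a, a < 5 → σ4 a = σ a := fun a ha => by
      rw [hn4 a (by omega), hn3 a (by omega), hn2 a (by omega), hn1 a (by omega)]
    refine ⟨?_, ?_, ?_, ?_, ?_, ?_, ?_, ?_, ?_⟩
    · rw [h0 0 (by simp), hL.n]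
    · rw [h0 0 (by simp), hL.T]
    · rw [h0 0 (by simp)]; exact hL.r
    · rw [h0 0 (by simp)]; exact hL.v
    · rw [h0 2 (by simp)]; exact hL.b
    · rw [h0 3 (by simp), hL.B]
    · rw [hn4 25 (by simp), hn3 25 (by simp), hn2 25 (by simp), h25]
    · rw [hn4 26 (by simp), hn3 26 (by simp), h26]
    · rw [hn4 27 (by simp), h27]
  have hO4 : D.Output σ4 := by
    have h1 : σ4 1 = σ 1 := by
      rw [hn4 1 (by simp), hn3 1 (by simp), hn2 1 (by simp), hn1 1 (by simp)]
    have h20 : σ4 20 0 = 0 := by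
      rw [hn4 20 (by simp), hn3 20 (by simp), hn2 20 (by simp), hn1 20 (by simp), hL.best]
    refine ⟨fun _ => 0, fun i hi => ?_, ?_, h20.ge, ?_⟩
    · rw [h1, hL.output i hi]
      simp
    · simpa using hD.B
    · rw [h20]
      simpa using sells_zero hD
  refine Halts.seq ((Halts.for (fun k τ => D.Stored τ ∧ D.Output τ ∧
    τ 5 0 = 2 + ∑ i ∈ Finset.range k, D.v i) D.n hn hn' hσ4 ⟨hS4, hO4, by simpa using h5⟩ rfl
    ?_ ?_ ?_ (fun τ hτ => hτ)).frame.mono ?_)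
  · rintro k τ υ hυ ⟨g1, g2, g3⟩
    refine ⟨g1.of_ne hυ (by simp), g2.congr (hυ 1 (by simp)) (hυ 20 (by simp)), ?_⟩
    rwa [hυ 5 (by simp)]
  · rintro k τ ⟨g1, -⟩
    simp [g1.n]
  · rintro k τ hτ ⟨g1, g2, g3⟩ h23 hk
    refine Halts.assign_of_eq (2 + ∑ i ∈ Finset.range (k + 1), D.v i) hτ ?_
      ((hh.partial_sum hk).mono (by omega)) fun υ hυ h5' =>
      ⟨g1.of_ne hυ (by simp), g2.congr (hυ 1 (by simp)) (hυ 20 (by simp)), h5'⟩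
    rw [Expr.eval_add, g1.eval_attraction (i := k) (by simpa using h23) hk, Expr.eval_var, g3,
      Finset.sum_range_succ, add_assoc]
  · rintro σ5 ⟨hσ5, -, hS5, hO5, h5'⟩
    refine Halts.for (fun j τ => D.Stored τ ∧ D.Output τ ∧ τ 5 0 = D.attraction ∧
      ∀ j' < j, ∀ k, D.T < D.T * (8 / 9) ^ k * D.attraction →
        Data.Dominates (D.guess j' k) (τ 20 0)) D.n hn hn' hσ5
      ⟨hS5, hO5, h5', fun j hj => absurd hj (Nat.not_lt_zero _)⟩ rfl ?_ ?_ ?_ ?_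
    · rintro k τ υ hυ ⟨g1, g2, g3, g4⟩
      refine ⟨g1.of_ne hυ (by simp), g2.congr (hυ 1 (by simp)) (hυ 20 (by simp)), ?_, ?_⟩
      · rwa [hυ 5 (by simp)]
      · rwa [hυ 20 (by simp)]
    · rintro k τ ⟨g1, -⟩
      simp [g1.n]
    · rintro j τ hτ ⟨g1, g2, g3, g4⟩ h4 hj
      refine (guesses_spec hD hh hτ g1 hj h4 g3 g2).frame.mono ?_
      rintro υ ⟨-, hfr, k1, k2, k3, k4⟩
      refine ⟨k1, k2, by rw [hfr 5 rfl, g3], fun j' hj' k hk => ?_⟩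
      rcases Nat.lt_succ_iff_lt_or_eq.1 hj' with hj' | rfl
      · exact (g4 j' hj' k hk).mono k3
      · exact k4 k hk
    · rintro τ ⟨g1, ⟨c, hc, hB, ha, hs⟩, g3, g4⟩
      refine ⟨c, τ 20 0, hc, hB, hs, fun c' A hc' hA =>
        Data.le_of_dominates hD (V := D.attraction) ?_ ha g4 hc' hA⟩
      unfold Data.attraction
      linarith

end Specs

end Assortment

/-! ### Heights of the input -/

namespace RatRAM

theorem bits_le_bitLength {l : List ℚ} {q : ℚ} (hq : q ∈ l) : bits q ≤ bitLength l := by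
  have := List.le_sum_of_mem (List.mem_map_of_mem (f := fun q => bits q + 1) hq)
  unfold bitLength
  omega

theorem length_le_bitLength (l : List ℚ) : l.length ≤ bitLength l := by
  unfold bitLength
  induction l with
  | nil => simp
  | cons q l ih =>
    simp only [List.map_cons, List.sum_cons, List.length_cons]
    omega

theorem small_initial (l : List ℚ) : Small (bitLength l) (initial l) := by
  intro a i
  unfold initial
  split_ifs
  · rcases lt_or_ge i l.length with hi | hi
    · rw [List.getD_eq_getElem _ _ hi]
      exact (heightLE_bits _).mono (bits_le_bitLength (List.getElem_mem hi))
    · rw [List.getD_eq_default _ _ hi]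
      exact heightLE_zero
  · exact heightLE_zero

theorem Small.mono {β β' : ℕ} {σ : Memory} (h : Small β σ) (hβ : β ≤ β') : Small β' σ :=
  fun a i => (h a i).mono hβ

theorem _root_.Polynomial.eval_mono_nat (p : Polynomial ℕ) {a b : ℕ} (h : a ≤ b) :
    p.eval a ≤ p.eval b := by
  rw [Polynomial.eval_eq_sum_range, Polynomial.eval_eq_sum_range]
  exact Finset.sum_le_sum fun i _ => Nat.mul_le_mul_left _ (Nat.pow_le_pow_left h i)

end RatRAM

namespace Assortment

open RatRAM

/-! ### Loading an instance -/

namespace Algorithm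

open Expr

/-- Copy the unit costs and the budget of a budget constrained instance. -/
def loadBudget : Program :=
  .seq (.for 23 (var 0) (.set 2 (var 23) (.get 0 (2 + 2 * var 0 + var 23))))
    (.assign 3 (.get 0 (2 + 3 * var 0)))

/-- A cardinality constraint is a budget constraint with unit costs `1`. -/
def loadCard : Program :=
  .seq (.for 23 (var 0) (.set 2 (var 23) 1)) (.assign 3 (.get 0 (2 + 2 * var 0)))

end Algorithm

/-- The memory holds the beginning of the encoding of the data. -/
structure Data.Input (D : Data) (σ : Memory) : Prop where
  n : σ 0 0 = D.n
  T : σ 0 1 = D.T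
  r : ∀ i < D.n, σ 0 (2 + i) = D.r i
  v : ∀ i < D.n, σ 0 (2 + D.n + i) = D.v i
  zero : ∀ a ≠ 0, ∀ i, σ a i = 0

section Load

variable {D : Data} {m R β : ℕ} {σ : Memory} {e y : Expr}

/-- This serves both kinds of constraint: `e` and `y` are the expressions for the unit costs and the
budget, and they may depend only on the input array and the counter. -/
theorem load_spec (hI : D.Input σ) (hσ : Small β σ) (hR : D.n ≤ R) (hn : D.n + 1 ≤ 2 ^ β)
    (hb : ∀ i < D.n, ∀ τ : Memory, τ 0 = σ 0 → τ 23 0 = i → e.eval τ = D.b i)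
    (hB : ∀ τ : Memory, τ 0 = σ 0 → y.eval τ = D.B)
    (hbβ : ∀ i < D.n, HeightLE β (D.b i)) (hBβ : HeightLE β D.B) :
    Halts R β (.seq (.for 23 (.var 0) (.set 2 (.var 23) e)) (.assign 3 y)) σ D.Loaded := by
  refine Halts.seq ((Halts.for (fun k τ => τ 0 = σ 0 ∧ ∀ i < k, τ 2 i = D.b i) D.n hR hn hσ
    ⟨rfl, fun i hi => absurd hi (Nat.not_lt_zero _)⟩ rfl ?_ ?_ ?_ (fun τ hτ => hτ)).frame.mono ?_)
  · rintro k τ υ hυ ⟨h1, h2⟩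
    rw [hυ 0 (by simp), hυ 2 (by simp)]
    exact ⟨h1, h2⟩
  · rintro k τ ⟨h1, -⟩
    simp [h1, hI.n]
  · rintro k τ hτ ⟨h1, h2⟩ h23 hk
    refine Halts.set_of_eq (k := k) (D.b k) hτ (by simpa using h23) (hb k hk τ h1 h23) (hbβ k hk)
      ⟨?_, fun i hi => ?_⟩
    · rw [store_of_ne _ (by simp), h1]
    · rw [store_apply]
      split_ifs with h
      · rw [h.2]
      · exact h2 i (by omega)
  · rintro τ ⟨hτ, hfr, h1, h2⟩
    refine Halts.assign_of_eq D.B hτ (hB τ h1) hBβ fun υ hυ h3 => ?_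
    have h0 : υ 0 = σ 0 := by rw [hυ 0 (by simp), h1]
    refine ⟨by rw [h0, hI.n], by rw [h0, hI.T], by rw [h0]; exact hI.r, by rw [h0]; exact hI.v,
      ?_, h3, fun i _ => ?_, ?_⟩
    · rw [hυ 2 (by simp)]
      exact h2
    · rw [hυ 1 (by simp), hfr 1 rfl, hI.zero 1 (by simp)]
    · rw [hυ 20 (by simp), hfr 20 rfl, hI.zero 20 (by simp)]

end Load

/-! ### The approximation guarantee -/

/-- The data of a market, extended by zeros. -/
def Market.data (M : Market) (b : Fin M.n → ℚ) (B : ℚ) : Data where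
  n := M.n
  r i := if h : i < M.n then M.r ⟨i, h⟩ else 0
  v i := if h : i < M.n then M.v ⟨i, h⟩ else 0
  b i := if h : i < M.n then b ⟨i, h⟩ else 0
  T := M.T
  B := B

section Market

variable {M : Market} {b : Fin M.n → ℚ} {B : ℚ}

theorem Market.data_nonneg (hb : ∀ i, 0 ≤ b i) (hB : 0 ≤ B) : (M.data b B).Nonneg where
  r i := by
    unfold Market.data
    dsimp only
    split_ifs
    exacts [M.r_nonneg _, le_rfl]
  v i := by
    unfold Market.data
    dsimp only
    split_ifs
    exacts [M.v_nonneg _, le_rfl]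
  b i := by
    unfold Market.data
    dsimp only
    split_ifs
    exacts [hb _, le_rfl]
  T := M.T_nonneg
  B := hB

theorem Market.data_r (i : Fin M.n) : (M.data b B).r i = M.r i := by simp [Market.data]
theorem Market.data_v (i : Fin M.n) : (M.data b B).v i = M.v i := by simp [Market.data]
theorem Market.data_b (i : Fin M.n) : (M.data b B).b i = b i := by simp [Market.data]

theorem Market.sum_data_b (f : ℕ → ℚ) :
    ∑ i ∈ Finset.range (M.data b B).n, (M.data b B).b i * f i = ∑ i, b i * f i := by
  change ∑ i ∈ Finset.range M.n, _ = _
  rw [Finset.sum_range]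
  simp only [Market.data_b]

theorem Market.sum_data_r (f : ℕ → ℝ) :
    ∑ i ∈ Finset.range (M.data b B).n, ((M.data b B).r i : ℝ) * f i = ∑ i, (M.r i : ℝ) * f i := by
  change ∑ i ∈ Finset.range M.n, _ = _
  rw [Finset.sum_range]
  simp only [Market.data_r]

theorem Market.fluidRevenue_nonneg (c : Fin M.n → ℕ) : 0 ≤ M.fluidRevenue c := by
  have := le_fLP (r := fun i => (M.r i : ℝ)) (v := fun i => (M.v i : ℝ)) (c := fun i => (c i : ℝ))
    (T := M.T) (x := fun _ => 0) (x₀ := 0) (fun i => by exact_mod_cast M.r_nonneg i)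
    (fun i => by exact_mod_cast M.v_nonneg i) (by exact_mod_cast M.T_nonneg)
    (fun i => Nat.cast_nonneg _) (fun i => ⟨le_rfl, Nat.cast_nonneg _, by simp⟩) le_rfl
    (by simpa using (by exact_mod_cast M.T_nonneg : (0 : ℝ) ≤ M.T))
  unfold Market.fluidRevenue
  simpa using this

theorem Data.Sells.le_fluidRevenue {c : ℕ → ℕ} {a : ℝ} (h : (M.data b B).Sells c a) :
    a ≤ M.fluidRevenue fun i => c i := by
  obtain ⟨x, x₀, hx, hx₀, hs, rfl⟩ := h
  rw [Finset.sum_range] at hs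
  rw [Market.sum_data_r]
  refine le_fLP (fun i => by exact_mod_cast M.r_nonneg i) (fun i => by exact_mod_cast M.v_nonneg i)
    (by exact_mod_cast M.T_nonneg) (fun i => Nat.cast_nonneg _) (x₀ := x₀) (fun i => ?_) hx₀ hs
  have := hx i i.2
  rwa [Market.data_v] at this

theorem Market.fluidRevenue_le {c : Fin M.n → ℕ} {A : ℝ} (hA : 0 ≤ A)
    (h : ∀ a, (M.data b B).Sells (fun i => if h : i < M.n then c ⟨i, h⟩ else 0) a → a ≤ A) :
    M.fluidRevenue c ≤ A := by
  refine fLP_le (fun i => by exact_mod_cast M.v_nonneg i) (by exact_mod_cast M.T_nonneg) hA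
    fun x x₀ hx hx₀ hs => h _ ⟨fun i => if h : i < M.n then x ⟨i, h⟩ else 0, x₀, fun i hi => ?_,
      hx₀, ?_, ?_⟩
  · have hi' : i < M.n := hi
    have := hx ⟨i, hi'⟩
    simpa [Market.data, hi'] using this
  · change ∑ i ∈ Finset.range M.n, _ + x₀ ≤ (M.T : ℝ)
    rw [Finset.sum_range]
    simpa using hs
  · rw [Market.sum_data_r]
    simp

/-- Polynomial bound for the number of iterations. -/
noncomputable def iterationsPoly : Polynomial ℕ :=
  8 * (.X * .X + 2) + (.X + 1) * ((8 * .X * .X + 1) * (8 * .X + 1))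

/-- Polynomial bound for the heights. -/
noncomputable def memoryHeightPoly : Polynomial ℕ :=
  .X * (4 * (5 * .X + 5 * (8 * (.X * .X + 2)) + 10)) +
    12 * (5 * .X + 5 * (8 * (.X * .X + 2)) + 10) + 12

theorem Data.iterations_le {D : Data} {m : ℕ} (h : D.n ≤ m) :
    D.iterations m ≤ iterationsPoly.eval m := by
  simp only [iterationsPoly, Data.iterations, Data.steps, Polynomial.eval_add, Polynomial.eval_mul,
    Polynomial.eval_X, Polynomial.eval_one, Polynomial.eval_ofNat]
  gcongr

theorem Data.memoryHeight_le {D : Data} {m : ℕ} (h : D.n ≤ m) :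
    D.memoryHeight m ≤ memoryHeightPoly.eval m := by
  simp only [memoryHeightPoly, Data.memoryHeight, Data.guessHeight, Data.steps,
    Polynomial.eval_add, Polynomial.eval_mul, Polynomial.eval_X, Polynomial.eval_ofNat]
  gcongr

/-- Polynomial bound for the cost of a program. -/
noncomputable def timePoly (P : Program) : Polynomial ℕ :=
  P.costPoly.comp iterationsPoly * (memoryHeightPoly + 1)

/-- The optimum is at most (9/8)^2 a, and the output sells at least 8/9 a, which gives (8/9)^3. The
bit length of the input serves as bound both for the heights of the data and for n. -/
theorem exists_approx {ρ : ℝ} (hρ : ρ ≤ (8 / 9) ^ 3) (hb : ∀ i, 0 ≤ b i) (hB : 0 ≤ B)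
    {l : List ℚ} (hI : (M.data b B).Input (initial l)) (hn : M.n + 2 ≤ l.length)
    (hbl : ∀ i, HeightLE (bitLength l) (b i)) (hBl : HeightLE (bitLength l) B) {P : Program}
    (hP : ∀ R β, bitLength l ≤ β → M.n ≤ R → M.n + 1 ≤ 2 ^ β → Small β (initial l) →
      Halts R β P (initial l) (M.data b B).Loaded) :
    ∃ c : Fin M.n → ℕ, ∑ i, b i * (c i : ℚ) ≤ B ∧
      (Program.seq P Algorithm.main).Computes l (List.ofFn fun i => (c i : ℚ))
        ((timePoly (.seq P Algorithm.main)).eval (bitLength l)) ∧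
      ∀ c' : Fin M.n → ℕ, ∑ i, b i * (c' i : ℚ) ≤ B →
        ρ * M.fluidRevenue c' ≤ M.fluidRevenue c := by
  have hD := Market.data_nonneg (M := M) hb hB
  set D := M.data b B with hDd
  set m := bitLength l with hm
  have hDn : D.n = M.n := rfl
  have hlen : M.n + 2 ≤ m := hn.trans (length_le_bitLength l)
  have hm2 : M.n + 1 ≤ 2 ^ m := (by omega : M.n + 1 ≤ m).trans Nat.lt_two_pow_self.le
  have hsm : Small m (initial l) := small_initial l
  have hh : D.Heights m := by
    refine ⟨hm2, fun i hi => hI.r i hi ▸ hsm _ _, fun i hi => hI.v i hi ▸ hsm _ _, fun i hi => ?_,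
      hI.T ▸ hsm _ _, hBl⟩
    have := Market.data_b (M := M) (b := b) (B := B) ⟨i, hi⟩
    rw [hDd, this]
    exact hbl _
  have hmβ : m ≤ D.memoryHeight m := by unfold Data.memoryHeight Data.guessHeight; omega
  have hnR : M.n ≤ D.iterations m := by
    refine le_trans ?_ (Nat.le_add_left _ _)
    exact (Nat.le_succ _).trans
      (Nat.le_mul_of_pos_right _ (Nat.mul_pos (Nat.succ_pos _) (Nat.succ_pos _)))
  have hrun := Halts.seq (((hP (D.iterations m) (D.memoryHeight m) hmβ hnR
    (hm2.trans (Nat.pow_le_pow_right (by norm_num) hmβ)) (hsm.mono hmβ)).frame).mono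
    fun τ hτ => main_spec hD hh hτ.1 hτ.2.2)
  obtain ⟨τ, s, hexec, hs, -, c, a, hc, hcB, hsell, hbest⟩ := hrun
  refine ⟨fun i => c i, ?_, ⟨τ, s, hexec, hs.trans ?_, ?_⟩, ?_⟩
  · rwa [hDd, Market.sum_data_b] at hcB
  · unfold timePoly
    rw [Polynomial.eval_mul, Polynomial.eval_comp, Polynomial.eval_add, Polynomial.eval_one]
    exact Nat.mul_le_mul (Polynomial.eval_mono_nat _ (D.iterations_le (by omega)))
      (Nat.succ_le_succ (D.memoryHeight_le (by omega)))
  · intro i hi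
    rw [List.length_ofFn] at hi
    rw [List.getElem_ofFn]
    exact hc i hi
  · intro c' hc'
    have h1 := hsell.le_fluidRevenue
    -- The empty inventory is a competitor with revenue 0.
    have ha : (0 : ℝ) ≤ a := by
      simpa using hbest (fun _ => 0) 0 (by simpa using hD.B) (sells_zero hD)
    have h2 : M.fluidRevenue c' ≤ a * (9 / 8) ^ 2 := by
      refine Market.fluidRevenue_le (b := b) (B := B) (by positivity) fun A hA => ?_
      have h3 := hbest _ A ?_ hA
      · linarith
      · rw [hDd, Market.sum_data_b]
        change _ ≤ B
        simpa using hc'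
    have h0 := M.fluidRevenue_nonneg c'
    have h3 := mul_le_mul_of_nonneg_right hρ h0
    push_cast at h1
    linarith

theorem Market.getD_encode_r (tail : List ℚ) (i : Fin M.n) :
    (M.encode ++ tail).getD (2 + i) 0 = M.r i := by
  unfold Market.encode
  rw [add_comm]
  simp only [List.cons_append, List.append_assoc, List.getD_cons_succ]
  rw [List.getD_append _ _ _ _ (by simp)]
  simp

theorem Market.getD_encode_v (tail : List ℚ) (i : Fin M.n) :
    (M.encode ++ tail).getD (2 + M.n + i) 0 = M.v i := by
  unfold Market.encode
  rw [show 2 + M.n + (i : ℕ) = M.n + i + 2 by omega]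
  simp only [List.cons_append, List.append_assoc, List.getD_cons_succ]
  rw [List.getD_append_right _ _ _ _ (by simp), List.getD_append _ _ _ _ (by simp)]
  simp

theorem Market.getD_encode_tail (tail : List ℚ) (i : ℕ) :
    (M.encode ++ tail).getD (2 + 2 * M.n + i) 0 = tail.getD i 0 := by
  have : M.encode.length = 2 + 2 * M.n := by
    simp [Market.encode]
    omega
  rw [List.getD_append_right _ _ _ _ (by omega), this, Nat.add_sub_cancel_left]

theorem Market.input (tail : List ℚ) : (M.data b B).Input (initial (M.encode ++ tail)) where
  n := by simp [initial, Market.encode, Market.data]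
  T := by simp [initial, Market.encode, Market.data]
  r i hi := by
    have := M.getD_encode_r tail ⟨i, hi⟩
    rw [show (M.data b B).r i = M.r ⟨i, hi⟩ from Market.data_r ⟨i, hi⟩]
    simpa [initial] using this
  v i hi := by
    have := M.getD_encode_v tail ⟨i, hi⟩
    rw [show (M.data b B).v i = M.v ⟨i, hi⟩ from Market.data_v ⟨i, hi⟩]
    change initial _ 0 (2 + M.n + i) = _
    simpa [initial] using this
  zero a ha i := by simp [initial, ha]

theorem Market.length_encode : M.encode.length = 2 + 2 * M.n := by
  simp only [Market.encode, List.length_cons, List.length_append, List.length_ofFn]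
  omega

end Market

/-! ### The two kinds of feasible region -/

theorem CardInst.exists_approx {ρ : ℝ} (hρ : ρ ≤ (8 / 9) ^ 3) (I : CardInst) :
    ∃ c : Fin I.n → ℕ, ∑ i, c i ≤ I.K ∧
      (Program.seq Algorithm.loadCard Algorithm.main).Computes (I.toMarket.encode ++ [(I.K : ℚ)])
        (List.ofFn fun i => (c i : ℚ)) ((timePoly (.seq Algorithm.loadCard Algorithm.main)).eval
          (bitLength (I.toMarket.encode ++ [(I.K : ℚ)]))) ∧
      ∀ c' : Fin I.n → ℕ, ∑ i, c' i ≤ I.K →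
        ρ * I.toMarket.fluidRevenue c' ≤ I.toMarket.fluidRevenue c := by
  have hsum : ∀ c : Fin I.n → ℕ, ∑ i, (1 : ℚ) * (c i : ℚ) ≤ (I.K : ℚ) ↔ ∑ i, c i ≤ I.K :=
    fun c => by
      simp only [one_mul]
      exact_mod_cast Iff.rfl
  have hinput := Market.input (M := I.toMarket) (b := fun _ => 1) (B := I.K) [(I.K : ℚ)]
  have hK : initial (I.toMarket.encode ++ [(I.K : ℚ)]) 0 (2 + 2 * I.n) = I.K :=
    I.toMarket.getD_encode_tail [(I.K : ℚ)] 0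
  have hlen : (I.toMarket.encode ++ [(I.K : ℚ)]).length = 2 * I.n + 3 := by
    rw [List.length_append, Market.length_encode, List.length_singleton]
    omega
  generalize I.toMarket.encode ++ [(I.K : ℚ)] = l at *
  have hK' : HeightLE (bitLength l) (I.K : ℚ) := hK ▸ small_initial l _ _
  have h1 : 1 ≤ bitLength l := le_trans (by omega) (length_le_bitLength l)
  have hb : ∀ i < I.n, (I.toMarket.data (fun _ => 1) I.K).b i = 1 := fun i hi =>
    Market.data_b ⟨i, hi⟩
  have hload : ∀ R β, bitLength l ≤ β → I.n ≤ R → I.n + 1 ≤ 2 ^ β → RatRAM.Small β (initial l) →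
      Halts R β Algorithm.loadCard (initial l) (I.toMarket.data (fun _ => 1) I.K).Loaded := by
    refine fun R β hβ hR hn hσ => load_spec hinput hσ hR hn (fun i hi τ _ _ => ?_)
      (fun τ hτ => ?_) (fun i hi => ?_) (hK'.mono hβ)
    · rw [hb i hi]
      simp
    · have h0 : τ 0 0 = I.n := by
        rw [hτ]
        exact hinput.n
      rw [Expr.eval_get_of_eq (k := 2 + 2 * I.n) (by simp [h0]), hτ, hK]
      rfl
    · rw [hb i hi]
      exact heightLE_one.mono (h1.trans hβ)
  obtain ⟨c, h2, h3, h4⟩ := Assortment.exists_approx hρ (fun _ => zero_le_one)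
    (Nat.cast_nonneg _) hinput (by omega) (fun _ => heightLE_one.mono h1) hK' hload
  exact ⟨c, (hsum c).1 h2, h3, fun c' hc' => h4 c' ((hsum c').2 hc')⟩

theorem BudgetInst.exists_approx {ρ : ℝ} (hρ : ρ ≤ (8 / 9) ^ 3) (I : BudgetInst) :
    ∃ c : Fin I.n → ℕ, ∑ i, I.b i * (c i : ℚ) ≤ I.B ∧
      (Program.seq Algorithm.loadBudget Algorithm.main).Computes
        (I.toMarket.encode ++ (List.ofFn I.b ++ [I.B]))
        (List.ofFn fun i => (c i : ℚ)) ((timePoly (.seq Algorithm.loadBudget Algorithm.main)).eval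
          (bitLength (I.toMarket.encode ++ (List.ofFn I.b ++ [I.B])))) ∧
      ∀ c' : Fin I.n → ℕ, ∑ i, I.b i * (c' i : ℚ) ≤ I.B →
        ρ * I.toMarket.fluidRevenue c' ≤ I.toMarket.fluidRevenue c := by
  have hinput := Market.input (M := I.toMarket) (b := I.b) (B := I.B) (List.ofFn I.b ++ [I.B])
  have hb : ∀ i : Fin I.n, initial (I.toMarket.encode ++ (List.ofFn I.b ++ [I.B])) 0
      (2 + 2 * I.n + i) = I.b i := fun i => by
    refine (I.toMarket.getD_encode_tail (List.ofFn I.b ++ [I.B]) i).trans ?_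
    rw [List.getD_append _ _ _ _ (by simp)]
    simp
  have hB : initial (I.toMarket.encode ++ (List.ofFn I.b ++ [I.B])) 0 (2 + 3 * I.n) = I.B := by
    rw [show 2 + 3 * I.n = 2 + 2 * I.n + I.n by omega]
    refine (I.toMarket.getD_encode_tail (List.ofFn I.b ++ [I.B]) I.n).trans ?_
    rw [List.getD_append_right _ _ _ _ (by simp)]
    simp
  have hlen : (I.toMarket.encode ++ (List.ofFn I.b ++ [I.B])).length = 3 * I.n + 3 := by
    rw [List.length_append, Market.length_encode, List.length_append, List.length_ofFn,
      List.length_singleton]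
    omega
  generalize I.toMarket.encode ++ (List.ofFn I.b ++ [I.B]) = l at *
  have hb' : ∀ i, HeightLE (bitLength l) (I.b i) := fun i => hb i ▸ small_initial l _ _
  have hB' : HeightLE (bitLength l) I.B := hB ▸ small_initial l _ _
  have hbi : ∀ i (hi : i < I.n), (I.toMarket.data I.b I.B).b i = I.b ⟨i, hi⟩ := fun i hi =>
    Market.data_b ⟨i, hi⟩
  refine Assortment.exists_approx hρ I.b_nonneg I.B_nonneg hinput (by omega) hb' hB'
    (P := Algorithm.loadBudget) fun R β hβ hR hn hσ =>
      load_spec hinput hσ hR hn (fun i hi τ hτ h23 => ?_) (fun τ hτ => ?_)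
        (fun i hi => ?_) (hB'.mono hβ)
  · have h0 : τ 0 0 = I.n := by
      rw [hτ]
      exact hinput.n
    rw [Expr.eval_get_of_eq (k := 2 + 2 * I.n + i) (by simp [h0, h23]), hτ, hbi i hi]
    exact hb ⟨i, hi⟩
  · have h0 : τ 0 0 = I.n := by
      rw [hτ]
      exact hinput.n
    rw [Expr.eval_get_of_eq (k := 2 + 3 * I.n) (by simp [h0]), hτ, hB]
    rfl
  · rw [hbi i hi]
    exact (hb' _).mono hβ

theorem card_polyTimeApprox {ρ : ℝ} (hρ : ρ ≤ (8 / 9) ^ 3) : cardProblem.PolyTimeApprox ρ :=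
  ⟨_, _, fun I => let ⟨c, h1, h2, h3⟩ := CardInst.exists_approx hρ I; ⟨c, h1, h2, h3⟩⟩

theorem budget_polyTimeApprox {ρ : ℝ} (hρ : ρ ≤ (8 / 9) ^ 3) : budgetProblem.PolyTimeApprox ρ :=
  ⟨_, _, fun I => let ⟨c, h1, h2, h3⟩ := BudgetInst.exists_approx hρ I; ⟨c, h1, h2, h3⟩⟩

end Assortment

theorem theorem1 (ε : ℝ) (hε₀ : 0 < ε) (hε₁ : ε < 1) :
    Assortment.cardProblem.PolyTimeApprox (1 - 1 / Real.exp 1 - ε) ∧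
      Assortment.budgetProblem.PolyTimeApprox (1 - 1 / Real.exp 1 - ε) := by
  -- From e < 3 follows 1 - 1/e < 2/3, while (8/9)^3 = 512/729 > 2/3.
  have hρ : 1 - 1 / Real.exp 1 - ε ≤ (8 / 9) ^ 3 := by
    have h1 : (1 : ℝ) / 3 ≤ 1 / Real.exp 1 :=
      one_div_le_one_div_of_le (Real.exp_pos 1) (by linarith [Real.exp_one_lt_d9])
    norm_num at h1 ⊢
    linarith
  exact ⟨Assortment.card_polyTimeApprox hρ, Assortment.budget_polyTimeApprox hρ⟩
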